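/- Let $D^2$ be the closed unit disk, let $P=\{p_1,\dots,p_n\}\subset \operatorname{int} D^2$ be a finite set of $n$ points, and let $\sigma_1,\dots,\sigma_n$ be a standard (geometric) system of generators of $\pi_1(D^2\setminus P)$, i.e. the image, under a homeomorphism of $D^2$, of the system based at the center of $D^2$ in which the punctures are $\tfrac12 e^{2\pi i j/n}$ and the $j$-th generator is a simple loop enclosing only the $j$-th puncture and staying in a thin sector about the ray through it. Let $F$ be compact Hausdorff and let $\phi:F\to D^2$ be a covering branched along $P$, i.e. a continuous map which is a covering map over $D^2\setminus P$ and has the form $z\mapsto z^m$, $m\ge 1$, in suitable coordinates around every point of $\phi^{-1}(P)$. Assume that $\phi$ is represented by a finite $n$-edge-colored graph $G$ which is a tree. (Edges with a common vertex have different colors; the vertices of $G$ are in bijection with the fibre over the base point in such a way that $\sigma_j$ acts on the fibre, by lifting paths, as the product of the transpositions $(v\ w)$ over all edges $[v,w]$ of color $j$.) Let $\alpha\subset\operatorname{int} D^2$ be an embedded arc joining two distinct points of $P$ and containing no other point of $P$, and let $\tau_\alpha: D^2\to D^2$ be a half-arc-twist along $\alpha$: on a closed disk neighborhood $N$ of $\alpha$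 in $\operatorname{int} D^2$ with $N\cap P=\alpha\cap P$, identified with the unit disk so that $\alpha=[-\tfrac12,\tfrac12]$, it is the rotation by $\pi$ on $|z|\le \tfrac12$ and the rotation by the angle $2\pi(1-|z|)$ at $z$ for $\tfrac12\le|z|\le1$; it is the identity outside $N$. For a connected component $\beta$ of $\phi^{-1}(\alpha)$ let $\operatorname{degree}(\beta)=|\phi^{-1}(q)\cap\beta|$, where $q$ is any interior point of $\alpha$. A homeomorphism $f$ of $D^2$ is said to lift if there is a homeomorphism $\tilde f:F\to F$ that fixes $\partial F=\phi^{-1}(\partial D^2)$ pointwise and satisfies $\phi\circ\tilde f=f\circ\phi$. Then, for every $k\in\mathbb Z$, $\tau_\alpha^k$ lifts if and only if $k$ is a multiple of $\operatorname{degree}(\beta)$ for every connected component $\beta$ of $\phi^{-1}(\alpha)$. -/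

import Mathlib

open Set

noncomputable section

namespace ArcTwist

/-- The closed unit disk `D²`. -/
abbrev Disk : Type := Metric.closedBall (0 : ℂ) 1

/-! ### Edge-colored graphs and their permutation representations -/

section Graph

variable {V : Type*} {G : SimpleGraph V} {n : ℕ}

/-- `w` is joined to `v` by an edge of color `i`.  An `n`-edge-coloring, in which consecutive edges
are labeled differently, is a proper vertex coloring of the line graph. -/
def ColoredAdj (c : G.lineGraph.Coloring (Fin n)) (i : Fin n) (v w : V) : Prop :=
  ∃ h : G.Adj v w, c ⟨s(v, w), h⟩ = i

theorem ColoredAdj.symm {c : G.lineGraph.Coloring (Fin n)} {i : Fin n} {v w : V}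
    (h : ColoredAdj c i v w) : ColoredAdj c i w v := by
  obtain ⟨hvw, hc⟩ := h
  refine ⟨hvw.symm, ?_⟩
  rw [← hc]
  congr 1
  exact Subtype.ext Sym2.eq_swap

theorem ColoredAdj.unique {c : G.lineGraph.Coloring (Fin n)} {i : Fin n} {v w w' : V}
    (h : ColoredAdj c i v w) (h' : ColoredAdj c i v w') : w = w' := by
  obtain ⟨hvw, hc⟩ := h
  obtain ⟨hvw', hc'⟩ := h'
  by_contra hne
  refine c.valid (v := ⟨s(v, w), hvw⟩) (w := ⟨s(v, w'), hvw'⟩) ?_ (hc.trans hc'.symm)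
  rw [SimpleGraph.lineGraph_adj_iff_exists]
  refine ⟨?_, v, by simp, by simp⟩
  intro he
  have he' : s(v, w) = s(v, w') := congrArg Subtype.val he
  exact hne (Sym2.congr_right.mp he')

open Classical in
/-- The underlying function of the product of the transpositions `(v w)` over all edges of
color `i`. -/
def colorSwap (c : G.lineGraph.Coloring (Fin n)) (i : Fin n) (v : V) : V :=
  if h : ∃ w, ColoredAdj c i v w then h.choose else v

theorem colorSwap_of_adj {c : G.lineGraph.Coloring (Fin n)} {i : Fin n} {v w : V}
    (h : ColoredAdj c i v w) : colorSwap c i v = w := by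
  have hex : ∃ w, ColoredAdj c i v w := ⟨w, h⟩
  rw [colorSwap, dif_pos hex]
  exact hex.choose_spec.unique h

theorem colorSwap_involutive (c : G.lineGraph.Coloring (Fin n)) (i : Fin n) :
    Function.Involutive (colorSwap c i) := by
  intro v
  by_cases h : ∃ w, ColoredAdj c i v w
  · obtain ⟨w, hw⟩ := h
    rw [colorSwap_of_adj hw, colorSwap_of_adj hw.symm]
  · have : colorSwap c i v = v := by rw [colorSwap, dif_neg h]
    rw [this, this]

/-- The representation `F_n → Sym(V)` of an `n`-colored graph: the `i`-th generator goes to the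
product of the (disjoint) transpositions `(v w)` over all edges `[v, w]` of color `i`. -/
def rho (c : G.lineGraph.Coloring (Fin n)) : FreeGroup (Fin n) →* Equiv.Perm V :=
  FreeGroup.lift fun i => (colorSwap_involutive c i).toPerm

end Graph

/-! ### The standard `n`-punctured disk and its standard generators -/

/-- The center of the disk. -/
def center : Disk := ⟨0, by simp⟩

/-- The `j`-th standard puncture `(1/2) e^{2πij/n}`. -/
def stdPoint (n : ℕ) (j : Fin n) : Disk :=
  ⟨((1 / 2 : ℝ) : ℂ) * Complex.exp (((2 * Real.pi * j / n : ℝ) : ℂ) * Complex.I), by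
    rw [mem_closedBall_zero_iff, norm_mul, Complex.norm_exp_ofReal_mul_I, Complex.norm_real]
    norm_num⟩

/-- The `j`-th standard generator of `π₁(D² - {punctures}, center)`: the simple loop, given in polar
coordinates by `r = (3/4) sin(πt)`, `θ = 2πj/n + (π/n)(t - 1/2)` for `0 ≤ t ≤ 1`.  It stays in a
sector of angle `π/n` about the ray through the `j`-th puncture, crosses this ray once, beyond the
puncture, and so runs once around the `j`-th puncture and around no other one. -/
def stdLoop (n : ℕ) (j : Fin n) (t : unitInterval) : Disk :=
  ⟨((3 / 4 * Real.sin (Real.pi * t) : ℝ) : ℂ) *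
      Complex.exp (((2 * Real.pi * j / n + Real.pi / n * (t - 1 / 2) : ℝ) : ℂ) * Complex.I), by
    rw [mem_closedBall_zero_iff, norm_mul, Complex.norm_exp_ofReal_mul_I, Complex.norm_real,
      Real.norm_eq_abs, abs_mul, mul_one]
    have h1 := Real.abs_sin_le_one (Real.pi * t)
    have h2 : |(3 / 4 : ℝ)| = 3 / 4 := abs_of_pos (by norm_num)
    rw [h2]
    linarith⟩

/-- The set `P` of punctures obtained from the standard ones by a homeomorphism of the disk. -/
def punctures (n : ℕ) (H : Disk ≃ₜ Disk) : Set Disk := range fun j => H (stdPoint n j)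

/-! ### Branched covers of the disk -/

section Cover

variable {F : Type*} [TopologicalSpace F]

/-- `φ` is a covering of the disk branched along `P`: an ordinary covering map over the complement
of `P`, and of the form `z ↦ z ^ m`, `m ≥ 1`, in suitable coordinates around each point over `P`. -/
structure IsBranchedCover (φ : C(F, Disk)) (P : Set Disk) : Prop where
  covering : IsCoveringMapOn φ Pᶜ
  local_form : ∀ x, φ x ∈ P → ∃ (m : ℕ) (u : OpenPartialHomeomorph F ℂ)
    (v : OpenPartialHomeomorph Disk ℂ), 0 < m ∧
      x ∈ u.source ∧ u x = 0 ∧ u.target = Metric.ball 0 1 ∧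
      φ x ∈ v.source ∧ v (φ x) = 0 ∧ v.target = Metric.ball 0 1 ∧
      ∀ y ∈ u.source, φ y ∈ v.source ∧ v (φ y) = u y ^ m

/-- The edge-colored graph `(G, c)` represents `φ` with respect to the base point `H center` and the
generators `H ∘ stdLoop n j`: the vertices are identified by a bijection with the fibre over the
base point, in such a way that the generators act on the fibre, by lifting of paths, through the
representation `rho c`. -/
def IsRepresentedBy {V : Type*} {G : SimpleGraph V} {n : ℕ} (φ : C(F, Disk)) (H : Disk ≃ₜ Disk)
    (c : G.lineGraph.Coloring (Fin n)) : Prop :=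
  ∃ e : V ≃ (φ ⁻¹' {H center} : Set F), ∀ (j : Fin n) (v : V),
    ∃ L : C(unitInterval, F), L 0 = e v ∧ L 1 = e (rho c (FreeGroup.of j) v) ∧
      ∀ t, φ (L t) = H (stdLoop n j t)

/-- A homeomorphism `f` of the disk lifts under `φ` if there is an automorphism `g` of `F` that
fixes `∂F = φ⁻¹(∂D²)` pointwise, with `φ ∘ g = f ∘ φ`. -/
def Lifts (φ : C(F, Disk)) (f : Disk ≃ₜ Disk) : Prop :=
  ∃ g : F ≃ₜ F, (∀ x, ‖(φ x : ℂ)‖ = 1 → g x = x) ∧ ∀ x, φ (g x) = f (φ x)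

/-- `β` is a connected component of `φ⁻¹(α)`. -/
def IsComponentOver (φ : C(F, Disk)) (α : Set Disk) (β : Set F) : Prop :=
  ∃ x ∈ φ ⁻¹' α, β = connectedComponentIn (φ ⁻¹' α) x

/-- The number of points of `β` over `q`; for `β` a connected component of `φ⁻¹(α)` and `q` in the
interior of the arc `α` this is the degree of `β`. -/
def degreeAt (φ : C(F, Disk)) (q : Disk) (β : Set F) : ℕ := (φ ⁻¹' {q} ∩ β).ncard

end Cover

/-! ### Arcs and half-arc-twists -/

/-- `α` is an embedded arc in the interior of the disk which meets `P` exactly in its two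
(distinct) endpoints. -/
def IsArcJoining (P α : Set Disk) : Prop :=
  ∃ γ : C(unitInterval, Disk), Function.Injective γ ∧ range γ = α ∧
    (∀ t, ‖(γ t : ℂ)‖ < 1) ∧ ∀ t, γ t ∈ P ↔ t = 0 ∨ t = 1

/-- The model half-twist of the unit disk: rotation by `π` on `‖z‖ ≤ 1/2`, and on the annulus
`1/2 ≤ ‖z‖ ≤ 1` rotation by an angle that decreases linearly in `‖z‖` from `π` to `0`. -/
def stdTwist (z : Disk) : Disk :=
  ⟨(z : ℂ) * Complex.exp (((Real.pi * min 1 (2 * (1 - ‖(z : ℂ)‖)) : ℝ) : ℂ) * Complex.I), by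
    rw [mem_closedBall_zero_iff, norm_mul, Complex.norm_exp_ofReal_mul_I, mul_one]
    exact mem_closedBall_zero_iff.mp z.2⟩

/-- `τ` is a half-arc-twist along `α` of the disk with marked points `P`: for a regular neighborhood
of `α`, i.e. a closed disk `h(D²)` in the interior of the disk in which `α` is the straight segment
`h([-1/2, 1/2])` and which contains no point of `P` off `α`, `τ` is the model half-twist in the
coordinates `h`, and `τ` is the identity outside this neighborhood. -/
def IsHalfArcTwist (P α : Set Disk) (τ : Disk ≃ₜ Disk) : Prop :=
  ∃ h : Disk → Disk, Topology.IsEmbedding h ∧ (∀ z, ‖(h z : ℂ)‖ < 1) ∧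
    h '' {z | (z : ℂ).im = 0 ∧ |(z : ℂ).re| ≤ 1 / 2} = α ∧ range h ∩ P ⊆ α ∧
    (∀ z, τ (h z) = h (stdTwist z)) ∧ ∀ x, x ∉ range h → τ x = x

end ArcTwist

end

section

open Topology Filter
open scoped unitInterval

namespace ArcTwist

/-! ### Lifting maps and logarithms through coverings -/

section Covering

variable {E B : Type*} [TopologicalSpace E] [TopologicalSpace B] {p : E → B} {S : Set B}
variable {T : Type*} [NormedAddCommGroup T] [NormedSpace ℝ T] {A : Set T}

/-! In the coordinates of the twist, `α` is the segment `[-1/2, 1/2]` of the unit disk. The real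
axis cuts the disk without `±1/2` into two star-convex halves, over which `φ` has sections `sm v`
and `sp v` indexed by the fibre over `0`. Sections with the same index agree across the open
segment; beyond the right and the left puncture they are matched by maps `a` and `b` of the fibre.
Each generator acts as a product of disjoint transpositions, and whether the square of the local
monodromy is trivial does not depend on the coordinate disk (`DoublePeriodic.of_chart`). Hence `a`
and `b` are involutions.

Lifting criterion. Let `N` be the support of the twist. A point outside `N` and `P` can be joined to
the boundary circle off `N` and `P` (`joinedIn_boundary`, by Eilenberg's criterion), so a lift of `τ
^ k` fixing `∂F` is the identity over there, and then over `∂N`. Over each half of `N` it is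
therefore the unique lift of the `k`-fold twist with given boundary values, and the only question is
whether the two lifts agree over `0`. One more half-twist drags a radius past one puncture, which
exchanges the halves and applies `a` or `b` (`spiral_lift`). So the lifts agree exactly when `(b a)
^ k = 1` (`twistLifts_zero_iff`, `lifts_iff`).

Degrees. The closed lifts of `α` are joined at their ends by `a` and `b`, so the components of the
preimage correspond to the orbits of the dihedral group generated by `a` and `b`, and the degree is
the size of the orbit (`mem_component_iff`). Such an orbit is either one cycle of `b a`, or two
cycles of equal length exchanged by `a`. The second case is that of a circle, and it occurs exactly
when the orbit carries a nonzero function `ε` with `ε ∘ a = ε ∘ b = -ε`. It remains to exclude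
circles, and this is where the tree is needed.

No circles. Morally, `F` is a disk, and a circle in its interior cannot have both of its sides
connected to `∂F`. To make this precise, an alternating `ε` yields a nowhere vanishing function on
`F` off the branch fibres that is `1` off `N` and winds `ε v` times along the lift with index `v` of
a diameter crossing the arc (`alternating_eq_zero`). On a tree every antisymmetric function of the
edges is a coboundary, so this function has a global logarithm (`exists_log`). The logarithm is
constant over the boundary circle (`eq_on_boundary`): its jumps there form a divergence-free
gradient, which vanishes (`IsTreeAction.eq_of_cyclic`). It is then the same constant over `∂N`, so
the winding numbers `ε v` are zero. -/

/-- Two lifts of the same map on a preconnected set agree as soon as they agree at one point. -/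
theorem eqOn_of_lifts {X : Type*} [TopologicalSpace X] {A : Set X}
    (hp : IsCoveringMapOn p S) (hA : IsPreconnected A) {f g : X → E}
    (hf : ContinuousOn f A) (hg : ContinuousOn g A) (hfS : ∀ a ∈ A, p (f a) ∈ S)
    (hfg : ∀ a ∈ A, p (f a) = p (g a)) {a : X} (ha : a ∈ A) (hfa : f a = g a) :
    EqOn f g A := by
  have hq := hp.isCoveringMap_restrictPreimage
  have : PreconnectedSpace A := Subtype.preconnectedSpace hA
  let f' : A → p ⁻¹' S := fun a => ⟨f a, hfS a a.2⟩
  let g' : A → p ⁻¹' S := fun a => ⟨g a, by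
    have := hfS a a.2
    rwa [hfg a a.2] at this⟩
  have hf' : Continuous f' := (continuousOn_iff_continuous_domRestrict.mp hf).subtype_mk _
  have hg' : Continuous g' := (continuousOn_iff_continuous_domRestrict.mp hg).subtype_mk _
  have h := hq.eq_of_comp_eq hf' hg' (by
    funext b
    exact Subtype.ext (hfg b b.2)) ⟨a, ha⟩ (Subtype.ext hfa)
  intro b hb
  exact congrArg Subtype.val (congrFun h ⟨b, hb⟩)

/-- A map on a star-convex set lifts to a covering through any prescribed point. -/
theorem exists_lift_of_starConvex (hp : IsCoveringMapOn p S) {a₀ : T} (hA : StarConvex ℝ a₀ A)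
    {ψ : T → B} (hψ : ContinuousOn ψ A) (hS : MapsTo ψ A S) {z : T} (hz : z ∈ A) {x : E}
    (hx : p x = ψ z) :
    ∃ Ψ : T → E, ContinuousOn Ψ A ∧ Ψ z = x ∧ ∀ a ∈ A, p (Ψ a) = ψ a := by
  classical
  have hq := hp.isCoveringMap_restrictPreimage
  have hmem : ∀ (t : I) (a : A), a₀ + (t : ℝ) • ((a : T) - a₀) ∈ A := fun t a =>
    hA.add_smul_sub_mem a.2 t.2.1 t.2.2
  have ha₀ : a₀ ∈ A := by simpa using hmem 0 ⟨z, hz⟩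
  -- `H` contracts `A` to its center. The point `x` is first transported to the fibre over the
  -- center along the reversed segment `γ`; the contraction is then lifted starting from that
  -- constant, and uniqueness along the segment to `z` brings the lift back to `x`.
  let H : C(I × A, S) := ⟨fun ta => ⟨ψ (a₀ + (ta.1 : ℝ) • ((ta.2 : T) - a₀)), hS (hmem _ _)⟩, by
    refine Continuous.subtype_mk ?_ _
    exact hψ.comp_continuous (by fun_prop) fun ta => hmem _ _⟩
  let γ : C(I, S) := ⟨fun t => H (σ t, ⟨z, hz⟩), by fun_prop⟩
  have hγ0 : γ 0 = S.restrictPreimage p ⟨x, by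
      rw [mem_preimage, hx]
      exact hS hz⟩ := by
    apply Subtype.ext
    simp [γ, H, hx]
  let L := hq.liftPath γ _ hγ0
  have hL : ∀ t, S.restrictPreimage p (L t) = γ t := fun t => congrFun (hq.liftPath_lifts γ _ hγ0) t
  have hL0 : L 0 = _ := hq.liftPath_zero γ _ hγ0
  let f : C(A, p ⁻¹' S) := ContinuousMap.const _ (L 1)
  have hH0 : ∀ a, H (0, a) = S.restrictPreimage p (f a) := by
    intro a
    rw [show f a = L 1 from rfl, hL 1]
    apply Subtype.ext
    simp [γ, H]
  let K := hq.liftHomotopy H f hH0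
  have hK : ∀ ta, S.restrictPreimage p (K ta) = H ta := fun ta =>
    congrFun (hq.liftHomotopy_lifts H f hH0) ta
  have hK0 : ∀ a, K (0, a) = L 1 := fun a => hq.liftHomotopy_zero H f hH0 a
  refine ⟨fun a => if h : a ∈ A then (K (1, ⟨a, h⟩) : E) else x, ?_, ?_, ?_⟩
  · rw [continuousOn_iff_continuous_domRestrict]
    have : Continuous fun a : A => (K (1, a) : E) := by fun_prop
    refine this.congr fun a => ?_
    simp
  · have h := hq.eq_of_comp_eq (g₁ := fun t : I => K (t, ⟨z, hz⟩)) (g₂ := fun t : I => L (σ t))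
      (by fun_prop) (by fun_prop) (by
        funext t
        simp only [Function.comp_apply, hK, hL]
        simp [γ]) 0 (by simp [hK0])
    have h1 := congrFun h 1
    simp only [unitInterval.symm_one, hL0] at h1
    simp [hz, h1]
  · intro a ha
    have := congrArg Subtype.val (hK (1, ⟨a, ha⟩))
    simpa [ha, H] using this

theorem exists_lift_of_convex (hp : IsCoveringMapOn p S) (hA : Convex ℝ A)
    {ψ : T → B} (hψ : ContinuousOn ψ A) (hS : MapsTo ψ A S) {z : T} (hz : z ∈ A) {x : E}
    (hx : p x = ψ z) :
    ∃ Ψ : T → E, ContinuousOn Ψ A ∧ Ψ z = x ∧ ∀ a ∈ A, p (Ψ a) = ψ a :=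
  exists_lift_of_starConvex hp (hA hz) hψ hS hz hx

theorem exists_lift_path (hp : IsCoveringMapOn p S) {γ : C(I, B)} (hγ : ∀ t, γ t ∈ S) {x : E}
    (hx : p x = γ 0) : ∃ L : C(I, E), L 0 = x ∧ ∀ t, p (L t) = γ t := by
  have hq := hp.isCoveringMap_restrictPreimage
  let γ' : C(I, S) := ⟨fun t => ⟨γ t, hγ t⟩, by fun_prop⟩
  obtain ⟨L, hL, hL0⟩ := hq.exists_path_lifts γ' ⟨x, by rw [mem_preimage, hx]; exact hγ 0⟩
    (Subtype.ext hx.symm)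
  refine ⟨⟨fun t => L t, by fun_prop⟩, by simp [hL0], fun t => ?_⟩
  exact congrArg Subtype.val (congrFun hL t)

/-- A nonvanishing function on a star-convex set has a continuous logarithm, with any prescribed
value at one point. -/
theorem exists_log_of_starConvex {a₀ : T} (hA : StarConvex ℝ a₀ A) {ψ : T → ℂ}
    (hψ : ContinuousOn ψ A) (h0 : ∀ a ∈ A, ψ a ≠ 0) {z : T} (hz : z ∈ A) {x : ℂ}
    (hx : Complex.exp x = ψ z) :
    ∃ Ψ : T → ℂ, ContinuousOn Ψ A ∧ Ψ z = x ∧ ∀ a ∈ A, Complex.exp (Ψ a) = ψ a :=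
  exists_lift_of_starConvex Complex.isCoveringMapOn_exp hA hψ (fun a ha => h0 a ha) hz hx

/-- Two logarithms of the same function on a preconnected set differ by a constant. -/
theorem log_sub_log_const {X : Type*} [TopologicalSpace X] {A : Set X} (hA : IsPreconnected A)
    {f g : X → ℂ} (hf : ContinuousOn f A) (hg : ContinuousOn g A)
    (hfg : ∀ a ∈ A, Complex.exp (f a) = Complex.exp (g a)) {a b : X} (ha : a ∈ A) (hb : b ∈ A) :
    f a - g a = f b - g b := by
  have h := eqOn_of_lifts (f := fun x => f x) (g := fun x => g x + (f a - g a))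
    Complex.isCoveringMapOn_exp hA hf (hg.add continuousOn_const)
    (fun a _ => Complex.exp_ne_zero _) (fun x hx => by
      rw [hfg x hx, Complex.exp_add, Complex.exp_sub, hfg a ha,
        div_self (Complex.exp_ne_zero _), mul_one]) ha (by ring)
  have := h hb
  simp only at this
  rw [this]
  ring

end Covering

end ArcTwist

namespace ArcTwist

/-! ### Logarithms and separation in the disk -/

section Plane

/-- The nearest-point projection of the plane to the disk, up to rescaling. -/
noncomputable def pr (z : ℂ) : Disk :=
  ⟨((max 1 ‖z‖)⁻¹ : ℝ) • z, by
    have h1 : 0 < max 1 ‖z‖ := lt_of_lt_of_le one_pos (le_max_left _ _)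
    rw [mem_closedBall_zero_iff, norm_smul, Real.norm_eq_abs, abs_of_pos (inv_pos.mpr h1),
      inv_mul_le_iff₀ h1, mul_one]
    exact le_max_right _ _⟩

theorem continuous_pr : Continuous pr := by
  refine Continuous.subtype_mk ?_ _
  have : Continuous fun z : ℂ => (max 1 ‖z‖)⁻¹ :=
    (by fun_prop : Continuous fun z : ℂ => max 1 ‖z‖).inv₀
      fun z => (lt_of_lt_of_le one_pos (le_max_left _ _)).ne'
  fun_prop

theorem coe_pr {z : ℂ} (hz : ‖z‖ ≤ 1) : (pr z : ℂ) = z := by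
  simp [pr, max_eq_left hz]

theorem pr_coe (z : Disk) : pr z = z :=
  Subtype.ext (coe_pr (mem_closedBall_zero_iff.mp z.2))

theorem norm_coe_le (z : Disk) : ‖(z : ℂ)‖ ≤ 1 := mem_closedBall_zero_iff.mp z.2

/-- The inclusion of the unit circle, shifted by a vector of norm less than one, has no continuous
logarithm. -/
theorem no_log_on_circle {y : ℂ} (hy : ‖y‖ < 1) {f : ℂ → ℂ}
    (hf : ContinuousOn f {z | ‖z‖ = 1}) (he : ∀ z, ‖z‖ = 1 → Complex.exp (f z) = z - y) : False := by
  have hn : ∀ t : ℝ, ‖Complex.exp (t * Complex.I)‖ = 1 := Complex.norm_exp_ofReal_mul_I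
  -- The factorization `e^{it} - y = e^{it} (1 - y e^{-it})` has a second factor with positive real
  -- part. Subtracting its principal logarithm leaves a `2π`-periodic logarithm of `e^{it}`, which
  -- cannot differ from `it` by a constant.
  have hslit : ∀ t : ℝ, 1 - y * Complex.exp (-(t * Complex.I)) ∈ Complex.slitPlane := by
    intro t
    refine Or.inl ?_
    have h1 : ‖y * Complex.exp (-(t * Complex.I))‖ < 1 := by
      rw [norm_mul, Complex.exp_neg, norm_inv, hn]
      simpa using hy
    have h2 := (abs_le.mp (Complex.abs_re_le_norm (y * Complex.exp (-(t * Complex.I))))).2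
    simp only [Complex.sub_re, Complex.one_re]
    linarith
  have hg : Continuous fun t : ℝ => f (Complex.exp (t * Complex.I)) -
      Complex.log (1 - y * Complex.exp (-(t * Complex.I))) := by
    refine Continuous.sub ?_ ?_
    · exact hf.comp_continuous (by fun_prop) fun t => hn t
    · exact Continuous.clog (by fun_prop) hslit
  have key := log_sub_log_const (A := (univ : Set ℝ)) isPreconnected_univ hg.continuousOn
    (g := fun t : ℝ => (t * Complex.I : ℂ)) (by fun_prop) (by
      intro t _
      have hne : 1 - y * Complex.exp (-(t * Complex.I)) ≠ 0 := Complex.slitPlane_ne_zero (hslit t)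
      rw [Complex.exp_sub, he _ (hn t), Complex.exp_log hne, div_eq_iff hne, mul_sub, mul_one,
        mul_left_comm, ← Complex.exp_add]
      simp) (mem_univ 0) (mem_univ (2 * Real.pi))
  have h2 : Complex.exp (((2 * Real.pi : ℝ) : ℂ) * Complex.I) = 1 := by
    push_cast
    exact Complex.exp_two_pi_mul_I
  simp only [Complex.exp_neg, h2] at key
  simp only [Complex.ofReal_zero, zero_mul, Complex.exp_zero, inv_one, mul_one] at key
  have h3 : ((2 * Real.pi : ℝ) : ℂ) * Complex.I = 0 := by linear_combination key
  simp [Real.pi_ne_zero] at h3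

/-- A homeomorphism of the disk preserves the boundary circle. -/
theorem norm_homeomorph_eq_one (H : Disk ≃ₜ Disk) {x : Disk} (hx : ‖(x : ℂ)‖ = 1) :
    ‖(H x : ℂ)‖ = 1 := by
  by_contra hne
  have hlt : ‖(H x : ℂ)‖ < 1 := lt_of_le_of_ne (norm_coe_le _) hne
  -- The disk without a boundary point is star-shaped, so `H - H x` has a logarithm there. If `H x`
  -- were interior, the preimage of the circle would avoid `x`, and transport by `H⁻¹` would give
  -- the excluded logarithm.
  have hstar : StarConvex ℝ (0 : ℂ) {z : ℂ | ‖z‖ ≤ 1 ∧ z ≠ x} := by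
    rw [starConvex_zero_iff]
    rintro z ⟨hz, hzx⟩ t ht0 ht1
    refine ⟨?_, ?_⟩
    · rw [norm_smul, Real.norm_of_nonneg ht0]
      exact mul_le_one₀ ht1 (norm_nonneg _) hz
    · intro h
      have h1 : t * ‖z‖ = 1 := by
        rw [← hx, ← h, norm_smul, Real.norm_of_nonneg ht0]
      have : t = 1 := by nlinarith [norm_nonneg z]
      rw [this, one_smul] at h
      exact hzx h
  have h0 : ∀ a ∈ {z : ℂ | ‖z‖ ≤ 1 ∧ z ≠ x}, (H (pr a) : ℂ) - H x ≠ 0 := by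
    rintro a ⟨ha, hax⟩ h
    have := H.injective (Subtype.ext (sub_eq_zero.mp h))
    exact hax (by rw [← coe_pr ha, this])
  have hx0 : (x : ℂ) ≠ 0 := by
    intro h
    simp [h] at hx
  have h0mem : (0 : ℂ) ∈ {z : ℂ | ‖z‖ ≤ 1 ∧ z ≠ x} := ⟨by simp, hx0.symm⟩
  obtain ⟨Ψ, hΨ, -, hexp⟩ := exists_log_of_starConvex hstar
    (ψ := fun z => (H (pr z) : ℂ) - H x)
    ((continuous_subtype_val.comp (H.continuous.comp continuous_pr)).sub
      continuous_const).continuousOn h0 h0mem (Complex.exp_log (h0 0 h0mem))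
  have hmem : ∀ z : ℂ, ‖z‖ = 1 → (H.symm (pr z) : ℂ) ∈ {z : ℂ | ‖z‖ ≤ 1 ∧ z ≠ x} := by
    intro z hz
    refine ⟨norm_coe_le _, fun h => ?_⟩
    have h1 : H.symm (pr z) = x := Subtype.ext h
    rw [Homeomorph.symm_apply_eq] at h1
    rw [← h1, coe_pr hz.le, hz] at hlt
    exact lt_irrefl _ hlt
  refine no_log_on_circle hlt (f := fun z => Ψ (H.symm (pr z))) ?_ ?_
  · refine hΨ.comp ?_ fun z hz => hmem z hz
    exact (continuous_subtype_val.comp (H.symm.continuous.comp continuous_pr)).continuousOn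
  · intro z hz
    rw [hexp _ (hmem z hz), pr_coe, H.apply_symm_apply, coe_pr hz.le]

instance : LocallyPathConnectedSpace Disk :=
  Convex.locallyPathConnectedSpace ℂ (convex_closedBall (0 : ℂ) 1)

instance : PreconnectedSpace Disk :=
  Subtype.preconnectedSpace (convex_closedBall (0 : ℂ) 1).isPreconnected

/-- Eilenberg's separation criterion: a point off a closed set `K` can be joined in the complement
of `K` to the boundary circle, if the translation by it has a continuous logarithm on `K`. -/
theorem exists_joinedIn_boundary {K : Set Disk} (hK : IsClosed K) {y : Disk} (hy : y ∉ K)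
    {L : Disk → ℂ} (hL : ContinuousOn L K) (hexp : ∀ z ∈ K, Complex.exp (L z) = (z : ℂ) - y) :
    ∃ b : Disk, ‖(b : ℂ)‖ = 1 ∧ JoinedIn Kᶜ y b := by
  classical
  by_contra! hcon
  set C := pathComponentIn Kᶜ y with hC
  have hyC : y ∈ C := mem_pathComponentIn_self hy
  have hCo : IsOpen C := hK.isOpen_compl.pathComponentIn y
  have hCb : ∀ b ∈ C, ‖(b : ℂ)‖ ≠ 1 := fun b hb h => hcon b h hb
  have hCK : IsClosed (C ∪ K) := by
    rw [← isOpen_compl_iff, isOpen_iff_mem_nhds]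
    intro w hw
    rw [compl_union] at hw
    refine mem_of_superset ((hK.isOpen_compl.pathComponentIn w).mem_nhds
      (mem_pathComponentIn_self hw.2)) ?_
    intro u hu hu'
    rcases hu' with hu' | hu'
    · exact hw.1 (JoinedIn.trans hu' (JoinedIn.symm hu))
    · exact pathComponentIn_subset hu hu'
  -- If the component `C` of `y` misses the circle, extend the logarithm by Tietze and replace `z -
  -- y` by `exp L'` on `C`. The result `G` has no zero on the disk, hence a logarithm, yet equals `z
  -- - y` on the circle.
  obtain ⟨L', hL'⟩ := ContinuousMap.exists_restrict_eq hK
    ⟨K.domRestrict L, continuousOn_iff_continuous_domRestrict.mp hL⟩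
  have hL'K : ∀ z ∈ K, L' z = L z := fun z hz => DFunLike.congr_fun hL' ⟨z, hz⟩
  let G : Disk → ℂ := fun z => if z ∈ C then Complex.exp (L' z) else (z : ℂ) - y
  have hG1 : EqOn G (fun z => Complex.exp (L' z)) (C ∪ K) := by
    rintro z (hz | hz)
    · simp [G, hz]
    · by_cases h : z ∈ C
      · simp [G, h]
      · simp [G, h, hL'K z hz, hexp z hz]
  have hG2 : EqOn G (fun z => (z : ℂ) - y) Cᶜ := fun z hz => by simp [G, show z ∉ C from hz]
  have hGc : Continuous G := by
    rw [← continuousOn_univ, show (univ : Set Disk) = (C ∪ K) ∪ Cᶜ by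
      ext z; by_cases h : z ∈ C <;> simp [h]]
    refine ContinuousOn.union_of_isClosed ?_ ?_ hCK hCo.isClosed_compl
    · exact ContinuousOn.congr (by fun_prop) hG1
    · exact ContinuousOn.congr (by fun_prop) hG2
  have hG0 : ∀ z, G z ≠ 0 := by
    intro z
    by_cases h : z ∈ C
    · simp [G, h, Complex.exp_ne_zero]
    · simp only [G, h, if_false]
      intro h'
      have : z = y := Subtype.ext (sub_eq_zero.mp h')
      exact h (this ▸ hyC)
  obtain ⟨Ψ, hΨ, -, hΨe⟩ := exists_log_of_starConvex
    (A := (univ : Set ℂ)) (convex_univ (mem_univ 0)) (ψ := fun z => G (pr z))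
    (hGc.comp continuous_pr).continuousOn (fun a _ => hG0 _) (mem_univ 0)
    (Complex.exp_log (hG0 _))
  have hylt : ‖(y : ℂ)‖ < 1 := lt_of_le_of_ne (norm_coe_le _) (hCb y hyC)
  refine no_log_on_circle hylt (hΨ.mono (subset_univ _)) fun z hz => ?_
  have hzC : pr z ∉ C := fun h => hCb _ h (by rw [coe_pr hz.le, hz])
  rw [hΨe z (mem_univ _)]
  simp [G, hzC, coe_pr hz.le]

/-- Punctured balls in the disk, around interior points, are preconnected. -/
theorem isPreconnected_punctured_ball {y : Disk} {ε : ℝ} (hε : 0 < ε) (hy : ‖(y : ℂ)‖ + ε ≤ 1) :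
    IsPreconnected {w : Disk | w ≠ y ∧ dist w y < ε} := by
  -- The punctured ball is the image of a half-plane under the exponential centered at `y`.
  have h1 : {w : Disk | w ≠ y ∧ dist w y < ε} =
      (fun w : ℂ => pr (y + Complex.exp w)) '' {w | w.re < Real.log ε} := by
    ext w
    constructor
    · rintro ⟨hw, hd⟩
      have hne : (w : ℂ) - y ≠ 0 := fun h => hw (Subtype.ext (sub_eq_zero.mp h))
      refine ⟨Complex.log (w - y), ?_, ?_⟩
      · rw [mem_ofPred_eq, Complex.log_re]
        refine Real.log_lt_log (norm_pos_iff.mpr hne) ?_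
        rwa [← dist_eq_norm]
      · simp only
        rw [Complex.exp_log hne, add_sub_cancel, pr_coe]
    · rintro ⟨u, hu, rfl⟩
      have hu' : ‖Complex.exp u‖ < ε := by
        rw [Complex.norm_exp, ← Real.lt_log_iff_exp_lt hε]
        exact hu
      have hle : ‖(y : ℂ) + Complex.exp u‖ ≤ 1 := (norm_add_le _ _).trans (by linarith)
      refine ⟨fun h => ?_, ?_⟩
      · have := congrArg Subtype.val h
        rw [coe_pr hle] at this
        simp [Complex.exp_ne_zero] at this
      · rw [Subtype.dist_eq, coe_pr hle, dist_eq_norm]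
        simpa using hu'
  rw [h1]
  refine IsPreconnected.image ?_ _ ?_
  · exact (convex_halfSpace_re_lt _).isPreconnected
  · exact (continuous_pr.comp (by fun_prop)).continuousOn

end Plane

end ArcTwist

namespace ArcTwist

/-! ### The model twist and its neighborhood -/

/-- The `k`-th power of the model half-twist, on the plane. -/
noncomputable def twist (k : ℤ) (z : ℂ) : ℂ :=
  z * Complex.exp (((Real.pi * k * min 1 (2 * (1 - ‖z‖)) : ℝ) : ℂ) * Complex.I)

theorem norm_twist (k : ℤ) (z : ℂ) : ‖twist k z‖ = ‖z‖ := by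
  rw [twist, norm_mul, Complex.norm_exp_ofReal_mul_I, mul_one]

theorem continuous_twist (k : ℤ) : Continuous (twist k) := by
  unfold twist
  fun_prop

theorem twist_add (k l : ℤ) (z : ℂ) : twist (k + l) z = twist k (twist l z) := by
  rw [show twist k (twist l z) = twist l z * _ from rfl, norm_twist, twist, twist, mul_assoc z,
    ← Complex.exp_add]
  congr 2
  push_cast
  ring

theorem twist_zero (z : ℂ) : twist 0 z = z := by simp [twist]

theorem twist_of_norm_eq_one (k : ℤ) {z : ℂ} (hz : ‖z‖ = 1) : twist k z = z := by
  simp [twist, hz]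

theorem twist_one_of_norm_le {z : ℂ} (hz : ‖z‖ ≤ 1 / 2) : twist 1 z = -z := by
  have : min 1 (2 * (1 - ‖z‖)) = 1 := min_eq_left (by linarith)
  simp [twist, this]

theorem twist_of_norm_le (k : ℤ) {z : ℂ} (hz : ‖z‖ ≤ 1 / 2) : twist k z = z ∨ twist k z = -z := by
  induction k using Int.induction_on with
  | zero => simp [twist_zero]
  | succ i ih =>
    rw [add_comm, twist_add]
    rcases ih with h | h
    · rw [h, twist_one_of_norm_le hz]
      simp
    · rw [h, twist_one_of_norm_le (by simpa using hz)]
      simp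
  | pred i ih =>
    have h0 : twist (-(i : ℤ)) z = twist 1 (twist (-(i : ℤ) - 1) z) := by
      rw [← twist_add]
      congr 1
      ring
    rw [twist_one_of_norm_le (by rwa [norm_twist])] at h0
    rw [h0] at ih
    rcases ih with h | h
    · exact Or.inr (neg_eq_iff_eq_neg.mp h)
    · exact Or.inl (neg_injective h)

/-- Precomposing a coordinate map with a twist thus creates no new points over the punctures
(`TwoPunctured.twist`). -/
theorem twist_half (k : ℤ) {z : ℂ} (h : twist k z = 1 / 2 ∨ twist k z = -(1 / 2)) :
    z = 1 / 2 ∨ z = -(1 / 2) := by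
  have hz : ‖z‖ ≤ 1 / 2 := by
    rw [← norm_twist k]
    rcases h with h | h <;> rw [h] <;> simp
  rcases twist_of_norm_le k hz with h' | h' <;> rw [h'] at h
  · exact h
  · rcases h with h | h
    · right
      rw [← h, neg_neg]
    · left
      exact neg_injective h

theorem coe_stdTwist (z : Disk) : (stdTwist z : ℂ) = twist 1 z := by
  simp [stdTwist, twist]

/-- A half-twist in the coordinates `h`. -/
structure TwistChart (P : Set Disk) (τ : Disk ≃ₜ Disk) (h : Disk → Disk) : Prop where
  emb : IsEmbedding h
  norm_lt : ∀ z, ‖(h z : ℂ)‖ < 1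
  twist : ∀ z, τ (h z) = h (stdTwist z)
  fixed : ∀ x, x ∉ range h → τ x = x

namespace TwistChart

variable {P : Set Disk} {τ : Disk ≃ₜ Disk} {h : Disk → Disk} (D : TwistChart P τ h)
include D

theorem isClosed_range : IsClosed (range h) :=
  (isCompact_range D.emb.continuous).isClosed

theorem continuous_chart : Continuous fun z : ℂ => h (pr z) :=
  D.emb.continuous.comp continuous_pr

theorem chart_injOn {z w : ℂ} (hz : ‖z‖ ≤ 1) (hw : ‖w‖ ≤ 1) (e : h (pr z) = h (pr w)) : z = w := by
  rw [← coe_pr hz, D.emb.injective e, coe_pr hw]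

theorem zpow_fixed (k : ℤ) {x : Disk} (hx : x ∉ range h) : (τ ^ k) x = x := by
  have h1 : τ x = x := D.fixed x hx
  have h2 : τ⁻¹ x = x := by
    nth_rewrite 1 [← h1]
    exact τ.symm_apply_apply x
  induction k using Int.induction_on with
  | zero => simp
  | succ i ih =>
    rw [zpow_add_one]
    change (τ ^ (i : ℤ)) (τ x) = x
    rw [h1, ih]
  | pred i ih =>
    rw [zpow_sub_one]
    change (τ ^ (-i : ℤ)) (τ⁻¹ x) = x
    rw [h2, ih]

theorem zpow_chart (k : ℤ) {z : ℂ} (hz : ‖z‖ ≤ 1) :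
    (τ ^ k) (h (pr z)) = h (pr (ArcTwist.twist k z)) := by
  have h1 : ∀ z : ℂ, ‖z‖ ≤ 1 → τ (h (pr z)) = h (pr (ArcTwist.twist 1 z)) := by
    intro z hz
    rw [D.twist]
    congr 1
    apply Subtype.ext
    rw [coe_stdTwist, coe_pr hz, coe_pr (by rwa [norm_twist])]
  have h2 : ∀ z : ℂ, ‖z‖ ≤ 1 → τ⁻¹ (h (pr z)) = h (pr (ArcTwist.twist (-1) z)) := by
    intro z hz
    have := h1 (ArcTwist.twist (-1) z) (by rwa [norm_twist])
    rw [← twist_add, add_neg_cancel, twist_zero] at this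
    rw [← this]
    exact τ.symm_apply_apply _
  induction k using Int.induction_on generalizing z with
  | zero => simp [twist_zero]
  | succ i ih =>
    rw [zpow_add_one]
    change (τ ^ (i : ℤ)) (τ (h (pr z))) = _
    rw [h1 z hz, ih (by rwa [norm_twist]), twist_add]
  | pred i ih =>
    rw [zpow_sub_one]
    change (τ ^ (-i : ℤ)) (τ⁻¹ (h (pr z))) = _
    rw [h2 z hz, ih (by rwa [norm_twist]), ← twist_add]
    rfl

/-- Limits of points outside the range are fixed by `τ`, so their coordinate is fixed by the model
twist. Its rotation angle lies in `[0, π]` and vanishes only on the unit circle, while the center is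
fixed by any rotation. -/
theorem eq_zero_or_norm_of_mem_closure {z : Disk} (hz : h z ∈ closure (range h)ᶜ) :
    (z : ℂ) = 0 ∨ ‖(z : ℂ)‖ = 1 := by
  have h1 : τ (h z) = h z := by
    have : closure (range h)ᶜ ⊆ {x | τ x = x} :=
      closure_minimal (fun x hx => D.fixed x hx) (isClosed_eq τ.continuous continuous_id)
    exact this hz
  rw [D.twist] at h1
  have h2 := congrArg Subtype.val (D.emb.injective h1)
  rw [coe_stdTwist, ArcTwist.twist] at h2
  by_cases h0 : (z : ℂ) = 0
  · exact Or.inl h0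
  right
  have h3 := mul_left_cancel₀ h0 (h2.trans (mul_one _).symm)
  rw [Complex.exp_eq_one_iff] at h3
  obtain ⟨n, hn⟩ := h3
  have h4 : Real.pi * min 1 (2 * (1 - ‖(z : ℂ)‖)) = n * (2 * Real.pi) := by
    have := congrArg Complex.im hn
    simpa using this
  have hpi := Real.pi_pos
  have hz1 := norm_coe_le z
  have h5 : min 1 (2 * (1 - ‖(z : ℂ)‖)) = 2 * n := by
    apply mul_left_cancel₀ hpi.ne'
    rw [h4]
    ring
  have h6 : (n : ℝ) < 1 := by
    have := min_le_left 1 (2 * (1 - ‖(z : ℂ)‖))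
    linarith
  have h7 : (0 : ℝ) ≤ n := by
    have : 0 ≤ min 1 (2 * (1 - ‖(z : ℂ)‖)) := le_min zero_le_one (by linarith)
    linarith
  have h8 : n = 0 := by
    have : n < 1 := by exact_mod_cast h6
    have : 0 ≤ n := by exact_mod_cast h7
    omega
  rw [h8] at h5
  rcases min_choice 1 (2 * (1 - ‖(z : ℂ)‖)) with h | h <;> rw [h] at h5
  · simp at h5
  · push_cast at h5
    linarith

/-- Only the center has to be excluded. A small punctured ball about its image misses the image of
the circle, hence is covered by two disjoint open sets, the complement and the interior of the
range. It is connected, but it contains points `h t` with `t` small and, if the center were a limit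
of the outside, also points off the range. The twist thus takes the place of invariance of domain.
-/
theorem norm_eq_one_of_mem_closure {z : Disk} (hz : h z ∈ closure (range h)ᶜ) : ‖(z : ℂ)‖ = 1 := by
  rcases D.eq_zero_or_norm_of_mem_closure hz with h0 | h1
  swap
  · exact h1
  exfalso
  have hz0 : z = pr 0 := Subtype.ext (by rw [h0, coe_pr (by simp)])
  set y := h z with hy
  have hS : IsClosed (h '' {w : Disk | ‖(w : ℂ)‖ = 1}) := by
    refine (IsCompact.image ?_ D.emb.continuous).isClosed
    exact (isClosed_eq (by fun_prop) continuous_const).isCompact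
  have hyS : y ∉ h '' {w : Disk | ‖(w : ℂ)‖ = 1} := by
    rintro ⟨w, hw, hwy⟩
    rw [D.emb.injective hwy, mem_ofPred_eq, h0] at hw
    simp at hw
  obtain ⟨ε₁, hε₁, hball⟩ := Metric.isOpen_iff.mp hS.isOpen_compl y hyS
  have hyi : ‖(y : ℂ)‖ < 1 := D.norm_lt z
  set ε := min ε₁ (1 - ‖(y : ℂ)‖) with hε
  have hε0 : 0 < ε := lt_min hε₁ (by linarith)
  have hpre := isPreconnected_punctured_ball (y := y) hε0
    (by have := min_le_right ε₁ (1 - ‖(y : ℂ)‖); linarith)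
  have hsub : {w : Disk | w ≠ y ∧ dist w y < ε} ⊆ (range h)ᶜ ∪ (closure (range h)ᶜ)ᶜ := by
    rintro w ⟨hwy, hw⟩
    by_cases hwN : w ∈ range h
    · right
      intro hcl
      obtain ⟨u, rfl⟩ := hwN
      rcases D.eq_zero_or_norm_of_mem_closure hcl with h | h
      · exact hwy (by rw [hy]; congr 1; exact Subtype.ext (h.trans h0.symm))
      · exact hball (hw.trans_le (min_le_left _ _)) ⟨u, h, rfl⟩
    · exact Or.inl hwN
  have hdis := isPreconnected_iff_subset_of_disjoint.mp hpre _ _ D.isClosed_range.isOpen_compl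
    isClosed_closure.isOpen_compl hsub (by
      ext w
      simp only [mem_inter_iff, mem_empty_iff_false, iff_false]
      intro hw
      exact hw.2.2 (subset_closure hw.2.1))
  rcases hdis with hd | hd
  · have hcont : Tendsto (fun t : ℝ => h (pr t)) (𝓝 0) (𝓝 y) := by
      have : Continuous fun t : ℝ => h (pr t) := D.continuous_chart.comp Complex.continuous_ofReal
      have h2 := this.tendsto 0
      simpa [hy, hz0] using h2
    have hev : ∀ᶠ t : ℝ in 𝓝[>] 0, dist (h (pr t)) y < ε ∧ t ∈ Ioo (0 : ℝ) 1 :=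
      ((hcont.eventually (Metric.ball_mem_nhds y hε0)).filter_mono nhdsWithin_le_nhds).and
        (Ioo_mem_nhdsGT one_pos)
    obtain ⟨t, ht, ht0, ht1⟩ := hev.exists
    refine hd ⟨?_, ht⟩ ⟨pr t, rfl⟩
    intro he
    have := congrArg Subtype.val (D.emb.injective he)
    rw [h0, coe_pr (by simp [abs_of_pos ht0, ht1.le])] at this
    exact ht0.ne' (by exact_mod_cast this)
  · obtain ⟨w, hw, hwN⟩ := Metric.mem_closure_iff.mp hz ε hε0
    refine hd ⟨?_, by rwa [dist_comm]⟩ (subset_closure hw)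
    rintro rfl
    exact hw ⟨z, rfl⟩

theorem range_ne_univ : range h ≠ univ := by
  intro hr
  have : (pr 1 : Disk) ∈ range h := hr ▸ mem_univ _
  obtain ⟨z, hz⟩ := this
  have := D.norm_lt z
  rw [hz, coe_pr (by simp)] at this
  simp at this

/-- A single boundary point of the neighborhood visible from outside suffices: what is known over it
is later carried along the whole circle by lifting. -/
theorem exists_mem_closure : ∃ c : Disk, ‖(c : ℂ)‖ = 1 ∧ h c ∈ closure (range h)ᶜ := by
  have hne : (frontier (range h)).Nonempty :=
    nonempty_frontier_iff.mpr ⟨range_nonempty h, D.range_ne_univ⟩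
  obtain ⟨x, hx⟩ := hne
  rw [D.isClosed_range.frontier_eq, Set.mem_sdiff] at hx
  obtain ⟨⟨c, rfl⟩, hc⟩ := hx
  have hc' : h c ∈ closure (range h)ᶜ := by
    rw [closure_compl]
    exact hc
  exact ⟨c, D.norm_eq_one_of_mem_closure hc', hc'⟩

/-- Openness of the chart at interior points: by the preceding analysis of the frontier, the range
is a neighborhood of such an image point. -/
theorem image_mem_nhds {z : Disk} (hz : ‖(z : ℂ)‖ ≠ 1) {O : Set Disk} (hO : O ∈ 𝓝 z) :
    h '' O ∈ 𝓝 (h z) := by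
  have h1 : range h ∈ 𝓝 (h z) := by
    have := mt D.norm_eq_one_of_mem_closure hz
    rw [closure_compl, mem_compl_iff, not_not] at this
    exact mem_interior_iff_mem_nhds.mp this
  have h2 := image_mem_map (m := h) hO
  rwa [D.emb.map_nhds_eq, nhdsWithin_eq_nhds.mpr h1] at h2

theorem continuousOn_invFun [Nonempty Disk] : ContinuousOn (Function.invFun h) (range h) := by
  rw [continuousOn_iff_continuous_domRestrict]
  refine D.emb.toHomeomorph.symm.continuous.congr ?_
  rintro ⟨_, z, rfl⟩
  rw [domRestrict_apply, Function.leftInverse_invFun D.emb.injective z,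
    Homeomorph.symm_apply_eq]
  rfl

/-- An embedded closed disk does not separate: on the contractible disk `h z - y` has a logarithm,
which the inverse of `h` moves to the range. On the finitely many remaining punctures any choice of
logarithms is continuous, so Eilenberg's criterion applies to the union. -/
theorem joinedIn_boundary (hP : P.Finite) {y : Disk} (hy : y ∉ range h) (hyP : y ∉ P) :
    ∃ b : Disk, ‖(b : ℂ)‖ = 1 ∧ JoinedIn (range h ∪ P)ᶜ y b := by
  classical
  have hne : Nonempty Disk := ⟨y⟩
  have hN := D.isClosed_range
  have h0 : ∀ a ∈ Metric.closedBall (0 : ℂ) 1, (h (pr a) : ℂ) - y ≠ 0 := fun a _ h' =>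
    hy ⟨pr a, Subtype.ext (sub_eq_zero.mp h')⟩
  obtain ⟨Ψ, hΨ, -, hexp⟩ := exists_log_of_starConvex
    (convex_closedBall (0 : ℂ) 1 (Metric.mem_closedBall_self zero_le_one))
    (ψ := fun z => (h (pr z) : ℂ) - y)
    ((continuous_subtype_val.comp D.continuous_chart).sub continuous_const).continuousOn h0
    (Metric.mem_closedBall_self zero_le_one) (Complex.exp_log (h0 0 (by simp)))
  let L : Disk → ℂ := fun x => if x ∈ range h then Ψ (Function.invFun h x : Disk) else Complex.log (x - y)
  refine exists_joinedIn_boundary (K := range h ∪ P) (L := L) (hN.union hP.isClosed)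
    (by simp only [mem_union, not_or]; exact ⟨hy, hyP⟩) ?_ ?_
  · rw [show range h ∪ P = range h ∪ (P \ range h) by simp]
    refine ContinuousOn.union_of_isClosed ?_ ?_ hN (hP.subset sdiff_subset).isClosed
    · refine ContinuousOn.congr (f := fun x => Ψ (Function.invFun h x : Disk)) ?_ fun x hx => if_pos hx
      refine hΨ.comp (continuous_subtype_val.comp_continuousOn D.continuousOn_invFun) ?_
      intro x _
      exact (Function.invFun h x).2
    · rw [continuousOn_iff_continuous_domRestrict]
      have : Finite ↥(P \ range h) := (hP.subset sdiff_subset).to_subtype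
      exact continuous_of_discreteTopology
  · rintro x hx
    by_cases hxN : x ∈ range h
    · obtain ⟨z, rfl⟩ := hxN
      simp only [L, mem_range_self, if_true]
      rw [Function.leftInverse_invFun D.emb.injective z, hexp _ z.2, pr_coe]
    · simp only [L, hxN, if_false]
      refine Complex.exp_log fun h' => ?_
      have hxy : x = y := Subtype.ext (sub_eq_zero.mp h')
      rcases hx with hx | hx
      · exact hxN hx
      · exact hyP (hxy ▸ hx)

end TwistChart

end ArcTwist

namespace ArcTwist

/-! ### Local monodromy at the branch points -/

section Local

set_option linter.unusedSectionVars false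

variable {F B : Type*} [TopologicalSpace F] [TopologicalSpace B]

/-- The topological properties of a branched covering that are used below. -/
structure IsBranchedAlong (φ : C(F, B)) (P : Set B) : Prop where
  covering : IsCoveringMapOn φ Pᶜ
  punctured : ∀ x, φ x ∈ P → ∀ O ∈ 𝓝 x, ∃ U ⊆ O, IsOpen U ∧ x ∈ U ∧ IsPathConnected (U \ {x}) ∧
    ∀ y ∈ U, φ y = φ x → y = x

/-- A coordinate disk of radius `δ` around the puncture `κ 0`. -/
structure PunctureChart (P : Set B) (κ : ℂ → B) (δ : ℝ) : Prop where
  pos : 0 < δ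
  cont : ContinuousOn κ (Metric.closedBall 0 δ)
  inj : InjOn κ (Metric.closedBall 0 δ)
  center : κ 0 ∈ P
  off : ∀ z, ‖z‖ ≤ δ → z ≠ 0 → κ z ∉ P
  nhds : ∀ ε, 0 < ε → ε ≤ δ → κ '' Metric.ball 0 ε ∈ 𝓝 (κ 0)

/-- The half-plane which `exp` maps onto the punctured disk of radius `δ`. -/
def expDomain (δ : ℝ) : Set ℂ := {w | w.re ≤ Real.log δ}

theorem convex_expDomain (δ : ℝ) : Convex ℝ (expDomain δ) := convex_halfSpace_re_le _

theorem mem_expDomain {δ : ℝ} (hδ : 0 < δ) {w : ℂ} : w ∈ expDomain δ ↔ ‖Complex.exp w‖ ≤ δ := by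
  rw [Complex.norm_exp, ← Real.le_log_iff_exp_le hδ]
  rfl

/-- A lift of the punctured coordinate disk to the total space, along the universal covering. -/
structure ExpLift (φ : C(F, B)) (κ : ℂ → B) (δ : ℝ) (Ψ : ℂ → F) : Prop where
  cont : ContinuousOn Ψ (expDomain δ)
  lift : ∀ w ∈ expDomain δ, φ (Ψ w) = κ (Complex.exp w)

/-- The local monodromy around the puncture `κ 0` is an involution. -/
def DoublePeriodic (φ : C(F, B)) (κ : ℂ → B) (δ : ℝ) : Prop :=
  ∀ Ψ, ExpLift φ κ δ Ψ → ∀ w ∈ expDomain δ, Ψ (w + 2 * (2 * Real.pi * Complex.I)) = Ψ w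

variable {φ : C(F, B)} {P : Set B} {κ : ℂ → B} {δ : ℝ}

theorem PunctureChart.exp_notMem (hκ : PunctureChart P κ δ) {w : ℂ} (hw : w ∈ expDomain δ) :
    κ (Complex.exp w) ∉ P :=
  hκ.off _ ((mem_expDomain hκ.pos).mp hw) (Complex.exp_ne_zero w)

theorem exists_expLift (hφ : IsBranchedAlong φ P) (hκ : PunctureChart P κ δ) {w : ℂ}
    (hw : w ∈ expDomain δ) {y : F} (hy : φ y = κ (Complex.exp w)) :
    ∃ Ψ, ExpLift φ κ δ Ψ ∧ Ψ w = y := by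
  obtain ⟨Ψ, h1, h2, h3⟩ := exists_lift_of_convex hφ.covering (convex_expDomain δ)
    (ψ := fun w => κ (Complex.exp w))
    (hκ.cont.comp Complex.continuous_exp.continuousOn fun w hw => by
      simpa using (mem_expDomain hκ.pos).mp hw)
    (fun w hw => hκ.exp_notMem hw) hw hy
  exact ⟨Ψ, ⟨h1, h3⟩, h2⟩

theorem ExpLift.eqOn (hφ : IsBranchedAlong φ P) (hκ : PunctureChart P κ δ) {Ψ Ψ' : ℂ → F}
    (h : ExpLift φ κ δ Ψ) (h' : ExpLift φ κ δ Ψ') {w : ℂ} (hw : w ∈ expDomain δ)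
    (e : Ψ w = Ψ' w) : EqOn Ψ Ψ' (expDomain δ) := by
  refine eqOn_of_lifts hφ.covering (convex_expDomain δ).isPreconnected h.cont h'.cont ?_ ?_ hw e
  · intro a ha
    rw [h.lift a ha]
    exact hκ.exp_notMem ha
  · intro a ha
    rw [h.lift a ha, h'.lift a ha]

theorem add_period_mem {w : ℂ} (n : ℤ) (hw : w ∈ expDomain δ) :
    w + n * (2 * Real.pi * Complex.I) ∈ expDomain δ := by
  simpa [expDomain] using hw

theorem add_period_mem' {w : ℂ} (hw : w ∈ expDomain δ) :
    w + 2 * Real.pi * Complex.I ∈ expDomain δ := by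
  simpa [expDomain] using hw

theorem ExpLift.shift {Ψ : ℂ → F} (h : ExpLift φ κ δ Ψ) (n : ℤ) :
    ExpLift φ κ δ fun w => Ψ (w + n * (2 * Real.pi * Complex.I)) := by
  refine ⟨h.cont.comp (by fun_prop) fun w hw => add_period_mem n hw, fun w hw => ?_⟩
  rw [h.lift _ (add_period_mem n hw), Complex.exp_periodic.int_mul n]

theorem DoublePeriodic.zmul (hD : DoublePeriodic φ κ δ) {Ψ : ℂ → F} (h : ExpLift φ κ δ Ψ)
    (n : ℤ) {w : ℂ} (hw : w ∈ expDomain δ) :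
    Ψ (w + n * (2 * Real.pi * Complex.I)) = Ψ w ∨
      Ψ (w + n * (2 * Real.pi * Complex.I)) = Ψ (w + 2 * Real.pi * Complex.I) := by
  have key : ∀ (m : ℤ) (w : ℂ), w ∈ expDomain δ →
      Ψ (w + (2 * m : ℤ) * (2 * Real.pi * Complex.I)) = Ψ w := by
    intro m
    induction m using Int.induction_on with
    | zero => simp
    | succ i ih =>
      intro w hw
      have h2 := hD Ψ h _ (add_period_mem (2 * i) hw)
      rw [← ih w hw, ← h2]
      congr 1
      push_cast
      ring
    | pred i ih =>
      intro w hw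
      rw [← ih w hw, ← hD Ψ h _ (add_period_mem _ hw)]
      congr 1
      push_cast
      ring
  rcases Int.even_or_odd' n with ⟨m, rfl | rfl⟩
  · exact Or.inl (key m w hw)
  · right
    rw [← key m _ (add_period_mem' hw)]
    congr 1
    push_cast
    ring

variable [CompactSpace F] [T2Space F] [T2Space B]

/-- `φ` is a closed map, because `F` is compact. -/
theorem exists_nhds_preimage_subset (φ : C(F, B)) {b : B} {O : Set F} (hO : IsOpen O)
    (hb : φ ⁻¹' {b} ⊆ O) : ∃ W ∈ 𝓝 b, φ ⁻¹' W ⊆ O := by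
  refine ⟨(φ '' Oᶜ)ᶜ, ?_, ?_⟩
  · refine IsOpen.mem_nhds ?_ ?_
    · exact (hO.isClosed_compl.isCompact.image φ.continuous).isClosed.isOpen_compl
    · rintro ⟨x, hx, rfl⟩
      exact hx (hb rfl)
  · intro x hx
    by_contra h
    exact hx ⟨x, h, rfl⟩

theorem IsBranchedAlong.finite_fibre (hφ : IsBranchedAlong φ P) {b : B} (hb : b ∈ P) :
    (φ ⁻¹' {b}).Finite := by
  have hc : IsCompact (φ ⁻¹' {b}) := (isClosed_singleton.preimage φ.continuous).isCompact
  have : ∀ x ∈ φ ⁻¹' {b}, ∃ U ∈ 𝓝 x, ∀ y ∈ U, φ y = b → y = x := by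
    rintro x rfl
    obtain ⟨U, -, hU, hxU, -, h⟩ := hφ.punctured x hb univ univ_mem
    exact ⟨U, hU.mem_nhds hxU, h⟩
  choose! U hU h using this
  obtain ⟨t, ht, hcov⟩ := hc.elim_nhds_subcover U hU
  refine t.finite_toSet.subset fun x hx => ?_
  obtain ⟨y, hy, hxy⟩ := mem_iUnion₂.mp (hcov hx)
  rw [h y (ht y hy) x hxy hx]
  exact hy

theorem PunctureChart.exists_log_bound (hκ : PunctureChart P κ δ) {W : Set B} (hW : W ∈ 𝓝 (κ 0)) :
    ∃ ε, 0 < ε ∧ ε ≤ δ ∧ ∀ z, ‖z‖ < ε → κ z ∈ W := by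
  have hc : ContinuousAt κ 0 := hκ.cont.continuousAt (Metric.closedBall_mem_nhds 0 hκ.pos)
  obtain ⟨ε, hε, h⟩ := Metric.mem_nhds_iff.mp (hc hW)
  refine ⟨min ε δ, lt_min hε hκ.pos, min_le_right _ _, fun z hz => h ?_⟩
  simpa using hz.trans_le (min_le_left _ _)

/-- A lift of the punctured disk that comes close to a point over the puncture converges to it. -/
theorem exists_nhds_forall_tendsto (hφ : IsBranchedAlong φ P) (hκ : PunctureChart P κ δ) {x : F}
    (hx : φ x = κ 0) : ∃ U ∈ 𝓝 x, ∀ Ψ, ExpLift φ κ δ Ψ → (∃ w ∈ expDomain δ, Ψ w ∈ U) →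
      ∀ O ∈ 𝓝 x, ∃ R, ∀ w : ℂ, w.re < R → w ∈ expDomain δ ∧ Ψ w ∈ O := by
  have hfin := hφ.finite_fibre hκ.center
  obtain ⟨V, hV, hdisj⟩ := hfin.t2_separation
  have hxf : x ∈ φ ⁻¹' {κ 0} := hx
  -- Over a small disk every point lies in `O ∩ V x` or in the neighborhood of another point of the
  -- fibre. These open sets are disjoint, so the connected image of a half-plane that meets `V x`
  -- stays in it, and shrinking `O` gives convergence.
  have hcov : ∀ O : Set F, IsOpen O → x ∈ O → ∃ ε, 0 < ε ∧ ε ≤ δ ∧ ∀ y z, ‖z‖ < ε →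
      φ y = κ z → y ∈ (O ∩ V x) ∪ ⋃ x' ∈ φ ⁻¹' {κ 0} \ {x}, V x' := by
    intro O hO hxO
    have hop : IsOpen ((O ∩ V x) ∪ ⋃ x' ∈ φ ⁻¹' {κ 0} \ {x}, V x') :=
      (hO.inter (hV x).2).union (isOpen_biUnion fun x' _ => (hV x').2)
    obtain ⟨W, hW, hWs⟩ := exists_nhds_preimage_subset φ (b := κ 0) hop (by
      intro y hy
      by_cases h : y = x
      · subst h
        exact Or.inl ⟨hxO, (hV y).1⟩
      · exact Or.inr (mem_biUnion (show y ∈ φ ⁻¹' {κ 0} \ {x} from ⟨hy, h⟩) (hV y).1))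
    obtain ⟨ε, hε, hεδ, h⟩ := hκ.exists_log_bound hW
    refine ⟨ε, hε, hεδ, fun y z hz hyz => hWs ?_⟩
    rw [mem_preimage, hyz]
    exact h z hz
  have hdis : Disjoint (V x) (⋃ x' ∈ φ ⁻¹' {κ 0} \ {x}, V x') := by
    rw [disjoint_iUnion₂_right]
    intro x' hx'
    exact hdisj hxf hx'.1 (Ne.symm hx'.2)
  obtain ⟨ε, hε, hεδ, h⟩ := hcov univ isOpen_univ (mem_univ x)
  have hnorm : ∀ {η : ℝ}, 0 < η → ∀ w : ℂ, w.re < Real.log η ↔ ‖Complex.exp w‖ < η := by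
    intro η hη w
    rw [Complex.norm_exp, Real.lt_log_iff_exp_lt hη]
  have hdom : ∀ w : ℂ, w.re < Real.log ε → w ∈ expDomain δ := fun w hw =>
    (mem_expDomain hκ.pos).mpr (((hnorm hε w).mp hw).le.trans hεδ)
  refine ⟨V x ∩ φ ⁻¹' (κ '' Metric.ball 0 ε), inter_mem ((hV x).2.mem_nhds (hV x).1)
    (φ.continuous.continuousAt (by rw [hx]; exact hκ.nhds ε hε hεδ)), ?_⟩
  rintro Ψ hΨ ⟨w₁, hw₁, hw₁V, z, hz, hzw⟩ O hO
  have hz' : ‖z‖ < ε := by simpa using hz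
  have hw₁R : w₁.re < Real.log ε := by
    rw [hnorm hε]
    have : z = Complex.exp w₁ := hκ.inj (by simpa using hz'.le.trans hεδ)
      (by simpa using (mem_expDomain hκ.pos).mp hw₁) (hzw.trans (hΨ.lift w₁ hw₁))
    rwa [← this]
  have hpre : IsPreconnected (Ψ '' {w : ℂ | w.re < Real.log ε}) :=
    (convex_halfSpace_re_lt _).isPreconnected.image _ (hΨ.cont.mono hdom)
  have hVx : ∀ w : ℂ, w.re < Real.log ε → Ψ w ∈ V x := by
    have hne : (Ψ '' {w : ℂ | w.re < Real.log ε} ∩ V x).Nonempty :=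
      ⟨Ψ w₁, mem_image_of_mem Ψ hw₁R, hw₁V⟩
    have hs := hpre.subset_left_of_subset_union (hV x).2
      (isOpen_biUnion fun x' (_ : x' ∈ φ ⁻¹' {κ 0} \ {x}) => (hV x').2) hdis (by
        rintro _ ⟨w, hw, rfl⟩
        have := h (Ψ w) _ ((hnorm hε w).mp hw) (hΨ.lift w (hdom w hw))
        rwa [univ_inter] at this) hne
    exact fun w hw => hs (mem_image_of_mem Ψ hw)
  obtain ⟨O', hO', hO'o, hxO'⟩ := mem_nhds_iff.mp hO
  obtain ⟨η, hη, hηδ, h'⟩ := hcov O' hO'o hxO'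
  refine ⟨min (Real.log ε) (Real.log η), fun w hw => ?_⟩
  have hwε := hw.trans_le (min_le_left _ _)
  have hwη := hw.trans_le (min_le_right _ _)
  refine ⟨hdom w hwε, ?_⟩
  rcases h' (Ψ w) _ ((hnorm hη w).mp hwη) (hΨ.lift w (hdom w hwε)) with h1 | h1
  · exact hO' h1.1
  · exact absurd h1 (disjoint_left.mp hdis (hVx w hwε))

/-- Over a small enough circle the lift must enter one of the neighborhoods of the fibre points
provided by `exists_nhds_forall_tendsto`. -/
theorem ExpLift.exists_limit (hφ : IsBranchedAlong φ P) (hκ : PunctureChart P κ δ) {Ψ : ℂ → F}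
    (hΨ : ExpLift φ κ δ Ψ) : ∃ x, φ x = κ 0 ∧
      ∀ O ∈ 𝓝 x, ∃ R, ∀ w : ℂ, w.re < R → w ∈ expDomain δ ∧ Ψ w ∈ O := by
  have h := fun (x : F) (hx : φ x = κ 0) => exists_nhds_forall_tendsto hφ hκ hx
  choose! U hU hlim using h
  obtain ⟨W, hW, hWs⟩ := exists_nhds_preimage_subset φ (b := κ 0)
    (O := ⋃ x ∈ φ ⁻¹' {κ 0}, interior (U x)) (isOpen_biUnion fun x _ => isOpen_interior)
    (fun x hx => mem_biUnion hx (mem_interior_iff_mem_nhds.mpr (hU x hx)))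
  obtain ⟨ε, hε, hεδ, hlog⟩ := hκ.exists_log_bound hW
  have hw : ‖Complex.exp ((Real.log (ε / 2) : ℝ) : ℂ)‖ = ε / 2 := by
    rw [Complex.norm_exp, Complex.ofReal_re, Real.exp_log (by linarith)]
  have hwd : ((Real.log (ε / 2) : ℝ) : ℂ) ∈ expDomain δ := by
    rw [mem_expDomain hκ.pos, hw]
    linarith
  have hm : Ψ (Real.log (ε / 2) : ℝ) ∈ φ ⁻¹' W := by
    rw [mem_preimage, hΨ.lift _ hwd]
    exact hlog _ (by rw [hw]; linarith)
  obtain ⟨x, hx, hxU⟩ := mem_iUnion₂.mp (hWs hm)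
  exact ⟨x, hx, hlim x hx Ψ hΨ ⟨_, hwd, interior_subset hxU⟩⟩

/-- Near a point over the puncture, a single lift of the punctured disk covers everything. -/
theorem exists_nhds_forall_exists (hφ : IsBranchedAlong φ P) (hκ : PunctureChart P κ δ) {x : F}
    (hx : φ x = κ 0) : ∃ U ∈ 𝓝 x, (∀ y ∈ U, y ≠ x → ∃ z, ‖z‖ ≤ δ ∧ z ≠ 0 ∧ φ y = κ z) ∧
      ∀ Ψ, ExpLift φ κ δ Ψ → ∀ w₁ ∈ expDomain δ, Ψ w₁ ∈ U → ∀ y ∈ U, y ≠ x →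
        ∃ w ∈ expDomain δ, Ψ w = y := by
  obtain ⟨U, hUO, hUo, hxU, hpc, hiso⟩ := hφ.punctured x (hx ▸ hκ.center)
    (φ ⁻¹' (κ '' Metric.ball 0 δ))
    (φ.continuous.continuousAt (by rw [hx]; exact hκ.nhds δ hκ.pos le_rfl))
  have hz : ∀ y ∈ U, y ≠ x → ∃ z, ‖z‖ ≤ δ ∧ z ≠ 0 ∧ φ y = κ z := by
    intro y hy hyx
    obtain ⟨z, hz, hzy⟩ := hUO hy
    refine ⟨z, (by simpa using hz : ‖z‖ < δ).le, ?_, hzy.symm⟩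
    rintro rfl
    exact hyx (hiso y hy (hzy.symm.trans hx.symm))
  refine ⟨U, hUo.mem_nhds hxU, hz, ?_⟩
  intro Ψ hΨ w₁ hw₁ hw₁U y hy hyx
  have hw₁x : Ψ w₁ ≠ x := by
    intro h
    have := hκ.exp_notMem hw₁
    rw [← hΨ.lift w₁ hw₁, h, hx] at this
    exact this hκ.center
  obtain ⟨γ, hγ⟩ := hpc.joinedIn (Ψ w₁) ⟨hw₁U, hw₁x⟩ y ⟨hy, hyx⟩
  choose ζ hζδ hζ0 hζ using fun t => hz (γ t) (hγ t).1 (hγ t).2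
  -- The path is read in the coordinate disk, where its nonzero coordinate lifts through `exp`; the
  -- lift `Ψ` along that logarithm retraces the path.
  have hζc : Continuous ζ := by
    have he : IsClosedEmbedding ((Metric.closedBall (0 : ℂ) δ).domRestrict κ) := by
      have : CompactSpace (Metric.closedBall (0 : ℂ) δ) :=
        isCompact_iff_compactSpace.mp (isCompact_closedBall 0 δ)
      exact (continuousOn_iff_continuous_domRestrict.mp hκ.cont).isClosedEmbedding
        (injOn_iff_injective.mp hκ.inj)
    have hc : Continuous fun t => (⟨ζ t, by simpa using hζδ t⟩ : Metric.closedBall (0 : ℂ) δ) := by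
      rw [he.isEmbedding.isInducing.continuous_iff]
      refine (φ.continuous.comp γ.continuous).congr fun t => ?_
      simp [hζ t]
    exact continuous_subtype_val.comp hc
  have h0 : Complex.exp w₁ = ζ 0 := by
    refine hκ.inj (by simpa using (mem_expDomain hκ.pos).mp hw₁) (by simpa using hζδ 0) ?_
    rw [← hΨ.lift w₁ hw₁, ← hζ 0, γ.source]
  obtain ⟨ω, hω0, hω⟩ := exists_lift_path Complex.isCoveringMapOn_exp (γ := ⟨ζ, hζc⟩)
    (fun t => hζ0 t) h0
  have hωd : ∀ t, ω t ∈ expDomain δ := fun t => by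
    rw [mem_expDomain hκ.pos, hω t]
    exact hζδ t
  have heq := eqOn_of_lifts (A := (univ : Set I)) hφ.covering isPreconnected_univ
    (f := fun t => Ψ (ω t)) (g := γ)
    ((hΨ.cont.comp_continuous ω.continuous hωd).continuousOn) γ.continuous.continuousOn
    (fun t _ => by
      rw [hΨ.lift _ (hωd t)]
      exact hκ.exp_notMem (hωd t))
    (fun t _ => by
      rw [hΨ.lift _ (hωd t), hω t, hζ t]
      rfl) (mem_univ 0) (by simp [hω0])
  refine ⟨ω 1, hωd 1, ?_⟩
  exact (heq (mem_univ 1)).trans γ.target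

/-- Whether the local monodromy is an involution does not depend on the chart. -/
theorem DoublePeriodic.of_chart (hφ : IsBranchedAlong φ P) {κ' : ℂ → B} {δ' : ℝ}
    (hκ : PunctureChart P κ δ) (hκ' : PunctureChart P κ' δ') (h0 : κ 0 = κ' 0)
    (hD : DoublePeriodic φ κ δ) : DoublePeriodic φ κ' δ' := by
  intro Ψ hΨ
  obtain ⟨x, hx, hlim⟩ := hΨ.exists_limit hφ hκ'
  obtain ⟨U, hU, hUz, hUc⟩ := exists_nhds_forall_exists hφ hκ (hx.trans h0.symm)
  -- In the chart `κ` one lift sweeps out all of `U` near `x`, and over a given point it has at most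
  -- two values, before and after one turn. This bound no longer mentions the chart.
  have htwo : ∀ y₁ ∈ U, ∀ y₂ ∈ U, ∀ y₃ ∈ U, φ y₁ ∉ P → φ y₂ = φ y₁ → φ y₃ = φ y₁ →
      y₁ = y₂ ∨ y₁ = y₃ ∨ y₂ = y₃ := by
    intro y₁ h₁ y₂ h₂ y₃ h₃ hP h21 h31
    have hxP : φ x ∈ P := hx ▸ hκ'.center
    have hne : ∀ y, φ y = φ y₁ → y ≠ x := by
      rintro y hy rfl
      exact hP (hy ▸ hxP)
    obtain ⟨z, hzδ, hz0, hz⟩ := hUz y₁ h₁ (hne y₁ rfl)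
    have hwz : Complex.exp (Complex.log z) = z := Complex.exp_log hz0
    have hwd : Complex.log z ∈ expDomain δ := by rwa [mem_expDomain hκ.pos, hwz]
    obtain ⟨Θ, hΘ, hΘ1⟩ := exists_expLift hφ hκ hwd (y := y₁) (by rw [hwz, hz])
    have hcase : ∀ y ∈ U, φ y = φ y₁ →
        y = y₁ ∨ y = Θ (Complex.log z + 2 * Real.pi * Complex.I) := by
      intro y hyU hy
      obtain ⟨w, hw, rfl⟩ := hUc Θ hΘ _ hwd (by rwa [hΘ1]) y hyU (hne y hy)
      have hew : Complex.exp w = Complex.exp (Complex.log z) := by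
        refine hκ.inj (by simpa using (mem_expDomain hκ.pos).mp hw)
          (by simpa using (mem_expDomain hκ.pos).mp hwd) ?_
        rw [← hΘ.lift w hw, hy, ← hΘ1, hΘ.lift _ hwd]
      obtain ⟨n, hn⟩ := Complex.exp_eq_exp_iff_exists_int.mp hew
      rw [hn, ← hΘ1]
      exact hD.zmul hΘ n hwd
    rcases hcase y₂ h₂ h21 with h | h
    · exact Or.inl h.symm
    · rcases hcase y₃ h₃ h31 with h' | h'
      · exact Or.inr (Or.inl h'.symm)
      · exact Or.inr (Or.inr (h.trans h'.symm))
  -- Far to the left, three values of `Ψ` one turn apart lie in `U` over the same point, so two of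
  -- them coincide. Each coincidence propagates to the whole half-plane and gives a period of one or
  -- two turns.
  obtain ⟨R, hR⟩ := hlim U hU
  set w₀ : ℂ := ((R - 1 : ℝ) : ℂ) with hw₀
  have hre : ∀ n : ℤ, (w₀ + n * (2 * Real.pi * Complex.I)).re < R := fun n => by simp [hw₀]
  have hm0 := hR (w₀ + (0 : ℤ) * (2 * Real.pi * Complex.I)) (hre 0)
  have hm1 := hR (w₀ + (1 : ℤ) * (2 * Real.pi * Complex.I)) (hre 1)
  have hm2 := hR (w₀ + (2 : ℤ) * (2 * Real.pi * Complex.I)) (hre 2)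
  have hw0d : w₀ ∈ expDomain δ' := by simpa using hm0.1
  have hl : ∀ n : ℤ, φ (Ψ (w₀ + n * (2 * Real.pi * Complex.I))) = κ' (Complex.exp w₀) :=
    fun n => (hΨ.shift n).lift w₀ hw0d
  have hcases := htwo _ hm0.2 _ hm1.2 _ hm2.2 (by rw [hl]; exact hκ'.exp_notMem hw0d)
    (by rw [hl, hl]) (by rw [hl, hl])
  have hgo : ∀ m n : ℤ, Ψ (w₀ + m * (2 * Real.pi * Complex.I)) =
      Ψ (w₀ + n * (2 * Real.pi * Complex.I)) → ∀ w ∈ expDomain δ',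
      Ψ (w + m * (2 * Real.pi * Complex.I)) = Ψ (w + n * (2 * Real.pi * Complex.I)) := by
    intro m n hmn
    exact (hΨ.shift m).eqOn hφ hκ' (hΨ.shift n) hw0d hmn
  intro w hw
  rcases hcases with h | h | h
  · have h1 := hgo 0 1 h w hw
    have h2 := hgo 0 1 h _ (add_period_mem 1 hw)
    calc _ = Ψ (w + (1 : ℤ) * (2 * Real.pi * Complex.I) + (1 : ℤ) * (2 * Real.pi * Complex.I)) :=
          congrArg Ψ (by push_cast; ring)
      _ = Ψ (w + (1 : ℤ) * (2 * Real.pi * Complex.I)) := by rw [← h2]; simp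
      _ = _ := by rw [← h1]; simp
  · have h1 := hgo 0 2 h w hw
    simpa using h1.symm
  · have h1 := hgo 1 2 h _ (add_period_mem (-1) hw)
    have h2 := hgo 1 2 h w hw
    calc _ = Ψ (w + (2 : ℤ) * (2 * Real.pi * Complex.I)) := congrArg Ψ (by push_cast; ring)
      _ = Ψ (w + (1 : ℤ) * (2 * Real.pi * Complex.I)) := h2.symm
      _ = Ψ (w + (-1 : ℤ) * (2 * Real.pi * Complex.I) + (2 : ℤ) * (2 * Real.pi * Complex.I)) :=
          congrArg Ψ (by push_cast; ring)
      _ = _ := by rw [← h1]; exact congrArg Ψ (by push_cast; ring)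

/-- The lower half of the punctured disk of radius `δ`. -/
def lowerHalf (δ : ℝ) : Set ℂ := {z | ‖z‖ ≤ δ ∧ z.im ≤ 0 ∧ z ≠ 0}

/-- The upper half of the punctured disk of radius `δ`. -/
def upperHalf (δ : ℝ) : Set ℂ := {z | ‖z‖ ≤ δ ∧ 0 ≤ z.im ∧ z ≠ 0}

/-- Sections over the two halves of a punctured coordinate disk: the sections with the same index
agree on the left, and those with indices `v` and `a v` agree on the right. -/
structure HalfSections {V : Type*} (φ : C(F, B)) (κ : ℂ → B) (δ : ℝ) (sm sp : V → ℂ → F)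
    (a : V → V) : Prop where
  contLower : ∀ v, ContinuousOn (sm v) (lowerHalf δ)
  contUpper : ∀ v, ContinuousOn (sp v) (upperHalf δ)
  liftLower : ∀ v, ∀ z ∈ lowerHalf δ, φ (sm v z) = κ z
  liftUpper : ∀ v, ∀ z ∈ upperHalf δ, φ (sp v z) = κ z
  inner : ∀ v, sm v (-δ) = sp v (-δ)
  outer : ∀ v, sm v δ = sp (a v) δ
  inj : ∀ v w, sm v (-δ) = sm w (-δ) → v = w
  surj : ∀ y, φ y = κ (-δ) → ∃ v, sm v (-δ) = y

section Half

variable {V : Type*} {sm sp : V → ℂ → F} {a : V → V}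

theorem exp_log_add_pi (hδ : 0 < δ) (n : ℤ) :
    Complex.exp (Real.log δ + (-(Real.pi * Complex.I) + n * (2 * Real.pi * Complex.I))) = -δ := by
  rw [Complex.exp_add, Complex.exp_periodic.int_mul n, Complex.exp_neg, Complex.exp_pi_mul_I,
    ← Complex.ofReal_exp, Real.exp_log hδ]
  simp

theorem log_mem_expDomain {t : ℝ} (ht : 0 < t) (htδ : t ≤ δ) (y : ℝ) :
    (Real.log t + y * Complex.I : ℂ) ∈ expDomain δ := by
  simpa [expDomain] using Real.log_le_log ht htδ

/-- The exponential maps the strip `-π ≤ im w ≤ 0` to the lower half-disk, so the section with index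
`v` becomes a lift there and uniqueness applies. -/
theorem HalfSections.eq_lower (hφ : IsBranchedAlong φ P) (hκ : PunctureChart P κ δ)
    (hs : HalfSections φ κ δ sm sp a) {Ψ : ℂ → F} (hΨ : ExpLift φ κ δ Ψ) {v : V}
    (h : Ψ (Real.log δ + (-Real.pi : ℝ) * Complex.I) = sm v (-δ)) {w : ℂ} (hw : w ∈ expDomain δ)
    (h1 : -Real.pi ≤ w.im) (h2 : w.im ≤ 0) : Ψ w = sm v (Complex.exp w) := by
  have hmaps : MapsTo Complex.exp (expDomain δ ∩ {w | -Real.pi ≤ w.im ∧ w.im ≤ 0})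
      (lowerHalf δ) := by
    rintro w ⟨hw, h1, h2⟩
    refine ⟨(mem_expDomain hκ.pos).mp hw, ?_, Complex.exp_ne_zero w⟩
    rw [Complex.exp_im]
    exact mul_nonpos_of_nonneg_of_nonpos (Real.exp_pos _).le
      (Real.sin_nonpos_of_nonpos_of_neg_pi_le h2 h1)
  have hconv : Convex ℝ (expDomain δ ∩ {w | -Real.pi ≤ w.im ∧ w.im ≤ 0}) :=
    (convex_expDomain δ).inter ((convex_halfSpace_im_ge _).inter (convex_halfSpace_im_le _))
  have h0 : (Real.log δ + (-Real.pi : ℝ) * Complex.I : ℂ) ∈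
      expDomain δ ∩ {w | -Real.pi ≤ w.im ∧ w.im ≤ 0} :=
    ⟨log_mem_expDomain hκ.pos le_rfl _, by simp [Real.pi_pos.le]⟩
  refine eqOn_of_lifts hφ.covering hconv.isPreconnected (hΨ.cont.mono inter_subset_left)
    (g := fun w => sm v (Complex.exp w))
    ((hs.contLower v).comp Complex.continuous_exp.continuousOn hmaps) ?_ ?_ h0 ?_ ⟨hw, h1, h2⟩
  · intro w hw
    rw [hΨ.lift w hw.1]
    exact hκ.exp_notMem hw.1
  · intro w hw
    rw [hΨ.lift w hw.1, hs.liftLower v _ (hmaps hw)]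
  · rw [h]
    congr 1
    have := exp_log_add_pi hκ.pos 0
    simp only [Int.cast_zero, zero_mul, add_zero] at this
    rw [← this]
    push_cast
    rw [neg_mul]

theorem HalfSections.eq_upper (hφ : IsBranchedAlong φ P) (hκ : PunctureChart P κ δ)
    (hs : HalfSections φ κ δ sm sp a) {Ψ : ℂ → F} (hΨ : ExpLift φ κ δ Ψ) {v : V}
    (h : Ψ (Real.log δ + (-Real.pi : ℝ) * Complex.I) = sm v (-δ)) {w : ℂ} (hw : w ∈ expDomain δ)
    (h1 : 0 ≤ w.im) (h2 : w.im ≤ Real.pi) : Ψ w = sp (a v) (Complex.exp w) := by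
  have hmaps : MapsTo Complex.exp (expDomain δ ∩ {w | 0 ≤ w.im ∧ w.im ≤ Real.pi})
      (upperHalf δ) := by
    rintro w ⟨hw, h1, h2⟩
    refine ⟨(mem_expDomain hκ.pos).mp hw, ?_, Complex.exp_ne_zero w⟩
    rw [Complex.exp_im]
    exact mul_nonneg (Real.exp_pos _).le (Real.sin_nonneg_of_nonneg_of_le_pi h1 h2)
  have hconv : Convex ℝ (expDomain δ ∩ {w | 0 ≤ w.im ∧ w.im ≤ Real.pi}) :=
    (convex_expDomain δ).inter ((convex_halfSpace_im_ge _).inter (convex_halfSpace_im_le _))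
  have hd : (Real.log δ + (0 : ℝ) * Complex.I : ℂ) ∈ expDomain δ :=
    log_mem_expDomain hκ.pos le_rfl _
  have he : Complex.exp (Real.log δ + (0 : ℝ) * Complex.I) = δ := by
    rw [Complex.ofReal_zero, zero_mul, add_zero, ← Complex.ofReal_exp, Real.exp_log hκ.pos]
  refine eqOn_of_lifts hφ.covering hconv.isPreconnected (hΨ.cont.mono inter_subset_left)
    (g := fun w => sp (a v) (Complex.exp w))
    ((hs.contUpper _).comp Complex.continuous_exp.continuousOn hmaps) ?_ ?_
    (a := (Real.log δ + (0 : ℝ) * Complex.I : ℂ)) ⟨hd, by simp [Real.pi_pos.le]⟩ ?_ ⟨hw, h1, h2⟩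
  · intro w hw
    rw [hΨ.lift w hw.1]
    exact hκ.exp_notMem hw.1
  · intro w hw
    rw [hΨ.lift w hw.1, hs.liftUpper _ _ (hmaps hw)]
  · rw [he, ← hs.outer, hs.eq_lower hφ hκ hΨ h hd (by simp [Real.pi_pos.le]) (by simp), he]

/-- A full turn from angle `-π` to `π` runs through the lower half with index `v`, crosses the outer
radius, and returns through the upper half with index `a v`: `a` is the local monodromy. -/
theorem HalfSections.eq_shift (hφ : IsBranchedAlong φ P) (hκ : PunctureChart P κ δ)
    (hs : HalfSections φ κ δ sm sp a) {Ψ : ℂ → F} (hΨ : ExpLift φ κ δ Ψ) {v : V}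
    (h : Ψ (Real.log δ + (-Real.pi : ℝ) * Complex.I) = sm v (-δ)) :
    Ψ (Real.log δ + (-Real.pi : ℝ) * Complex.I + 2 * Real.pi * Complex.I) = sm (a v) (-δ) := by
  have e : (Real.log δ + (-Real.pi : ℝ) * Complex.I + 2 * Real.pi * Complex.I : ℂ) =
      Real.log δ + (Real.pi : ℝ) * Complex.I := by
    push_cast
    ring
  have he : Complex.exp (Real.log δ + (Real.pi : ℝ) * Complex.I) = -δ := by
    rw [← exp_log_add_pi hκ.pos 1]
    congr 1
    push_cast
    ring
  rw [e, hs.eq_upper hφ hκ hΨ h (log_mem_expDomain hκ.pos le_rfl _) (by simp [Real.pi_pos.le])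
    (by simp), he, hs.inner]

theorem HalfSections.exists_expLift (hφ : IsBranchedAlong φ P) (hκ : PunctureChart P κ δ)
    (hs : HalfSections φ κ δ sm sp a) (v : V) :
    ∃ Ψ, ExpLift φ κ δ Ψ ∧ Ψ (Real.log δ + (-Real.pi : ℝ) * Complex.I) = sm v (-δ) := by
  refine ArcTwist.exists_expLift hφ hκ (log_mem_expDomain hκ.pos le_rfl _) ?_
  rw [hs.liftLower v]
  · congr 1
    rw [← exp_log_add_pi hκ.pos 0]
    congr 1
    push_cast
    ring
  · simp [lowerHalf, abs_of_pos hκ.pos, hκ.pos.ne']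

theorem HalfSections.involutive (hφ : IsBranchedAlong φ P) (hκ : PunctureChart P κ δ)
    (hs : HalfSections φ κ δ sm sp a) (hD : DoublePeriodic φ κ δ) (v : V) : a (a v) = v := by
  obtain ⟨Ψ, hΨ, h⟩ := hs.exists_expLift hφ hκ v
  have h1 := hs.eq_shift hφ hκ hΨ h
  have h2 := hs.eq_shift hφ hκ (hΨ.shift 1) (v := a v) (by simpa using h1)
  apply hs.inj
  rw [← h2, ← h, ← hD Ψ hΨ _ (log_mem_expDomain hκ.pos le_rfl _)]
  congr 1
  push_cast
  ring

theorem HalfSections.doublePeriodic (hφ : IsBranchedAlong φ P) (hκ : PunctureChart P κ δ)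
    (hs : HalfSections φ κ δ sm sp a) (ha : ∀ v, a (a v) = v) : DoublePeriodic φ κ δ := by
  intro Ψ hΨ
  have hd : (Real.log δ + (-Real.pi : ℝ) * Complex.I : ℂ) ∈ expDomain δ :=
    log_mem_expDomain hκ.pos le_rfl _
  obtain ⟨v, hv⟩ := hs.surj (Ψ (Real.log δ + (-Real.pi : ℝ) * Complex.I)) (by
    rw [hΨ.lift _ hd]
    congr 1
    rw [← exp_log_add_pi hκ.pos 0]
    congr 1
    push_cast
    ring)
  have h1 := hs.eq_shift hφ hκ hΨ hv.symm
  have h2 := hs.eq_shift hφ hκ (hΨ.shift 1) (v := a v) (by simpa using h1)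
  rw [ha, hv] at h2
  intro w hw
  rw [← (hΨ.shift 2).eqOn hφ hκ hΨ hd ?_ hw]
  · push_cast
    rfl
  · rw [← h2]
    congr 1
    push_cast
    ring

/-- The image of the radius on which the sections with the same index agree. -/
def innerRay (δ : ℝ) : Set ℂ := (fun t : ℝ => (-t : ℂ)) '' Ioc 0 δ

theorem exp_inner {t : ℝ} (ht : 0 < t) :
    Complex.exp (Real.log t + (-Real.pi : ℝ) * Complex.I) = -t := by
  rw [← exp_log_add_pi ht 0]
  congr 1
  push_cast
  ring

theorem HalfSections.mem_closure_inner (hφ : IsBranchedAlong φ P) (hκ : PunctureChart P κ δ)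
    (hs : HalfSections φ κ δ sm sp a) {Ψ : ℂ → F} (hΨ : ExpLift φ κ δ Ψ) {v : V}
    (h : Ψ (Real.log δ + (-Real.pi : ℝ) * Complex.I) = sm v (-δ)) {x : F}
    (hlim : ∀ O ∈ 𝓝 x, ∃ R, ∀ w : ℂ, w.re < R → w ∈ expDomain δ ∧ Ψ w ∈ O) :
    x ∈ closure (sm v '' innerRay δ) := by
  rw [mem_closure_iff_nhds]
  intro O hO
  obtain ⟨R, hR⟩ := hlim O hO
  set t := Real.exp (R - 1) with ht
  have ht0 : 0 < t := Real.exp_pos _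
  have hw := hR (Real.log t + (-Real.pi : ℝ) * Complex.I) (by simp [ht])
  have htδ : t ≤ δ := by
    have := (mem_expDomain hκ.pos).mp hw.1
    rw [exp_inner ht0] at this
    simpa [abs_of_pos ht0] using this
  refine ⟨sm v (-t), ?_, ⟨_, ⟨t, ⟨ht0, htδ⟩, rfl⟩, rfl⟩⟩
  rw [← exp_inner ht0, ← hs.eq_lower hφ hκ hΨ h hw.1 (by simp) (by simp [Real.pi_pos.le])]
  exact hw.2

/-- A turn around the puncture replaces the index `v` by `a v` but does not change the limit of the
lift. -/
theorem HalfSections.exists_common_limit (hφ : IsBranchedAlong φ P) (hκ : PunctureChart P κ δ)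
    (hs : HalfSections φ κ δ sm sp a) (v : V) : ∃ x, φ x = κ 0 ∧
      x ∈ closure (sm v '' innerRay δ) ∧ x ∈ closure (sm (a v) '' innerRay δ) := by
  obtain ⟨Ψ, hΨ, h⟩ := hs.exists_expLift hφ hκ v
  obtain ⟨x, hx, hlim⟩ := hΨ.exists_limit hφ hκ
  refine ⟨x, hx, hs.mem_closure_inner hφ hκ hΨ h hlim, ?_⟩
  refine hs.mem_closure_inner hφ hκ (hΨ.shift 1) (v := a v)
    (by simpa using hs.eq_shift hφ hκ hΨ h) fun O hO => ?_
  obtain ⟨R, hR⟩ := hlim O hO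
  refine ⟨R, fun w hw => ⟨(hR w hw).1, (hR _ ?_).2⟩⟩
  simpa using hw

/-- There are points over the punctured disk arbitrarily close to `x`. The lift through a
sufficiently close one converges to `x`, and its value at the base of the inner radius gives the
index. -/
theorem HalfSections.exists_mem_closure (hφ : IsBranchedAlong φ P) (hκ : PunctureChart P κ δ)
    (hs : HalfSections φ κ δ sm sp a) {x : F} (hx : φ x = κ 0) :
    ∃ v, x ∈ closure (sm v '' innerRay δ) := by
  obtain ⟨U, hU, hlim⟩ := exists_nhds_forall_tendsto hφ hκ hx
  obtain ⟨U', hU', hz, -⟩ := exists_nhds_forall_exists hφ hκ hx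
  obtain ⟨U₀, hU₀, -, hxU₀, hpc, -⟩ := hφ.punctured x (hx ▸ hκ.center) _ (inter_mem hU hU')
  obtain ⟨y, hy, hyx⟩ := hpc.nonempty
  obtain ⟨z, hzδ, hz0, hyz⟩ := hz y (hU₀ hy).2 hyx
  have hwz : Complex.exp (Complex.log z) = z := Complex.exp_log hz0
  have hwd : Complex.log z ∈ expDomain δ := by rwa [mem_expDomain hκ.pos, hwz]
  obtain ⟨Ψ, hΨ, hΨy⟩ := ArcTwist.exists_expLift hφ hκ hwd (y := y) (by rw [hwz, hyz])
  have hl := hlim Ψ hΨ ⟨_, hwd, by rw [hΨy]; exact (hU₀ hy).1⟩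
  obtain ⟨v, hv⟩ := hs.surj (Ψ (Real.log δ + (-Real.pi : ℝ) * Complex.I)) (by
    rw [hΨ.lift _ (log_mem_expDomain hκ.pos le_rfl _), exp_inner hκ.pos])
  exact ⟨v, hs.mem_closure_inner hφ hκ hΨ hv.symm hl⟩

/-- Near `x` the lift with index `v` reaches every point, so the other section is this lift after
some number of turns; by double periodicity only the parity of that number matters. -/
theorem HalfSections.eq_or_eq_of_mem_closure (hφ : IsBranchedAlong φ P)
    (hκ : PunctureChart P κ δ) (hs : HalfSections φ κ δ sm sp a) (hD : DoublePeriodic φ κ δ)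
    {x : F} (hx : φ x = κ 0) {v w : V} (hv : x ∈ closure (sm v '' innerRay δ))
    (hw : x ∈ closure (sm w '' innerRay δ)) : w = v ∨ w = a v := by
  obtain ⟨U, hU, -, hcov⟩ := exists_nhds_forall_exists hφ hκ hx
  obtain ⟨_, h₁U, _, ⟨t₁, ht₁, rfl⟩, rfl⟩ := mem_closure_iff_nhds.mp hv U hU
  obtain ⟨_, h₂U, _, ⟨t₂, ht₂, rfl⟩, rfl⟩ := mem_closure_iff_nhds.mp hw U hU
  obtain ⟨Ψ, hΨ, h⟩ := hs.exists_expLift hφ hκ v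
  have hd₁ := log_mem_expDomain ht₁.1 ht₁.2 (-Real.pi)
  have hd₂ := log_mem_expDomain ht₂.1 ht₂.2 (-Real.pi)
  have e₁ : Ψ (Real.log t₁ + (-Real.pi : ℝ) * Complex.I) = sm v (-t₁) := by
    rw [hs.eq_lower hφ hκ hΨ h hd₁ (by simp) (by simp [Real.pi_pos.le]), exp_inner ht₁.1]
  have e₂ : ∀ (Θ : ℂ → F) (u : V), ExpLift φ κ δ Θ →
      Θ (Real.log δ + (-Real.pi : ℝ) * Complex.I) = sm u (-δ) →
      Θ (Real.log t₂ + (-Real.pi : ℝ) * Complex.I) = sm u (-t₂) := by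
    intro Θ u hΘ hΘu
    rw [hs.eq_lower hφ hκ hΘ hΘu hd₂ (by simp) (by simp [Real.pi_pos.le]), exp_inner ht₂.1]
  have hm₂ : (-t₂ : ℂ) ∈ lowerHalf δ := by
    simp [lowerHalf, abs_of_pos ht₂.1, ht₂.2, ht₂.1.ne']
  have hlift₂ : φ (sm w (-t₂)) = κ (-t₂) := hs.liftLower w _ hm₂
  have hne : sm w (-t₂) ≠ x := by
    intro he
    rw [he, hx] at hlift₂
    have := hκ.off (-t₂) hm₂.1 hm₂.2.2
    rw [← hlift₂] at this
    exact this hκ.center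
  obtain ⟨u, hu, hue⟩ := hcov Ψ hΨ _ hd₁ (by rw [e₁]; exact h₁U) _ h₂U hne
  have hexp : Complex.exp u = Complex.exp (Real.log t₂ + (-Real.pi : ℝ) * Complex.I) := by
    refine hκ.inj (by simpa using (mem_expDomain hκ.pos).mp hu)
      (by simpa using (mem_expDomain hκ.pos).mp hd₂) ?_
    rw [← hΨ.lift u hu, exp_inner ht₂.1, ← hlift₂, hue]
  obtain ⟨n, hn⟩ := Complex.exp_eq_exp_iff_exists_int.mp hexp
  obtain ⟨Θ, hΘ, hΘw⟩ := hs.exists_expLift hφ hκ w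
  have hΘ₂ := e₂ Θ w hΘ hΘw
  have hd : (Real.log δ + (-Real.pi : ℝ) * Complex.I : ℂ) ∈ expDomain δ :=
    log_mem_expDomain hκ.pos le_rfl _
  rw [hn] at hue
  rcases hD.zmul hΨ n hd₂ with h' | h'
  · left
    have := hΘ.eqOn hφ hκ hΨ hd₂ (by rw [hΘ₂, ← hue, h']) hd
    rw [hΘw, h] at this
    exact hs.inj _ _ this
  · right
    have := hΘ.eqOn hφ hκ (hΨ.shift 1) hd₂ (by rw [hΘ₂, ← hue, h']; simp) hd
    rw [hΘw] at this
    apply hs.inj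
    rw [this, ← hs.eq_shift hφ hκ hΨ h]
    simp

end Half

end Local

end ArcTwist

namespace ArcTwist

/-! ### From the local form to the topology; the arc in twist coordinates -/

section Arc

variable {F : Type*} [TopologicalSpace F]

/-- In the chart `u` a punctured neighborhood is a punctured disk, the image of a half-plane under
`exp`, hence path connected; and `u ^ m` vanishes only at the center, so `x` is alone in its fibre.
Nothing else of the local form is used. -/
theorem IsBranchedCover.isBranchedAlong {φ : C(F, Disk)} {P : Set Disk}
    (hφ : IsBranchedCover φ P) : IsBranchedAlong φ P := by
  refine ⟨hφ.covering, fun x hx O hO => ?_⟩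
  obtain ⟨m, u, v, hm, hxu, hux, hut, -, hvx, -, hform⟩ := hφ.local_form x hx
  have h0t : (0 : ℂ) ∈ u.target := by rw [← hux]; exact u.map_source hxu
  have hsymm0 : u.symm 0 = x := by rw [← hux, u.left_inv hxu]
  have hcont : ContinuousAt u.symm 0 := u.continuousAt_symm h0t
  obtain ⟨ε₀, hε₀, hball⟩ := Metric.mem_nhds_iff.mp (hcont (by rwa [hsymm0]))
  set ε := min ε₀ 1 with hε
  have hε0 : 0 < ε := lt_min hε₀ one_pos
  have hεt : Metric.ball 0 ε ⊆ u.target := by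
    rw [hut]
    exact Metric.ball_subset_ball (min_le_right _ _)
  refine ⟨u.source ∩ u ⁻¹' Metric.ball 0 ε, ?_, u.isOpen_inter_preimage Metric.isOpen_ball,
    ⟨hxu, by simp [hux, hε0]⟩, ?_, ?_⟩
  · rintro y ⟨hy, hyε⟩
    rw [← u.left_inv hy]
    exact hball (Metric.ball_subset_ball (min_le_left _ _) hyε)
  · have himg : (u.source ∩ u ⁻¹' Metric.ball 0 ε) \ {x} =
        (fun w : ℂ => u.symm (Complex.exp w)) '' {w | w.re < Real.log ε} := by
      have hn : ∀ w : ℂ, w.re < Real.log ε ↔ Complex.exp w ∈ Metric.ball (0 : ℂ) ε := by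
        intro w
        rw [mem_ball_zero_iff, Complex.norm_exp, Real.lt_log_iff_exp_lt hε0]
      ext y
      constructor
      · rintro ⟨⟨hy, hyε⟩, hyx⟩
        have hne : u y ≠ 0 := fun h => hyx (by
          rw [mem_singleton_iff, ← u.left_inv hy, h, hsymm0])
        refine ⟨Complex.log (u y), ?_, ?_⟩
        · rw [mem_ofPred_eq, hn, Complex.exp_log hne]
          exact hyε
        · simp only
          rw [Complex.exp_log hne, u.left_inv hy]
      · rintro ⟨w, hw, rfl⟩
        have hw' := (hn w).mp hw
        refine ⟨⟨u.map_target (hεt hw'), ?_⟩, ?_⟩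
        · rw [mem_preimage, u.right_inv (hεt hw')]
          exact hw'
        · intro h
          have := congrArg u h
          rw [u.right_inv (hεt hw'), hux] at this
          exact Complex.exp_ne_zero w this
    rw [himg]
    refine IsPathConnected.image' ?_ ?_
    · exact (convex_halfSpace_re_lt _).isPathConnected
        ⟨((Real.log ε - 1 : ℝ) : ℂ), by simp⟩
    · refine u.continuousOn_symm.comp Complex.continuous_exp.continuousOn fun w hw => hεt ?_
      rw [mem_ball_zero_iff, Complex.norm_exp, ← Real.lt_log_iff_exp_lt hε0]
      exact hw
  · rintro y ⟨hy, -⟩ hyx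
    have h1 := (hform y hy).2
    rw [hyx, hvx] at h1
    have h2 : u y = 0 := by
      rcases pow_eq_zero_iff hm.ne' |>.mp h1.symm with h
      exact h
    rw [← u.left_inv hy, h2, hsymm0]

variable {P α : Set Disk} {τ : Disk ≃ₜ Disk} {h : Disk → Disk}

/-- In the coordinates of a half-twist along `α`, the punctures are the ends of the segment. -/
theorem TwistChart.mem_punctures_iff (D : TwistChart P τ h) (hα : IsArcJoining P α)
    (hseg : h '' {z | (z : ℂ).im = 0 ∧ |(z : ℂ).re| ≤ 1 / 2} = α) (hrange : range h ∩ P ⊆ α)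
    {z : ℂ} (hz : ‖z‖ ≤ 1) : h (pr z) ∈ P ↔ z = 1 / 2 ∨ z = -(1 / 2) := by
  obtain ⟨γ, hγi, hγr, -, hγP⟩ := hα
  have hne : Nonempty Disk := ⟨pr 0⟩
  have hinv : ∀ t, ∃ w : Disk, ((w : ℂ).im = 0 ∧ |(w : ℂ).re| ≤ 1 / 2) ∧ h w = γ t := by
    intro t
    have : γ t ∈ α := hγr ▸ mem_range_self t
    rw [← hseg] at this
    exact this
  choose w hw hwγ using hinv
  have hwc : Continuous w := by
    have h1 : Continuous fun t => Function.invFun h (γ t) :=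
      D.continuousOn_invFun.comp_continuous γ.continuous fun t => ⟨w t, hwγ t⟩
    refine h1.congr fun t => ?_
    rw [← hwγ t, Function.leftInverse_invFun D.emb.injective]
  let θ : I → ℝ := fun t => (w t : ℂ).re
  have hwθ : ∀ t, (w t : ℂ) = (θ t : ℂ) := fun t => Complex.ext rfl (by simpa using (hw t).1)
  have hθc : Continuous θ := Complex.continuous_re.comp (continuous_subtype_val.comp hwc)
  have hθi : Function.Injective θ := by
    intro s t hst
    apply hγi
    rw [← hwγ s, ← hwγ t]
    congr 1
    apply Subtype.ext
    rw [hwθ, hwθ, hst]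
  have hsurj : ∀ s : ℝ, |s| ≤ 1 / 2 → ∃ t, θ t = s ∧ h (pr s) = γ t := by
    intro s hs
    have hs1 : ‖(s : ℂ)‖ ≤ 1 := by
      rw [Complex.norm_real, Real.norm_eq_abs]
      linarith
    have : h (pr s) ∈ α := by
      rw [← hseg]
      exact ⟨pr s, by rw [mem_ofPred_eq, coe_pr hs1]; simpa using hs, rfl⟩
    rw [← hγr] at this
    obtain ⟨t, ht⟩ := this
    refine ⟨t, ?_, ht.symm⟩
    have h2 := D.emb.injective ((hwγ t).trans ht)
    change (w t : ℂ).re = s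
    rw [h2, coe_pr hs1, Complex.ofReal_re]
  have hbd : ∀ t, -(1 / 2) ≤ θ t ∧ θ t ≤ 1 / 2 := fun t => abs_le.mp (hw t).2
  obtain ⟨tp, htp, htpγ⟩ := hsurj (1 / 2) (by norm_num [abs_of_pos])
  obtain ⟨tm, htm, htmγ⟩ := hsurj (-(1 / 2)) (by norm_num [abs_of_pos])
  -- In the coordinate of the segment the arc is an injective continuous real function, hence
  -- monotone; as it attains `±1/2`, its ends go to the ends of the segment.
  have hends : (θ 0 = -(1 / 2) ∧ θ 1 = 1 / 2) ∨ (θ 0 = 1 / 2 ∧ θ 1 = -(1 / 2)) := by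
    rcases hθc.strictMono_of_inj_boundedOrder' hθi with hm | hm
    · left
      exact ⟨le_antisymm (htm ▸ hm.monotone (unitInterval.nonneg' (t := tm))) (hbd 0).1,
        le_antisymm (hbd 1).2 (htp ▸ hm.monotone (unitInterval.le_one' (t := tp)))⟩
    · right
      exact ⟨le_antisymm (hbd 0).2 (htp ▸ hm.antitone (unitInterval.nonneg' (t := tp))),
        le_antisymm (htm ▸ hm.antitone (unitInterval.le_one' (t := tm))) (hbd 1).1⟩
  have key : ∀ t, (t = 0 ∨ t = 1) ↔ θ t = 1 / 2 ∨ θ t = -(1 / 2) := by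
    intro t
    constructor
    · rintro (rfl | rfl) <;> rcases hends with h | h <;> simp [h.1, h.2]
    · rcases hends with h | h
      · rintro (h' | h')
        · exact Or.inr (hθi (h'.trans h.2.symm))
        · exact Or.inl (hθi (h'.trans h.1.symm))
      · rintro (h' | h')
        · exact Or.inl (hθi (h'.trans h.1.symm))
        · exact Or.inr (hθi (h'.trans h.2.symm))
  have hcast : ∀ t, (θ t = 1 / 2 ∨ θ t = -(1 / 2)) ↔
      ((w t : ℂ) = 1 / 2 ∨ (w t : ℂ) = -(1 / 2)) := by
    intro t
    rw [hwθ]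
    constructor
    · rintro (h | h) <;> rw [h] <;> simp
    · rintro (h | h)
      · left
        simpa using congrArg Complex.re h
      · right
        simpa using congrArg Complex.re h
  have hmain : ∀ t, γ t ∈ P ↔ ((w t : ℂ) = 1 / 2 ∨ (w t : ℂ) = -(1 / 2)) := fun t =>
    (hγP t).trans ((key t).trans (hcast t))
  constructor
  · intro hzP
    have hzα := hrange ⟨⟨pr z, rfl⟩, hzP⟩
    rw [← hγr] at hzα
    obtain ⟨t, ht⟩ := hzα
    have hwz : w t = pr z := D.emb.injective ((hwγ t).trans ht)
    have := (hmain t).mp (ht ▸ hzP)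
    rwa [hwz, coe_pr hz] at this
  · intro hz'
    rcases hz' with rfl | rfl
    · have h1 := (hmain tp).mpr ((hcast tp).mp (Or.inl htp))
      rw [← htpγ] at h1
      simpa using h1
    · have h1 := (hmain tm).mpr ((hcast tm).mp (Or.inr htm))
      rw [← htmγ] at h1
      simpa using h1

end Arc

end ArcTwist

namespace ArcTwist

/-! ### The covering over the neighborhood of the arc -/

/-- The lower half of the unit disk, without the punctures `±1/2`. -/
def lowerDisk : Set ℂ := {z | ‖z‖ ≤ 1 ∧ z.im ≤ 0 ∧ z ≠ 1 / 2 ∧ z ≠ -(1 / 2)}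

/-- The upper half of the unit disk, without the punctures `±1/2`. -/
def upperDisk : Set ℂ := {z | ‖z‖ ≤ 1 ∧ 0 ≤ z.im ∧ z ≠ 1 / 2 ∧ z ≠ -(1 / 2)}

theorem neg_mem_upperDisk {z : ℂ} : -z ∈ upperDisk ↔ z ∈ lowerDisk := by
  simp only [upperDisk, lowerDisk, mem_ofPred_eq, norm_neg, Complex.neg_im, Left.nonneg_neg_iff,
    ne_eq, neg_eq_iff_eq_neg, neg_neg]
  tauto

theorem neg_mem_lowerDisk {z : ℂ} : -z ∈ lowerDisk ↔ z ∈ upperDisk := by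
  rw [← neg_mem_upperDisk, neg_neg]

/-- Without the punctures the half-disk is no longer convex. But a segment from a point of it to `i`
leaves the real axis at once, so it meets no puncture. -/
theorem starConvex_upperDisk : StarConvex ℝ Complex.I upperDisk := by
  rintro z ⟨hz, hi, h1, h2⟩ a b ha hb hab
  have him : (a • Complex.I + b • z).im = a + b * z.im := by simp
  have hbz : 0 ≤ b * z.im := mul_nonneg hb hi
  have key : (a • Complex.I + b • z).im = 0 → a • Complex.I + b • z = z := by
    intro h0
    have ha0 : a = 0 := by
      rw [him] at h0
      linarith
    have hb1 : b = 1 := by linarith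
    simp [ha0, hb1]
  refine ⟨?_, ?_, ?_, ?_⟩
  · have := (convex_closedBall (0 : ℂ) 1) (x := Complex.I) (by simp) (y := z) (by simpa using hz)
      ha hb hab
    simpa using this
  · rw [him]
    linarith
  · intro h
    rw [key (by rw [h]; simp)] at h
    exact h1 h
  · intro h
    rw [key (by rw [h]; simp)] at h
    exact h2 h

theorem starConvex_lowerDisk : StarConvex ℝ (-Complex.I) lowerDisk := by
  have h := starConvex_upperDisk.neg
  have : -upperDisk = lowerDisk := by
    ext z
    rw [Set.mem_neg, neg_mem_upperDisk]
  rwa [this] at h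

theorem I_mem_upperDisk : Complex.I ∈ upperDisk := by
  refine ⟨by simp, by simp, fun h => ?_, fun h => ?_⟩ <;>
  · have := congrArg Complex.im h
    simp at this

theorem negI_mem_lowerDisk : -Complex.I ∈ lowerDisk := neg_mem_lowerDisk.mpr I_mem_upperDisk

theorem isPreconnected_upperDisk : IsPreconnected upperDisk :=
  (starConvex_upperDisk.isPathConnected I_mem_upperDisk).isConnected.isPreconnected

theorem isPreconnected_lowerDisk : IsPreconnected lowerDisk :=
  (starConvex_lowerDisk.isPathConnected negI_mem_lowerDisk).isConnected.isPreconnected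

theorem ofReal_mem_upperDisk {t : ℝ} (ht : |t| ≤ 1) (h1 : t ≠ 1 / 2) (h2 : t ≠ -(1 / 2)) :
    (t : ℂ) ∈ upperDisk := by
  refine ⟨by simpa using ht, by simp, fun h => h1 ?_, fun h => h2 ?_⟩ <;>
  · have := congrArg Complex.re h
    simpa using this

theorem ofReal_mem_lowerDisk {t : ℝ} (ht : |t| ≤ 1) (h1 : t ≠ 1 / 2) (h2 : t ≠ -(1 / 2)) :
    (t : ℂ) ∈ lowerDisk := by
  refine ⟨by simpa using ht, by simp, fun h => h1 ?_, fun h => h2 ?_⟩ <;>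
  · have := congrArg Complex.re h
    simpa using this

/-- A continuous map of the closed unit disk that takes only `±1/2` to punctures. -/
structure TwoPunctured (P : Set Disk) (κ : ℂ → Disk) : Prop where
  cont : Continuous κ
  off : ∀ z, ‖z‖ ≤ 1 → z ≠ 1 / 2 → z ≠ -(1 / 2) → κ z ∉ P

theorem TwoPunctured.neg {P : Set Disk} {κ : ℂ → Disk} (hκ : TwoPunctured P κ) :
    TwoPunctured P fun z => κ (-z) :=
  ⟨hκ.cont.comp continuous_neg, fun z hz h1 h2 => hκ.off _ (by simpa using hz)
    (fun h => h2 (by rw [← h, neg_neg])) fun h => h1 (by rw [← neg_neg z, h, neg_neg])⟩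

theorem twist_neg (k : ℤ) (z : ℂ) : twist k (-z) = -twist k z := by simp [twist]

theorem TwoPunctured.twist {P : Set Disk} {κ : ℂ → Disk} (hκ : TwoPunctured P κ) (k : ℤ) :
    TwoPunctured P fun z => κ (ArcTwist.twist k z) := by
  refine ⟨hκ.cont.comp (continuous_twist k), fun z hz h1 h2 => ?_⟩
  refine hκ.off _ (by rwa [norm_twist]) (fun h => ?_) fun h => ?_
  · exact (twist_half k (Or.inl h)).elim h1 h2
  · exact (twist_half k (Or.inr h)).elim h1 h2

/-! ### Adding one half-twist -/

section Spiral

variable {F : Type*} [TopologicalSpace F] {φ : C(F, Disk)} {P : Set Disk} {κ : ℂ → Disk}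

theorem eqOn_of_lifts_disk (hφ : IsBranchedAlong φ P) (hκ : TwoPunctured P κ) {A : Set ℂ}
    (hA : IsPreconnected A) (hA1 : ∀ z ∈ A, ‖z‖ ≤ 1 ∧ z ≠ 1 / 2 ∧ z ≠ -(1 / 2)) {f g : ℂ → F}
    (hf : ContinuousOn f A) (hg : ContinuousOn g A) (hfl : ∀ z ∈ A, φ (f z) = κ z)
    (hgl : ∀ z ∈ A, φ (g z) = κ z) {z : ℂ} (hz : z ∈ A) (e : f z = g z) : EqOn f g A := by
  refine eqOn_of_lifts hφ.covering hA hf hg (fun w hw => ?_) (fun w hw => ?_) hz e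
  · rw [hfl w hw]
    exact hκ.off w (hA1 w hw).1 (hA1 w hw).2.1 (hA1 w hw).2.2
  · rw [hfl w hw, hgl w hw]

/-- The convex region, in polar coordinates, between the circle and the spiral traced by the
half-twist of a radius. -/
def spiralRegion : Set (ℝ × ℝ) :=
  {x | x.1 ≤ 1 ∧ x.2 ≤ Real.pi / 2 ∧ -(Real.pi / 2) + 2 * Real.pi * (1 - x.1) ≤ x.2}

theorem convex_spiralRegion : Convex ℝ spiralRegion := by
  rintro ⟨r, s⟩ ⟨h1, h2, h3⟩ ⟨r', s'⟩ ⟨h1', h2', h3'⟩ a b ha hb hab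
  simp only at h1 h2 h3 h1' h2' h3'
  have hb' : b = 1 - a := by linarith
  subst hb'
  refine ⟨?_, ?_, ?_⟩ <;> simp only [Prod.smul_mk, Prod.mk_add_mk, smul_eq_mul]
  · nlinarith
  · nlinarith
  · nlinarith [mul_le_mul_of_nonneg_left h3 ha, mul_le_mul_of_nonneg_left h3' hb]

noncomputable def polar (x : ℝ × ℝ) : ℂ := x.1 * Complex.exp (x.2 * Complex.I)

theorem continuous_polar : Continuous polar := by
  unfold polar
  fun_prop

theorem norm_polar (x : ℝ × ℝ) : ‖polar x‖ = |x.1| := by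
  rw [polar, norm_mul, Complex.norm_exp_ofReal_mul_I, mul_one, Complex.norm_real,
    Real.norm_eq_abs]

theorem polar_half_pi (r : ℝ) : polar (r, Real.pi / 2) = r * Complex.I := by
  simp [polar, Complex.exp_pi_div_two_mul_I]

theorem spiralRegion_bounds {x : ℝ × ℝ} (hx : x ∈ spiralRegion) : 1 / 2 ≤ x.1 ∧ x.1 ≤ 1 := by
  obtain ⟨h1, h2, h3⟩ := hx
  refine ⟨?_, h1⟩
  have := Real.pi_pos
  nlinarith

/-- The region reaches radius `1/2` only at its corner of angle `π/2`, that is at `i/2`; elsewhere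
the radius is larger. -/
theorem polar_ne_half {x : ℝ × ℝ} (hx : x ∈ spiralRegion) :
    ‖polar x‖ ≤ 1 ∧ polar x ≠ 1 / 2 ∧ polar x ≠ -(1 / 2) := by
  have hb := spiralRegion_bounds hx
  have habs : |x.1| = x.1 := abs_of_nonneg (by linarith)
  have key : ‖polar x‖ = 1 / 2 → polar x = (1 / 2 : ℝ) * Complex.I := by
    intro h
    rw [norm_polar, habs] at h
    have h2 : x.2 = Real.pi / 2 := by
      obtain ⟨-, h2, h3⟩ := hx
      rw [h] at h3
      linarith
    have : x = (1 / 2, Real.pi / 2) := Prod.ext h h2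
    rw [this, polar_half_pi]
  refine ⟨by rw [norm_polar, habs]; exact hb.2, fun h => ?_, fun h => ?_⟩
  · have h1 := key (by rw [h]; simp)
    rw [h] at h1
    have := congrArg Complex.im h1
    simp at this
  · have h1 := key (by rw [h]; simp)
    rw [h] at h1
    have := congrArg Complex.im h1
    simp at this

theorem twist_radius {r : ℝ} (h1 : 1 / 2 ≤ r) :
    twist 1 (-(r * Complex.I)) = polar (r, -(Real.pi / 2) + 2 * Real.pi * (1 - r)) := by
  have hn : ‖-((r : ℂ) * Complex.I)‖ = r := by
    rw [norm_neg, norm_mul, Complex.norm_I, mul_one, Complex.norm_real, Real.norm_eq_abs,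
      abs_of_nonneg (by linarith)]
  have hm : min 1 (2 * (1 - r)) = 2 * (1 - r) := min_eq_right (by linarith)
  rw [twist, hn, hm, polar]
  simp only
  rw [Complex.ofReal_add, add_mul, Complex.exp_add]
  have : Complex.exp (((-(Real.pi / 2) : ℝ) : ℂ) * Complex.I) = -Complex.I := by
    push_cast
    rw [neg_mul, Complex.exp_neg, Complex.exp_pi_div_two_mul_I, Complex.inv_I]
  rw [this]
  push_cast
  ring_nf

/-- The effect of one more half-twist on the lift of a radius. -/
theorem spiral_lift (hφ : IsBranchedAlong φ P) (hκ : TwoPunctured P κ) (k : ℤ)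
    {f₀ f₁ s₀ s₁ : ℂ → F}
    (hf₀ : ContinuousOn f₀ lowerDisk) (hf₀l : ∀ z ∈ lowerDisk, φ (f₀ z) = κ (twist (k + 1) z))
    (hf₁ : ContinuousOn f₁ upperDisk) (hf₁l : ∀ z ∈ upperDisk, φ (f₁ z) = κ (twist k z))
    (hs₀ : ContinuousOn s₀ lowerDisk) (hs₀l : ∀ z ∈ lowerDisk, φ (s₀ z) = κ z)
    (hs₁ : ContinuousOn s₁ upperDisk) (hs₁l : ∀ z ∈ upperDisk, φ (s₁ z) = κ z)
    (h₀ : f₀ (-Complex.I) = s₀ (-Complex.I)) (h₁ : s₀ 1 = s₁ 1)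
    (h₂ : f₁ Complex.I = s₁ Complex.I) : f₀ 0 = f₁ 0 := by
  have hpi := Real.pi_pos
  have hκk := hκ.twist k
  have hA : ((1, -(Real.pi / 2)) : ℝ × ℝ) ∈ spiralRegion := by
    refine ⟨le_rfl, ?_, ?_⟩ <;> simp only <;> linarith
  have hpolA : polar (1, -(Real.pi / 2)) = -Complex.I := by
    have := twist_radius (r := 1) (by norm_num)
    rw [sub_self, mul_zero, add_zero, Complex.ofReal_one, one_mul,
      twist_of_norm_eq_one 1 (by simp)] at this
    exact this.symm
  -- The region is bounded by the twisted lower radius, the right half-circle from `-i` to `i`, and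
  -- the outer half of the upper radius. It avoids both punctures, so one lift over it, compared
  -- with the given lifts along its boundary, links `f₀` with `f₁`.
  obtain ⟨Θ, hΘ, hΘA, hΘl⟩ := exists_lift_of_convex hφ.covering convex_spiralRegion
    (ψ := fun x => κ (twist k (polar x))) ((hκk.cont.comp continuous_polar).continuousOn)
    (fun x hx => hκk.off _ (polar_ne_half hx).1 (polar_ne_half hx).2.1 (polar_ne_half hx).2.2)
    hA (x := s₀ (-Complex.I)) (by
      rw [hs₀l _ negI_mem_lowerDisk, hpolA, twist_of_norm_eq_one k (by simp)])
  have hoff : ∀ x ∈ spiralRegion, φ (Θ x) ∈ Pᶜ := fun x hx => by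
    rw [hΘl x hx]
    exact hκk.off _ (polar_ne_half hx).1 (polar_ne_half hx).2.1 (polar_ne_half hx).2.2
  have hlow : ∀ r ∈ Icc (0 : ℝ) 1, -((r : ℂ) * Complex.I) ∈ lowerDisk := by
    intro r hr
    refine ⟨by simpa [abs_of_nonneg hr.1] using hr.2, by simpa using hr.1, fun h => ?_,
      fun h => ?_⟩ <;>
    · have := congrArg Complex.re h
      norm_num at this
  have hupp : ∀ r ∈ Icc (0 : ℝ) 1, ((r : ℂ) * Complex.I) ∈ upperDisk := fun r hr =>
    neg_mem_lowerDisk.mp (hlow r hr)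
  have hhalf : ∀ r ∈ Icc (1 / 2 : ℝ) 1, r ∈ Icc (0 : ℝ) 1 := fun r hr =>
    ⟨by linarith [hr.1], hr.2⟩
  have hone : (1 : ℝ) ∈ Icc (1 / 2 : ℝ) 1 := ⟨by norm_num, le_rfl⟩
  have hhalfm : (1 / 2 : ℝ) ∈ Icc (1 / 2 : ℝ) 1 := ⟨le_rfl, by norm_num⟩
  have hsp : ∀ r ∈ Icc (1 / 2 : ℝ) 1,
      ((r, -(Real.pi / 2) + 2 * Real.pi * (1 - r)) : ℝ × ℝ) ∈ spiralRegion := by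
    intro r hr
    refine ⟨hr.2, ?_, le_rfl⟩
    simp only
    nlinarith [hr.1]
  have htop : ∀ r ∈ Icc (1 / 2 : ℝ) 1, ((r, Real.pi / 2) : ℝ × ℝ) ∈ spiralRegion := by
    intro r hr
    refine ⟨hr.2, le_rfl, ?_⟩
    simp only
    nlinarith [hr.1]
  have hcir : ∀ t ∈ Icc (-(Real.pi / 2)) (Real.pi / 2), ((1, t) : ℝ × ℝ) ∈ spiralRegion := by
    intro t ht
    refine ⟨le_rfl, ht.2, ?_⟩
    simp only
    linarith [ht.1]
  -- along the spiral
  have hedge1 : EqOn (fun r : ℝ => Θ (r, -(Real.pi / 2) + 2 * Real.pi * (1 - r)))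
      (fun r : ℝ => f₀ (-(r * Complex.I))) (Icc (1 / 2) 1) := by
    refine eqOn_of_lifts hφ.covering isPreconnected_Icc (hΘ.comp (by fun_prop) hsp)
      (hf₀.comp (by fun_prop) fun r hr => hlow r (hhalf r hr)) (fun r hr => hoff _ (hsp r hr))
      (fun r hr => ?_) hone ?_
    · rw [hΘl _ (hsp r hr), hf₀l _ (hlow r (hhalf r hr)), twist_add, twist_radius hr.1]
    · simp only [sub_self, mul_zero, add_zero, Complex.ofReal_one, one_mul]
      rw [hΘA, h₀]
  -- along the circle
  have hcnorm : ∀ t : ℝ, ‖polar (1, t)‖ = 1 := fun t => by rw [norm_polar]; simp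
  have hcre : ∀ t : ℝ, polar (1, t) ≠ 1 / 2 ∧ polar (1, t) ≠ -(1 / 2) := by
    intro t
    constructor <;>
    · intro h
      have := hcnorm t
      rw [h] at this
      norm_num at this
  have hcim : ∀ t : ℝ, (polar (1, t)).im = Real.sin t := by
    intro t
    simp [polar, Complex.exp_ofReal_mul_I_im]
  have hclow : ∀ t ∈ Icc (-(Real.pi / 2)) 0, polar (1, t) ∈ lowerDisk := fun t ht =>
    ⟨(hcnorm t).le, by
      rw [hcim]
      exact Real.sin_nonpos_of_nonpos_of_neg_pi_le ht.2 (by linarith [ht.1]), hcre t⟩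
  have hcupp : ∀ t ∈ Icc 0 (Real.pi / 2), polar (1, t) ∈ upperDisk := fun t ht =>
    ⟨(hcnorm t).le, by
      rw [hcim]
      exact Real.sin_nonneg_of_nonneg_of_le_pi ht.1 (by linarith [ht.2]), hcre t⟩
  have hcir1 : ∀ t ∈ Icc (-(Real.pi / 2)) 0, ((1, t) : ℝ × ℝ) ∈ spiralRegion := fun t ht =>
    hcir t ⟨ht.1, by linarith [ht.2]⟩
  have hcir2 : ∀ t ∈ Icc 0 (Real.pi / 2), ((1, t) : ℝ × ℝ) ∈ spiralRegion := fun t ht =>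
    hcir t ⟨by linarith [ht.1], ht.2⟩
  have hpc : Continuous fun t : ℝ => polar (1, t) := continuous_polar.comp (by fun_prop)
  have hedge2 : EqOn (fun t : ℝ => Θ (1, t)) (fun t : ℝ => s₀ (polar (1, t)))
      (Icc (-(Real.pi / 2)) 0) := by
    refine eqOn_of_lifts hφ.covering isPreconnected_Icc (hΘ.comp (by fun_prop) hcir1)
      (hs₀.comp hpc.continuousOn hclow) (fun t ht => hoff _ (hcir1 t ht)) (fun t ht => ?_)
      (a := -(Real.pi / 2)) ⟨le_rfl, by linarith⟩ ?_
    · rw [hΘl _ (hcir1 t ht), hs₀l _ (hclow t ht), twist_of_norm_eq_one k (hcnorm t)]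
    · rw [hΘA, hpolA]
  have hp0 : polar (1, 0) = 1 := by simp [polar]
  have hedge3 : EqOn (fun t : ℝ => Θ (1, t)) (fun t : ℝ => s₁ (polar (1, t)))
      (Icc 0 (Real.pi / 2)) := by
    refine eqOn_of_lifts hφ.covering isPreconnected_Icc (hΘ.comp (by fun_prop) hcir2)
      (hs₁.comp hpc.continuousOn hcupp) (fun t ht => hoff _ (hcir2 t ht)) (fun t ht => ?_)
      (a := 0) ⟨le_rfl, by linarith⟩ ?_
    · rw [hΘl _ (hcir2 t ht), hs₁l _ (hcupp t ht), twist_of_norm_eq_one k (hcnorm t)]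
    · have := hedge2 (⟨by linarith, le_rfl⟩ : (0 : ℝ) ∈ Icc (-(Real.pi / 2)) 0)
      refine this.trans ?_
      simp only [hp0, h₁]
  have hTop : Θ (1, Real.pi / 2) = f₁ Complex.I := by
    have : Θ (1, Real.pi / 2) = _ :=
      hedge3 (⟨by linarith, le_rfl⟩ : Real.pi / 2 ∈ Icc 0 (Real.pi / 2))
    refine this.trans ?_
    simp only [polar_half_pi, Complex.ofReal_one, one_mul, h₂]
  -- along the upper radius
  have hedge4 : EqOn (fun r : ℝ => Θ (r, Real.pi / 2)) (fun r : ℝ => f₁ (r * Complex.I))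
      (Icc (1 / 2) 1) := by
    refine eqOn_of_lifts hφ.covering isPreconnected_Icc (hΘ.comp (by fun_prop) htop)
      (hf₁.comp (by fun_prop) fun r hr => hupp r (hhalf r hr)) (fun r hr => hoff _ (htop r hr))
      (fun r hr => ?_) hone ?_
    · rw [hΘl _ (htop r hr), hf₁l _ (hupp r (hhalf r hr)), polar_half_pi]
    · simp only [Complex.ofReal_one, one_mul]
      exact hTop
  have hmid : f₀ (-((1 / 2 : ℝ) * Complex.I)) = f₁ ((1 / 2 : ℝ) * Complex.I) := by
    have e1 := hedge1 hhalfm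
    have e4 := hedge4 hhalfm
    simp only at e1 e4
    rw [← e1, ← e4]
    congr 2
    ring
  have hin : ∀ r ∈ Icc (0 : ℝ) (1 / 2), r ∈ Icc (0 : ℝ) 1 := fun r hr =>
    ⟨hr.1, by linarith [hr.2]⟩
  -- Inside radius `1/2` the extra half-twist is `z ↦ -z`, which sends the lower radius to the upper
  -- one.
  have hedge5 : EqOn (fun r : ℝ => f₀ (-(r * Complex.I))) (fun r : ℝ => f₁ (r * Complex.I))
      (Icc 0 (1 / 2)) := by
    refine eqOn_of_lifts hφ.covering isPreconnected_Icc
      (hf₀.comp (by fun_prop) fun r hr => hlow r (hin r hr))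
      (hf₁.comp (by fun_prop) fun r hr => hupp r (hin r hr)) (fun r hr => ?_)
      (fun r hr => ?_) (a := 1 / 2) ⟨by norm_num, le_rfl⟩ hmid
    · rw [hf₀l _ (hlow r (hin r hr))]
      obtain ⟨n1, -, n2, n3⟩ := hlow r (hin r hr)
      exact (hκ.twist (k + 1)).off _ n1 n2 n3
    · rw [hf₀l _ (hlow r (hin r hr)), hf₁l _ (hupp r (hin r hr)), twist_add,
        twist_one_of_norm_le, neg_neg]
      simpa [abs_of_nonneg hr.1] using hr.2
  have := hedge5 (⟨le_rfl, by norm_num⟩ : (0 : ℝ) ∈ Icc (0 : ℝ) (1 / 2))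
  simpa using this

end Spiral

end ArcTwist

namespace ArcTwist

/-! ### Sections over the two halves and lifts of the powers of the twist -/

section ArcSections

variable {F : Type*} [TopologicalSpace F] {V : Type*}

/-- The sections over the two halves of the unit disk, indexed by the fibre over `0`, and the
permutations that describe how they fit together to the right and to the left of the punctures. -/
structure ArcSections (φ : C(F, Disk)) (κ : ℂ → Disk) (sm sp : V → ℂ → F) (a b : V → V) :
    Prop where
  contLower : ∀ v, ContinuousOn (sm v) lowerDisk
  contUpper : ∀ v, ContinuousOn (sp v) upperDisk
  liftLower : ∀ v, ∀ z ∈ lowerDisk, φ (sm v z) = κ z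
  liftUpper : ∀ v, ∀ z ∈ upperDisk, φ (sp v z) = κ z
  zero : ∀ v, sm v 0 = sp v 0
  right : ∀ v, sm v 1 = sp (a v) 1
  left : ∀ v, sp v (-1) = sm (b v) (-1)
  inj : ∀ v w, sm v 0 = sm w 0 → v = w
  surj : ∀ y, φ y = κ 0 → ∃ v, sm v 0 = y

/-- Lifts, over the two halves of the unit disk, of the `k`-th power of the twist, that agree with
the sections `sm` and `sp` on the boundary. -/
structure TwistLifts (φ : C(F, Disk)) (κ : ℂ → Disk) (sm sp : V → ℂ → F) (k : ℤ)
    (gm gp : V → ℂ → F) : Prop where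
  contLower : ∀ v, ContinuousOn (gm v) lowerDisk
  contUpper : ∀ v, ContinuousOn (gp v) upperDisk
  liftLower : ∀ v, ∀ z ∈ lowerDisk, φ (gm v z) = κ (twist k z)
  liftUpper : ∀ v, ∀ z ∈ upperDisk, φ (gp v z) = κ (twist k z)
  base : ∀ v, gm v (-Complex.I) = sm v (-Complex.I)
  base' : ∀ v, gp v Complex.I = sp v Complex.I

variable {φ : C(F, Disk)} {P : Set Disk} {κ : ℂ → Disk} {sm sp : V → ℂ → F} {a b : V → V}

theorem zero_mem_upperDisk : (0 : ℂ) ∈ upperDisk := by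
  simpa using ofReal_mem_upperDisk (t := 0) (by simp) (by norm_num) (by norm_num)

theorem zero_mem_lowerDisk : (0 : ℂ) ∈ lowerDisk := by
  simpa using ofReal_mem_lowerDisk (t := 0) (by simp) (by norm_num) (by norm_num)

theorem one_mem_upperDisk : (1 : ℂ) ∈ upperDisk := by
  simpa using ofReal_mem_upperDisk (t := 1) (by simp) (by norm_num) (by norm_num)

theorem one_mem_lowerDisk : (1 : ℂ) ∈ lowerDisk := by
  simpa using ofReal_mem_lowerDisk (t := 1) (by simp) (by norm_num) (by norm_num)

theorem neg_one_mem_upperDisk : (-1 : ℂ) ∈ upperDisk := neg_mem_upperDisk.mpr one_mem_lowerDisk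

theorem neg_one_mem_lowerDisk : (-1 : ℂ) ∈ lowerDisk := neg_mem_lowerDisk.mpr one_mem_upperDisk

theorem upperDisk_bounds {z : ℂ} (hz : z ∈ upperDisk) :
    ‖z‖ ≤ 1 ∧ z ≠ 1 / 2 ∧ z ≠ -(1 / 2) := ⟨hz.1, hz.2.2⟩

theorem lowerDisk_bounds {z : ℂ} (hz : z ∈ lowerDisk) :
    ‖z‖ ≤ 1 ∧ z ≠ 1 / 2 ∧ z ≠ -(1 / 2) := ⟨hz.1, hz.2.2⟩

theorem TwoPunctured.mapsTo_upper (hκ : TwoPunctured P κ) : MapsTo κ upperDisk Pᶜ :=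
  fun z hz => hκ.off z hz.1 hz.2.2.1 hz.2.2.2

theorem TwoPunctured.mapsTo_lower (hκ : TwoPunctured P κ) : MapsTo κ lowerDisk Pᶜ :=
  fun z hz => hκ.off z hz.1 hz.2.2.1 hz.2.2.2

namespace ArcSections

theorem exists_upper (hφ : IsBranchedAlong φ P) (hκ : TwoPunctured P κ) {z : ℂ}
    (hz : z ∈ upperDisk) {y : F} (hy : φ y = κ z) :
    ∃ f : ℂ → F, ContinuousOn f upperDisk ∧ f z = y ∧ ∀ z ∈ upperDisk, φ (f z) = κ z :=
  exists_lift_of_starConvex hφ.covering starConvex_upperDisk hκ.cont.continuousOn hκ.mapsTo_upper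
    hz hy

theorem exists_lower (hφ : IsBranchedAlong φ P) (hκ : TwoPunctured P κ) {z : ℂ}
    (hz : z ∈ lowerDisk) {y : F} (hy : φ y = κ z) :
    ∃ f : ℂ → F, ContinuousOn f lowerDisk ∧ f z = y ∧ ∀ z ∈ lowerDisk, φ (f z) = κ z :=
  exists_lift_of_starConvex hφ.covering starConvex_lowerDisk hκ.cont.continuousOn hκ.mapsTo_lower
    hz hy

theorem eqOn_upper (hφ : IsBranchedAlong φ P) (hκ : TwoPunctured P κ) {f g : ℂ → F}
    (hf : ContinuousOn f upperDisk) (hg : ContinuousOn g upperDisk)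
    (hfl : ∀ z ∈ upperDisk, φ (f z) = κ z) (hgl : ∀ z ∈ upperDisk, φ (g z) = κ z) {z : ℂ}
    (hz : z ∈ upperDisk) (e : f z = g z) : EqOn f g upperDisk :=
  eqOn_of_lifts_disk hφ hκ isPreconnected_upperDisk (fun _ h => upperDisk_bounds h) hf hg hfl hgl
    hz e

theorem eqOn_lower (hφ : IsBranchedAlong φ P) (hκ : TwoPunctured P κ) {f g : ℂ → F}
    (hf : ContinuousOn f lowerDisk) (hg : ContinuousOn g lowerDisk)
    (hfl : ∀ z ∈ lowerDisk, φ (f z) = κ z) (hgl : ∀ z ∈ lowerDisk, φ (g z) = κ z) {z : ℂ}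
    (hz : z ∈ lowerDisk) (e : f z = g z) : EqOn f g lowerDisk :=
  eqOn_of_lifts_disk hφ hκ isPreconnected_lowerDisk (fun _ h => lowerDisk_bounds h) hf hg hfl hgl
    hz e

/-- The fibre over `0` itself serves as index set. Continuing `sm v` through `1` into the upper
half, or `sp v` through `-1` into the lower half, gives a section again, and its value at `0` is the
index defining `a v`, respectively `b v`. -/
theorem exists_sections (hφ : IsBranchedAlong φ P) (hκ : TwoPunctured P κ) :
    ∃ (sm sp : {y // φ y = κ 0} → ℂ → F) (a b : {y // φ y = κ 0} → {y // φ y = κ 0}),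
      ArcSections φ κ sm sp a b := by
  choose sm hsm hsm0 hsml using fun v : {y // φ y = κ 0} =>
    exists_lower hφ hκ zero_mem_lowerDisk v.2
  choose sp hsp hsp0 hspl using fun v : {y // φ y = κ 0} =>
    exists_upper hφ hκ zero_mem_upperDisk v.2
  have ha : ∀ v, ∃ w, sm v 1 = sp w 1 := by
    intro v
    obtain ⟨f, hf, hf1, hfl⟩ := exists_upper hφ hκ one_mem_upperDisk
      (hsml v 1 one_mem_lowerDisk)
    refine ⟨⟨f 0, hfl 0 zero_mem_upperDisk⟩, ?_⟩
    rw [← hf1]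
    exact eqOn_upper hφ hκ hf (hsp _) hfl (hspl _) zero_mem_upperDisk
      (hsp0 ⟨f 0, hfl 0 zero_mem_upperDisk⟩).symm one_mem_upperDisk
  have hb : ∀ v, ∃ w, sp v (-1) = sm w (-1) := by
    intro v
    obtain ⟨f, hf, hf1, hfl⟩ := exists_lower hφ hκ neg_one_mem_lowerDisk
      (hspl v (-1) neg_one_mem_upperDisk)
    refine ⟨⟨f 0, hfl 0 zero_mem_lowerDisk⟩, ?_⟩
    rw [← hf1]
    exact eqOn_lower hφ hκ hf (hsm _) hfl (hsml _) zero_mem_lowerDisk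
      (hsm0 ⟨f 0, hfl 0 zero_mem_lowerDisk⟩).symm neg_one_mem_lowerDisk
  choose a ha using ha
  choose b hb using hb
  refine ⟨sm, sp, a, b, hsm, hsp, hsml, hspl, fun v => by rw [hsm0, hsp0], ha, hb, ?_, ?_⟩
  · intro v w h
    rw [hsm0, hsm0] at h
    exact Subtype.ext h
  · intro y hy
    exact ⟨⟨y, hy⟩, hsm0 _⟩

variable (S : ArcSections φ κ sm sp a b)
include S

theorem inj_lower (hφ : IsBranchedAlong φ P) (hκ : TwoPunctured P κ) {z : ℂ}
    (hz : z ∈ lowerDisk) {v w : V} (h : sm v z = sm w z) : v = w :=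
  S.inj v w (eqOn_lower hφ hκ (S.contLower v) (S.contLower w) (S.liftLower v) (S.liftLower w) hz h
    zero_mem_lowerDisk)

theorem inj_upper (hφ : IsBranchedAlong φ P) (hκ : TwoPunctured P κ) {z : ℂ}
    (hz : z ∈ upperDisk) {v w : V} (h : sp v z = sp w z) : v = w := by
  apply S.inj
  rw [S.zero, S.zero]
  exact eqOn_upper hφ hκ (S.contUpper v) (S.contUpper w) (S.liftUpper v) (S.liftUpper w) hz h
    zero_mem_upperDisk

theorem surj_lower (hφ : IsBranchedAlong φ P) (hκ : TwoPunctured P κ) {z : ℂ}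
    (hz : z ∈ lowerDisk) {y : F} (hy : φ y = κ z) : ∃ v, sm v z = y := by
  obtain ⟨f, hf, hf1, hfl⟩ := exists_lower hφ hκ hz hy
  obtain ⟨v, hv⟩ := S.surj (f 0) (hfl 0 zero_mem_lowerDisk)
  refine ⟨v, ?_⟩
  rw [← hf1]
  exact eqOn_lower hφ hκ (S.contLower v) hf (S.liftLower v) hfl zero_mem_lowerDisk hv hz

theorem surj_upper (hφ : IsBranchedAlong φ P) (hκ : TwoPunctured P κ) {z : ℂ}
    (hz : z ∈ upperDisk) {y : F} (hy : φ y = κ z) : ∃ v, sp v z = y := by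
  obtain ⟨f, hf, hf1, hfl⟩ := exists_upper hφ hκ hz hy
  obtain ⟨v, hv⟩ := S.surj (f 0) (hfl 0 zero_mem_upperDisk)
  refine ⟨v, ?_⟩
  rw [← hf1]
  exact eqOn_upper hφ hκ (S.contUpper v) hf (S.liftUpper v) hfl zero_mem_upperDisk
    ((S.zero v).symm.trans hv) hz

/-- Recentering at the puncture `1/2` with radius `1/2` puts the midpoint `0` of the arc at the
inner end `-1/2` and the boundary point `1` at the outer end, so `a` is the local monodromy there.
The left puncture follows from `neg`. -/
theorem half_right : HalfSections φ (fun z => κ (1 / 2 + z)) (1 / 2)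
    (fun v z => sm v (1 / 2 + z)) (fun v z => sp v (1 / 2 + z)) a := by
  have hn : ∀ z : ℂ, ‖z‖ ≤ 1 / 2 → z ≠ 0 →
      ‖1 / 2 + z‖ ≤ 1 ∧ 1 / 2 + z ≠ 1 / 2 ∧ 1 / 2 + z ≠ -(1 / 2) := by
    intro z hz h0
    refine ⟨(norm_add_le _ _).trans ?_, by simpa using h0, fun h => ?_⟩
    · have : ‖(1 / 2 : ℂ)‖ = 1 / 2 := by simp
      linarith
    · have : z = -1 := by linear_combination h
      rw [this] at hz
      norm_num at hz
  have hl : MapsTo (fun z : ℂ => 1 / 2 + z) (lowerHalf (1 / 2)) lowerDisk := fun z hz =>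
    ⟨(hn z hz.1 hz.2.2).1, by simpa using hz.2.1, (hn z hz.1 hz.2.2).2⟩
  have hu : MapsTo (fun z : ℂ => 1 / 2 + z) (upperHalf (1 / 2)) upperDisk := fun z hz =>
    ⟨(hn z hz.1 hz.2.2).1, by simpa using hz.2.1, (hn z hz.1 hz.2.2).2⟩
  have e0 : (1 / 2 + -((1 / 2 : ℝ) : ℂ)) = 0 := by
    push_cast
    ring
  have e1 : (1 / 2 + ((1 / 2 : ℝ) : ℂ)) = 1 := by
    push_cast
    ring
  refine ⟨fun v => (S.contLower v).comp (by fun_prop) hl,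
    fun v => (S.contUpper v).comp (by fun_prop) hu, fun v z hz => S.liftLower v _ (hl hz),
    fun v z hz => S.liftUpper v _ (hu hz), ?_, ?_, ?_, ?_⟩ <;> simp only [e0, e1]
  · exact S.zero
  · exact S.right
  · exact S.inj
  · exact S.surj

/-- The symmetry of the situation under rotation by `π`. -/
theorem neg : ArcSections φ (fun z => κ (-z)) (fun v z => sp v (-z)) (fun v z => sm v (-z))
    b a := by
  refine ⟨fun v => (S.contUpper v).comp (by fun_prop) fun z hz => neg_mem_upperDisk.mpr hz,
    fun v => (S.contLower v).comp (by fun_prop) fun z hz => neg_mem_lowerDisk.mpr hz,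
    fun v z hz => S.liftUpper v _ (neg_mem_upperDisk.mpr hz),
    fun v z hz => S.liftLower v _ (neg_mem_lowerDisk.mpr hz), fun v => ?_, S.left, fun v => ?_, ?_, ?_⟩
  · simpa using (S.zero v).symm
  · simpa using S.right v
  · intro v w h
    simp only [neg_zero] at h
    rw [← S.zero, ← S.zero] at h
    exact S.inj v w h
  · intro y hy
    simp only [neg_zero] at hy ⊢
    obtain ⟨v, hv⟩ := S.surj y hy
    exact ⟨v, by rw [← S.zero, hv]⟩

theorem exists_twistLifts (hφ : IsBranchedAlong φ P) (hκ : TwoPunctured P κ) (k : ℤ) :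
    ∃ gm gp, TwistLifts φ κ sm sp k gm gp := by
  have h1 := fun v => exists_lower hφ (hκ.twist k) negI_mem_lowerDisk (y := sm v (-Complex.I)) (by
    rw [S.liftLower v _ negI_mem_lowerDisk, twist_of_norm_eq_one k (by simp)])
  have h2 := fun v => exists_upper hφ (hκ.twist k) I_mem_upperDisk (y := sp v Complex.I) (by
    rw [S.liftUpper v _ I_mem_upperDisk, twist_of_norm_eq_one k (by simp)])
  choose gm hgm hgm0 hgml using h1
  choose gp hgp hgp0 hgpl using h2
  exact ⟨gm, gp, hgm, hgp, hgml, hgpl, hgm0, hgp0⟩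

theorem twistLifts_step (hφ : IsBranchedAlong φ P) (hκ : TwoPunctured P κ) {k : ℤ}
    {gm gp gm' gp' : V → ℂ → F} (hg : TwistLifts φ κ sm sp k gm gp)
    (hg' : TwistLifts φ κ sm sp (k + 1) gm' gp') (v : V) : gm' v 0 = gp (a v) 0 :=
  spiral_lift hφ hκ k (hg'.contLower v) (hg'.liftLower v) (hg.contUpper (a v))
    (hg.liftUpper (a v)) (S.contLower v) (S.liftLower v) (S.contUpper _) (S.liftUpper _)
    (hg'.base v) (S.right v) (hg.base' _)

omit S in
theorem _root_.ArcTwist.TwistLifts.neg {k : ℤ} {gm gp : V → ℂ → F}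
    (hg : TwistLifts φ κ sm sp k gm gp) :
    TwistLifts φ (fun z => κ (-z)) (fun v z => sp v (-z)) (fun v z => sm v (-z)) k
      (fun v z => gp v (-z)) (fun v z => gm v (-z)) := by
  refine ⟨fun v => (hg.contUpper v).comp (by fun_prop) fun z hz => neg_mem_upperDisk.mpr hz,
    fun v => (hg.contLower v).comp (by fun_prop) fun z hz => neg_mem_lowerDisk.mpr hz,
    fun v z hz => ?_, fun v z hz => ?_, ?_, ?_⟩
  · rw [hg.liftUpper v _ (neg_mem_upperDisk.mpr hz), twist_neg]
  · rw [hg.liftLower v _ (neg_mem_lowerDisk.mpr hz), twist_neg]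
  · intro v
    simpa using hg.base' v
  · intro v
    simpa using hg.base v

theorem twistLifts_inj (hφ : IsBranchedAlong φ P) (hκ : TwoPunctured P κ) {k : ℤ}
    {gm gp : V → ℂ → F} (hg : TwistLifts φ κ sm sp k gm gp) {v w : V} (h : gp v 0 = gp w 0) :
    v = w := by
  have := eqOn_upper hφ (hκ.twist k) (hg.contUpper v) (hg.contUpper w) (hg.liftUpper v)
    (hg.liftUpper w) zero_mem_upperDisk h I_mem_upperDisk
  rw [hg.base', hg.base'] at this
  exact S.inj_upper hφ hκ I_mem_upperDisk this

/-- The lifts of the `k`-th power of the twist are matched over `0` by the `k`-th power of the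
product of the two local monodromies. -/
theorem twistLifts_zero (hφ : IsBranchedAlong φ P) (hκ : TwoPunctured P κ)
    (ha : Function.Involutive a) (hb : Function.Involutive b) {gm gp : ℤ → V → ℂ → F}
    (hg : ∀ k, TwistLifts φ κ sm sp k (gm k) (gp k)) (k : ℤ) (v : V) :
    gm k v 0 = gp k (((hb.toPerm * ha.toPerm) ^ k) v) 0 := by
  set A := ha.toPerm with hA
  set B := hb.toPerm with hB
  have hA2 : A * A = 1 := by
    ext v
    exact ha v
  have hB2 : B * B = 1 := by
    ext v
    exact hb v
  have hAi : A⁻¹ = A := inv_eq_of_mul_eq_one_left hA2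
  have hBi : B⁻¹ = B := inv_eq_of_mul_eq_one_left hB2
  -- Dihedral relation: conjugation by `B` inverts `B A`. The two steps below apply `A` and `B`
  -- alternately to the lower and upper lifts; this relation collects them into powers of `B A`.
  have hconj : ∀ k : ℤ, B * (B * A) ^ k * B = ((B * A) ^ k)⁻¹ := by
    intro k
    have h1 : B * (B * A) * B⁻¹ = (B * A)⁻¹ := by
      rw [mul_inv_rev, hAi, hBi, ← mul_assoc, hB2, one_mul]
    rw [← inv_zpow, ← h1, conj_zpow, hBi]
  have step1 : ∀ k v, gm (k + 1) v 0 = gp k (A v) 0 := fun k v =>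
    S.twistLifts_step hφ hκ (hg k) (hg (k + 1)) v
  -- Rotation by `π` exchanges the halves and the two punctures, so the step across the left
  -- puncture is the step across the right one for the rotated data.
  have step2 : ∀ k v, gp (k + 1) v 0 = gm k (B v) 0 := fun k v => by
    have : gp (k + 1) v 0 = gm k (b v) 0 := by
      simpa using S.neg.twistLifts_step hφ hκ.neg (hg k).neg (hg (k + 1)).neg v
    exact this
  induction k using Int.induction_on generalizing v with
  | zero =>
    have h1 := eqOn_lower hφ hκ ((hg 0).contLower v) (S.contLower v)
      (fun z hz => by rw [(hg 0).liftLower v z hz, twist_zero]) (S.liftLower v)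
      negI_mem_lowerDisk ((hg 0).base v) zero_mem_lowerDisk
    have h2 := eqOn_upper hφ hκ ((hg 0).contUpper v) (S.contUpper v)
      (fun z hz => by rw [(hg 0).liftUpper v z hz, twist_zero]) (S.liftUpper v)
      I_mem_upperDisk ((hg 0).base' v) zero_mem_upperDisk
    rw [h1, zpow_zero, Equiv.Perm.one_apply, h2, S.zero]
  | succ i ih =>
    rw [step1, step2, ih]
    congr 1
    have : A = (B * A) ^ (i : ℤ) * (B * (B * A) ^ ((i : ℤ) + 1)) := by
      have h2 : B * (B * A) ^ (i : ℤ) = ((B * A) ^ (i : ℤ))⁻¹ * B := by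
        rw [← hconj, mul_assoc, hB2, mul_one]
      rw [zpow_add_one, ← mul_assoc B, h2]
      simp only [← mul_assoc]
      rw [mul_inv_cancel, one_mul, hB2, one_mul]
    conv_lhs => rw [this]
    rfl
  | pred i ih =>
    have e : (-(i : ℤ) - 1) + 1 = -(i : ℤ) := by ring
    have h1 := step1 (-(i : ℤ) - 1) (((B * A) ^ (-(i : ℤ)))⁻¹ (B v))
    have h2 := step2 (-(i : ℤ) - 1) (B v)
    rw [e] at h1 h2
    have hBB : B (B v) = v := hb v
    rw [hBB] at h2
    rw [← h2]
    rw [ih] at h1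
    have h3 : ((B * A) ^ (-(i : ℤ))) (((B * A) ^ (-(i : ℤ)))⁻¹ (B v)) = B v := by
      rw [← Equiv.Perm.mul_apply, mul_inv_cancel, Equiv.Perm.one_apply]
    rw [h3] at h1
    rw [h1]
    congr 1
    have : (B * A) ^ (-(i : ℤ) - 1) = A * (((B * A) ^ (-(i : ℤ)))⁻¹ * B) := by
      have h4 : (B * A) ^ (-(i : ℤ) - 1) = (B * A)⁻¹ * (B * A) ^ (-(i : ℤ)) := by
        rw [sub_eq_neg_add, zpow_add, zpow_neg_one]
      rw [h4, ← hconj, mul_assoc _ B B, hB2, mul_one, mul_inv_rev, hAi, hBi, mul_assoc]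
    rw [this]
    rfl

theorem twistLifts_zero_iff (hφ : IsBranchedAlong φ P) (hκ : TwoPunctured P κ)
    (ha : Function.Involutive a) (hb : Function.Involutive b) {k : ℤ} {gm gp : V → ℂ → F}
    (hg : TwistLifts φ κ sm sp k gm gp) :
    (∀ v, gm v 0 = gp v 0) ↔ (hb.toPerm * ha.toPerm) ^ k = 1 := by
  classical
  choose gm' gp' hg' using fun k => S.exists_twistLifts hφ hκ k
  -- The recursion needs lifts for all exponents at once; the given pair is inserted at the exponent
  -- `k`.
  have key := S.twistLifts_zero hφ hκ ha hb (gm := Function.update gm' k gm)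
    (gp := Function.update gp' k gp) (fun l => by
      by_cases h : l = k
      · subst h
        simpa using hg
      · simpa [h] using hg' l) k
  simp only [Function.update_self] at key
  constructor
  · intro h
    ext v
    exact S.twistLifts_inj hφ hκ hg ((key v).symm.trans (h v))
  · intro h v
    rw [key, h]
    rfl

end ArcSections

end ArcSections

end ArcTwist

namespace ArcTwist

/-! ### Matching the lifts across the real axis -/

section ArcSections

variable {F : Type*} [TopologicalSpace F] {V : Type*} {φ : C(F, Disk)} {P : Set Disk} {κ : ℂ → Disk}
  {sm sp : V → ℂ → F} {a b : V → V}

namespace ArcSections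

/-- The twist is trivial on the circle, so over the lower half-circle both sides lift the same map,
and they agree at `-i`. -/
theorem lower_of_norm_eq_one (S : ArcSections φ κ sm sp a b) (hφ : IsBranchedAlong φ P)
    (hκ : TwoPunctured P κ) {k : ℤ}
    {gm gp : V → ℂ → F} (hg : TwistLifts φ κ sm sp k gm gp) (v : V) {z : ℂ} (hz : z ∈ lowerDisk)
    (h1 : ‖z‖ = 1) : gm v z = sm v z := by
  have hn : ∀ t : ℝ, ‖Complex.exp (t * Complex.I)‖ = 1 := Complex.norm_exp_ofReal_mul_I
  have hmem : ∀ t ∈ Icc (-Real.pi) 0, Complex.exp (t * Complex.I) ∈ lowerDisk := by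
    intro t ht
    refine ⟨(hn t).le, ?_, fun h => ?_, fun h => ?_⟩
    · rw [Complex.exp_ofReal_mul_I_im]
      exact Real.sin_nonpos_of_nonpos_of_neg_pi_le ht.2 ht.1
    · have := hn t
      rw [h] at this
      norm_num at this
    · have := hn t
      rw [h] at this
      norm_num at this
  -- The principal argument serves except at `-1`, where it is `π` and must be replaced by `-π`.
  have hex : ∃ t ∈ Icc (-Real.pi) 0, Complex.exp (t * Complex.I) = z := by
    have hz' : Complex.exp (Complex.arg z * Complex.I) = z := by
      have := Complex.norm_mul_exp_arg_mul_I z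
      rwa [h1, Complex.ofReal_one, one_mul] at this
    rcases le_or_gt z.arg 0 with h0 | h0
    · exact ⟨z.arg, ⟨(Complex.neg_pi_lt_arg z).le, h0⟩, hz'⟩
    · have him : z.im = 0 := le_antisymm hz.2.1 (Complex.arg_nonneg_iff.mp h0.le)
      have hpi : z.arg = Real.pi := by
        by_contra hne
        have hlt := lt_of_le_of_ne (Complex.arg_le_pi z) hne
        have := Real.sin_pos_of_pos_of_lt_pi h0 hlt
        rw [← Complex.exp_ofReal_mul_I_im, hz', him] at this
        exact lt_irrefl _ this
      refine ⟨-Real.pi, ⟨le_rfl, by linarith [Real.pi_pos]⟩, ?_⟩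
      rw [← hz', hpi]
      push_cast
      rw [neg_mul, Complex.exp_neg, Complex.exp_pi_mul_I]
      norm_num
  obtain ⟨t, ht, rfl⟩ := hex
  have hcont : ContinuousOn (fun t : ℝ => Complex.exp (t * Complex.I)) (Icc (-Real.pi) 0) := by
    fun_prop
  have hI : Complex.exp (((-(Real.pi / 2) : ℝ) : ℂ) * Complex.I) = -Complex.I := by
    push_cast
    rw [neg_mul, Complex.exp_neg, Complex.exp_pi_div_two_mul_I, Complex.inv_I]
  refine eqOn_of_lifts (f := fun t : ℝ => gm v (Complex.exp (t * Complex.I)))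
    (g := fun t : ℝ => sm v (Complex.exp (t * Complex.I))) hφ.covering isPreconnected_Icc
    ((hg.contLower v).comp hcont hmem) ((S.contLower v).comp hcont hmem) ?_ ?_
    (a := -(Real.pi / 2)) ⟨by linarith [Real.pi_pos], by linarith [Real.pi_pos]⟩ ?_ ht
  · intro s hs
    rw [hg.liftLower v _ (hmem s hs), twist_of_norm_eq_one k (hn s)]
    exact hκ.mapsTo_lower (hmem s hs)
  · intro s hs
    rw [hg.liftLower v _ (hmem s hs), twist_of_norm_eq_one k (hn s), S.liftLower v _ (hmem s hs)]
  · simp only [hI]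
    exact hg.base v

theorem upper_of_norm_eq_one (S : ArcSections φ κ sm sp a b) (hφ : IsBranchedAlong φ P)
    (hκ : TwoPunctured P κ) {k : ℤ}
    {gm gp : V → ℂ → F} (hg : TwistLifts φ κ sm sp k gm gp) (v : V) {z : ℂ} (hz : z ∈ upperDisk)
    (h1 : ‖z‖ = 1) : gp v z = sp v z := by
  simpa using S.neg.lower_of_norm_eq_one hφ hκ.neg hg.neg v (z := -z) (neg_mem_lowerDisk.mpr hz)
    (by simpa using h1)

theorem compat_of_preconnected (S : ArcSections φ κ sm sp a b) (hφ : IsBranchedAlong φ P)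
    (hκ : TwoPunctured P κ) {k : ℤ} {gm gp : V → ℂ → F} (hg : TwistLifts φ κ sm sp k gm gp)
    {A : Set ℂ} (hA : IsPreconnected A) (hl : A ⊆ lowerDisk) (hu : A ⊆ upperDisk) {z₀ z : ℂ}
    (hz₀ : z₀ ∈ A) (hz : z ∈ A) (h0 : ∀ v w, sm v z₀ = sp w z₀ → gm v z₀ = gp w z₀) {v w : V}
    (h : sm v z = sp w z) : gm v z = gp w z := by
  have h1 := eqOn_of_lifts_disk hφ hκ hA (fun _ h => upperDisk_bounds (hu h))
    ((S.contLower v).mono hl) ((S.contUpper w).mono hu) (fun z hz => S.liftLower v z (hl hz))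
    (fun z hz => S.liftUpper w z (hu hz)) hz h hz₀
  exact eqOn_of_lifts_disk hφ (hκ.twist k) hA (fun _ h => upperDisk_bounds (hu h))
    ((hg.contLower v).mono hl) ((hg.contUpper w).mono hu) (fun z hz => hg.liftLower v z (hl hz))
    (fun z hz => hg.liftUpper w z (hu hz)) hz₀ (h0 v w h1) hz

/-- The halves meet in three intervals. On the two outer ones the lifts agree at `±1` by their
boundary values, on the middle one at `0` by hypothesis; agreement at a point spreads over the
interval. -/
theorem compat (S : ArcSections φ κ sm sp a b) (hφ : IsBranchedAlong φ P)
    (hκ : TwoPunctured P κ) {k : ℤ} {gm gp : V → ℂ → F} (hg : TwistLifts φ κ sm sp k gm gp)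
    (h0 : ∀ v, gm v 0 = gp v 0) {z : ℂ} (hl : z ∈ lowerDisk) (hu : z ∈ upperDisk) {v w : V}
    (h : sm v z = sp w z) : gm v z = gp w z := by
  obtain ⟨t, rfl⟩ : ∃ t : ℝ, (t : ℂ) = z :=
    ⟨z.re, Complex.ext (by simp) (by simpa using le_antisymm hu.2.1 hl.2.1)⟩
  have ht : |t| ≤ 1 := by simpa using hl.1
  have ht1 : t ≠ 1 / 2 := fun h => hl.2.2.1 (by rw [h]; push_cast; rfl)
  have ht2 : t ≠ -(1 / 2) := fun h => hl.2.2.2 (by rw [h]; push_cast; rfl)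
  have main : ∀ (T : Set ℝ), IsPreconnected T → (∀ s ∈ T, |s| ≤ 1 ∧ s ≠ 1 / 2 ∧ s ≠ -(1 / 2)) →
      ∀ s₀ ∈ T, (∀ v w, sm v (s₀ : ℂ) = sp w s₀ → gm v (s₀ : ℂ) = gp w s₀) → t ∈ T →
      gm v (t : ℂ) = gp w t := by
    intro T hT hT' s₀ hs₀ hh htT
    refine S.compat_of_preconnected hφ hκ hg (A := (fun t : ℝ => (t : ℂ)) '' T)
      (hT.image _ Complex.continuous_ofReal.continuousOn) ?_ ?_ ⟨s₀, hs₀, rfl⟩ ⟨t, htT, rfl⟩ hh h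
    · rintro _ ⟨s, hs, rfl⟩
      exact ofReal_mem_lowerDisk (hT' s hs).1 (hT' s hs).2.1 (hT' s hs).2.2
    · rintro _ ⟨s, hs, rfl⟩
      exact ofReal_mem_upperDisk (hT' s hs).1 (hT' s hs).2.1 (hT' s hs).2.2
  have hcirc : ∀ s : ℝ, |s| = 1 → ∀ v w, sm v (s : ℂ) = sp w s → gm v (s : ℂ) = gp w s := by
    intro s hs v w hvw
    have e1 : s ≠ 1 / 2 := by rintro rfl; norm_num [abs_of_pos] at hs
    have e2 : s ≠ -(1 / 2) := by rintro rfl; norm_num [abs_of_pos] at hs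
    rw [S.lower_of_norm_eq_one hφ hκ hg v (ofReal_mem_lowerDisk hs.le e1 e2) (by simpa using hs),
      S.upper_of_norm_eq_one hφ hκ hg w (ofReal_mem_upperDisk hs.le e1 e2) (by simpa using hs), hvw]
  rw [abs_le] at ht
  rcases lt_or_gt_of_ne ht1 with h1 | h1
  · rcases lt_or_gt_of_ne ht2 with h2 | h2
    · refine main (Ico (-1) (-(1 / 2))) isPreconnected_Ico (fun s hs => ?_) (-1) (by norm_num)
        (hcirc (-1) (by norm_num)) ⟨ht.1, h2⟩
      exact ⟨abs_le.mpr ⟨hs.1, by linarith [hs.2]⟩, by linarith [hs.2], hs.2.ne⟩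
    · refine main (Ioo (-(1 / 2)) (1 / 2)) isPreconnected_Ioo (fun s hs => ?_) 0 (by norm_num)
        (fun v w hvw => ?_) ⟨h2, h1⟩
      · exact ⟨abs_le.mpr ⟨by linarith [hs.1], by linarith [hs.2]⟩, hs.2.ne, hs.1.ne'⟩
      · simp only [Complex.ofReal_zero] at hvw ⊢
        rw [← S.zero] at hvw
        rw [S.inj v w hvw, h0]
  · refine main (Ioc (1 / 2) 1) isPreconnected_Ioc (fun s hs => ?_) 1 (by norm_num)
      (hcirc 1 (by norm_num)) ⟨h1, ht.2⟩
    exact ⟨abs_le.mpr ⟨by linarith [hs.1], hs.2⟩, hs.1.ne', by linarith [hs.1]⟩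

end ArcSections

end ArcSections

/-! ### Lifting the twist -/

/-- A twist chart that meets the finite set `P` of interior points exactly in `±1/2`. -/
structure ArcChart (P : Set Disk) (τ : Disk ≃ₜ Disk) (h : Disk → Disk) : Prop extends
    TwistChart P τ h where
  mem_iff : ∀ z : ℂ, ‖z‖ ≤ 1 → (h (pr z) ∈ P ↔ z = 1 / 2 ∨ z = -(1 / 2))
  finite : P.Finite
  interior : ∀ p ∈ P, ‖(p : ℂ)‖ < 1

namespace ArcChart

variable {P : Set Disk} {τ : Disk ≃ₜ Disk} {h : Disk → Disk}

theorem twoPunctured (D : ArcChart P τ h) : TwoPunctured P fun z => h (pr z) :=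
  ⟨D.continuous_chart, fun z hz h1 h2 hP => ((D.mem_iff z hz).mp hP).elim h1 h2⟩

theorem nhds_image (D : ArcChart P τ h) {c : ℂ} (hc : ‖c‖ < 1) {ε : ℝ} (hε : 0 < ε) :
    h '' {w | dist (w : ℂ) c < ε} ∈ 𝓝 (h (pr c)) := by
  refine D.image_mem_nhds (by rw [coe_pr hc.le]; exact hc.ne) ?_
  refine IsOpen.mem_nhds ?_ ?_
  · exact isOpen_lt (by fun_prop) continuous_const
  · simpa [coe_pr hc.le] using hε

theorem norm_half_add_le {z : ℂ} (hz : ‖z‖ ≤ 1 / 2) : ‖1 / 2 + z‖ ≤ 1 := by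
  have : ‖(1 / 2 : ℂ)‖ = 1 / 2 := by simp
  exact (norm_add_le _ _).trans (by linarith)

theorem punctureChart_right (D : ArcChart P τ h) :
    PunctureChart P (fun z => h (pr (1 / 2 + z))) (1 / 2) := by
  refine ⟨by norm_num, ?_, ?_, ?_, ?_, ?_⟩
  · exact (D.continuous_chart.comp (continuous_const.add continuous_id)).continuousOn
  · intro z hz w hw e
    exact add_left_cancel (D.chart_injOn (norm_half_add_le (by simpa using hz))
      (norm_half_add_le (by simpa using hw)) e)
  · exact (D.mem_iff _ (norm_half_add_le (by norm_num))).mpr (Or.inl (by simp))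
  · intro z hz h0 hP
    rcases (D.mem_iff _ (norm_half_add_le hz)).mp hP with h | h
    · exact h0 (by simpa using h)
    · have : z = -1 := by linear_combination h
      rw [this] at hz
      norm_num at hz
  · intro ε hε hε1
    have e : (1 / 2 + (0 : ℂ)) = 1 / 2 := by simp
    simp only [e]
    refine mem_of_superset (D.nhds_image (c := 1 / 2) (by norm_num) hε) ?_
    rintro _ ⟨w, hw, rfl⟩
    refine ⟨(w : ℂ) - 1 / 2, by simpa [dist_eq_norm] using hw, ?_⟩
    simp [pr_coe]

theorem punctureChart_left (D : ArcChart P τ h) :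
    PunctureChart P (fun z => h (pr (-(1 / 2 + z)))) (1 / 2) := by
  have hn : ∀ z : ℂ, ‖z‖ ≤ 1 / 2 → ‖-(1 / 2 + z)‖ ≤ 1 := fun z hz => by
    rw [norm_neg]
    exact norm_half_add_le hz
  refine ⟨by norm_num, ?_, ?_, ?_, ?_, ?_⟩
  · exact (D.continuous_chart.comp (continuous_const.add continuous_id).neg).continuousOn
  · intro z hz w hw e
    exact add_left_cancel (neg_injective (D.chart_injOn (hn z (by simpa using hz))
      (hn w (by simpa using hw)) e))
  · exact (D.mem_iff _ (hn 0 (by norm_num))).mpr (Or.inr (by simp))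
  · intro z hz h0 hP
    rcases (D.mem_iff _ (hn z hz)).mp hP with h | h
    · have : z = -1 := by linear_combination -h
      rw [this] at hz
      norm_num at hz
    · exact h0 (by simpa using h)
  · intro ε hε hε1
    have e : -(1 / 2 + (0 : ℂ)) = -(1 / 2) := by simp
    simp only [e]
    refine mem_of_superset (D.nhds_image (c := -(1 / 2)) (by norm_num) hε) ?_
    rintro _ ⟨w, hw, rfl⟩
    refine ⟨-(w : ℂ) - 1 / 2, ?_, ?_⟩
    · rw [mem_ball_zero_iff, ← norm_neg]
      convert (show dist (w : ℂ) (-(1 / 2)) < ε from hw) using 1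
      rw [dist_eq_norm]
      congr 1
      ring
    · simp [pr_coe]

end ArcChart

end ArcTwist

namespace ArcTwist

/-! ### Extension over the branch points and rigidity of lifts -/

section LiftCriterion

set_option linter.unusedSectionVars false

variable {F : Type*} [TopologicalSpace F] [CompactSpace F] [T2Space F] {V : Type*} {φ : C(F, Disk)}
  {P : Set Disk} {τ : Disk ≃ₜ Disk} {h : Disk → Disk} {sm sp : V → ℂ → F} {a b : V → V}

theorem IsBranchedAlong.map_nhds (hφ : IsBranchedAlong φ P) {x : F} (hx : φ x ∉ P) :
    map φ (𝓝 x) = 𝓝 (φ x) :=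
  hφ.covering.isLocalHomeomorphOn.map_nhds_eq hx

theorem IsBranchedAlong.dense_compl (hφ : IsBranchedAlong φ P) (hP : P.Finite) :
    Dense {x | φ x ∉ P} := by
  intro x
  by_cases hx : φ x ∈ P
  · rw [mem_closure_iff_nhds]
    intro O hO
    have hW : φ ⁻¹' (P \ {φ x})ᶜ ∈ 𝓝 x := φ.continuous.continuousAt
      ((hP.subset sdiff_subset).isClosed.isOpen_compl.mem_nhds (by simp))
    obtain ⟨U, hUO, -, -, hU, hUx⟩ := hφ.punctured x hx _ (inter_mem hO hW)
    obtain ⟨y, hy, hyx⟩ := hU.nonempty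
    exact ⟨y, (hUO hy).1, fun hyP => (hUO hy).2 ⟨hyP, fun e => hyx (hUx y hy e)⟩⟩
  · exact subset_closure hx

/-- A lift, over the complement of the branch points, of a map that preserves the branch points,
extends continuously. -/
theorem IsBranchedAlong.exists_extension (hφ : IsBranchedAlong φ P) (hP : P.Finite) {T : Disk → Disk}
    (hT : Continuous T) (hTP : MapsTo T P P) {g : ↥{x | φ x ∉ P} → F} (hg : Continuous g)
    (hgφ : ∀ x, φ (g x) = T (φ x)) :
    ∃ G : F → F, Continuous G ∧ (∀ x : ↥{x | φ x ∉ P}, G x = g x) ∧ ∀ x, φ (G x) = T (φ x) := by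
  have hd : IsDenseInducing (Subtype.val : ↥{x | φ x ∉ P} → F) :=
    (hφ.dense_compl hP).isDenseInducing_val
  have hlim : ∀ x : F, ∃ y, Tendsto g (comap Subtype.val (𝓝 x)) (𝓝 y) := by
    intro x
    by_cases hx : φ x ∈ P
    · have hfin := hφ.finite_fibre (hTP hx)
      obtain ⟨O, hO, hOd⟩ := hfin.t2_separation
      -- In a small punctured neighborhood, `g` takes values in only one of the sets `O y`.
      have hloc : ∀ Q : F → Set F, (∀ y, Q y ∈ 𝓝 y) → (∀ y, Q y ⊆ O y) → (∀ y, IsOpen (Q y)) →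
          ∃ y ∈ φ ⁻¹' {T (φ x)}, ∃ U ∈ 𝓝 x, ∀ z : ↥{x | φ x ∉ P}, (z : F) ∈ U → g z ∈ Q y := by
        intro Q hQ hQO hQo
        obtain ⟨W, hW, hWQ⟩ := exists_nhds_preimage_subset φ
          (O := ⋃ y ∈ φ ⁻¹' {T (φ x)}, Q y) (isOpen_biUnion fun y _ => hQo y)
          (fun y hy => mem_biUnion hy (mem_of_mem_nhds (hQ y)))
        have hW' : φ ⁻¹' (T ⁻¹' W ∩ (P \ {φ x})ᶜ) ∈ 𝓝 x :=
          φ.continuous.continuousAt (inter_mem (hT.continuousAt hW)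
            ((hP.subset sdiff_subset).isClosed.isOpen_compl.mem_nhds (by simp)))
        obtain ⟨U, hUO, hUo, hxU, hU, hUx⟩ := hφ.punctured x hx _ hW'
        have hUP : ∀ z ∈ U \ {x}, φ z ∉ P := fun z hz hzP =>
          (hUO hz.1).2 ⟨hzP, fun e => hz.2 (hUx z hz.1 e)⟩
        have hcon : IsPreconnected (g '' (Subtype.val ⁻¹' (U \ {x}))) := by
          refine IsPreconnected.image ?_ _ hg.continuousOn
          refine (Topology.IsInducing.subtypeVal (t := {x | φ x ∉ P})).isPreconnected_image.mp ?_
          rw [Subtype.image_preimage_coe]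
          convert hU.isConnected.isPreconnected using 1
          exact inter_eq_self_of_subset_right hUP
        obtain ⟨z, hz⟩ := hU.nonempty
        have hsub : g '' (Subtype.val ⁻¹' (U \ {x})) ⊆ ⋃ y ∈ φ ⁻¹' {T (φ x)}, Q y := by
          rintro _ ⟨w, hw, rfl⟩
          refine hWQ ?_
          rw [mem_preimage, hgφ]
          exact (hUO hw.1).1
        obtain ⟨y, hy, hzy⟩ := mem_iUnion₂.mp (hsub ⟨⟨z, hUP z hz⟩, hz, rfl⟩)
        refine ⟨y, hy, U, hUo.mem_nhds hxU, fun w hw => ?_⟩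
        have hwx : (w : F) ≠ x := fun e => w.2 (by rw [e]; exact hx)
        have hgz : (g '' (Subtype.val ⁻¹' (U \ {x})) ∩ Q y).Nonempty :=
          ⟨_, ⟨⟨z, hUP z hz⟩, hz, rfl⟩, hzy⟩
        have hgw : g w ∈ g '' (Subtype.val ⁻¹' (U \ {x})) := ⟨w, ⟨hw, hwx⟩, rfl⟩
        refine hcon.subset_left_of_subset_union (hQo y)
          (v := ⋃ y' ∈ φ ⁻¹' {T (φ x)} \ {y}, Q y') (isOpen_biUnion fun y _ => hQo y) ?_ ?_
          hgz hgw
        · rw [disjoint_iUnion₂_right]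
          intro y' hy'
          exact (hOd hy hy'.1 (Ne.symm hy'.2)).mono (hQO y) (hQO y')
        · intro q hq
          obtain ⟨y', hy', hqy'⟩ := mem_iUnion₂.mp (hsub hq)
          by_cases e : y' = y
          · exact Or.inl (e ▸ hqy')
          · exact Or.inr (mem_biUnion ⟨hy', e⟩ hqy')
      obtain ⟨y, hy, U, hU, hUy⟩ := hloc O (fun y => (hO y).2.mem_nhds (hO y).1)
        (fun _ => Subset.rfl) fun y => (hO y).2
      refine ⟨y, fun Q hQ => ?_⟩
      -- The localization is repeated with the neighborhood of `y` shrunk and the others unchanged.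
      -- The selected point must again be `y`, since the sets `O` are disjoint, so `y` is the limit.
      obtain ⟨Q', hQ'Q, hQ'o, hyQ'⟩ := mem_nhds_iff.mp hQ
      classical
      obtain ⟨y', hy', U', hU', hUy'⟩ := hloc (fun w => if w = y then O y ∩ Q' else O w)
        (fun w => by
          by_cases e : w = y
          · subst e
            simpa using inter_mem ((hO w).2.mem_nhds (hO w).1) (hQ'o.mem_nhds hyQ')
          · simpa [e] using (hO w).2.mem_nhds (hO w).1)
        (fun w => by
          by_cases e : w = y
          · subst e
            simp
          · simp [e])
        (fun w => by
          by_cases e : w = y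
          · simpa [e] using (hO y).2.inter hQ'o
          · simpa [e] using (hO w).2)
      refine mem_map.mpr (mem_comap.mpr ⟨U ∩ U', inter_mem hU hU', fun z hz => ?_⟩)
      have h1 := hUy z hz.1
      have h2 := hUy' z hz.2
      by_cases e : y' = y
      · simp only [e, if_true] at h2
        exact hQ'Q h2.2
      · simp only [e, if_false] at h2
        exact absurd h2 (disjoint_left.mp (hOd hy hy' (Ne.symm e)) h1)
    · refine ⟨g ⟨x, hx⟩, ?_⟩
      have := hg.tendsto ⟨x, hx⟩
      rwa [nhds_subtype] at this
  have hG := hd.continuous_extend hlim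
  have hGg : ∀ x, hd.extend g (x : ↥{x | φ x ∉ P}) = g x := fun x => hd.extend_eq hg x
  refine ⟨hd.extend g, hG, hGg, fun x => ?_⟩
  have hcl : IsClosed {x | φ (hd.extend g x) = T (φ x)} :=
    isClosed_eq (φ.continuous.comp hG) (hT.comp φ.continuous)
  refine hcl.closure_subset_iff.mpr ?_ (hφ.dense_compl hP x)
  intro x hx
  have := hGg ⟨x, hx⟩
  simp only [mem_ofPred_eq]
  rw [this, hgφ]

namespace ArcChart

/-- An endomorphism over a power of the twist that fixes the boundary also fixes everything outside
of the support of the twist. -/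
theorem fixed_of_notMem_range (D : ArcChart P τ h) (hφ : IsBranchedAlong φ P) {k : ℤ} {g : F → F}
    (hg : Continuous g) (hgφ : ∀ x, φ (g x) = (τ ^ k) (φ x)) (hgb : ∀ x, ‖(φ x : ℂ)‖ = 1 → g x = x)
    {x : F} (hx : φ x ∉ range h) (hxP : φ x ∉ P) : g x = x := by
  obtain ⟨y, hy, hj⟩ := D.joinedIn_boundary D.finite hx hxP
  obtain ⟨γ, hγ⟩ := hj
  have hγP : ∀ t, γ t ∈ Pᶜ := fun t ht => hγ t (Or.inr ht)
  obtain ⟨L, hL0, hL⟩ := exists_lift_path hφ.covering (γ := γ.toContinuousMap) hγP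
    (x := x) γ.source.symm
  have hL' : ∀ t, φ (L t) = γ t := hL
  have key := eqOn_of_lifts (f := fun t => g (L t)) (g := L) hφ.covering
    (isPreconnected_univ (α := I)) (by fun_prop) (by fun_prop) (fun t _ => by
      rw [hgφ, hL', D.zpow_fixed k fun ht => hγ t (Or.inl ht)]
      exact hγP t) (fun t _ => by
      rw [hgφ, hL', D.zpow_fixed k fun ht => hγ t (Or.inl ht)]) (mem_univ 1)
      (hgb _ (by rw [hL', γ.target, hy])) (mem_univ 0)
  simpa [hL0] using key

/-- Off the branch points `φ` maps neighborhoods to neighborhoods, so `x` is a limit of points over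
the outside, which are already known to be fixed. -/
theorem fixed_of_mem_closure (D : ArcChart P τ h) (hφ : IsBranchedAlong φ P) {k : ℤ} {g : F → F}
    (hg : Continuous g) (hgφ : ∀ x, φ (g x) = (τ ^ k) (φ x)) (hgb : ∀ x, ‖(φ x : ℂ)‖ = 1 → g x = x)
    {x : F} (hx : φ x ∈ closure (range h)ᶜ) (hxP : φ x ∉ P) : g x = x := by
  have hcl : IsClosed {x | g x = x} := isClosed_eq hg continuous_id
  rw [← mem_ofPred_eq (p := fun x => g x = x), ← hcl.closure_eq, mem_closure_iff_nhds]
  intro O hO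
  have h1 : φ '' O ∩ Pᶜ ∈ 𝓝 (φ x) := by
    refine inter_mem ?_ (D.finite.isClosed.isOpen_compl.mem_nhds hxP)
    rw [← hφ.map_nhds hxP]
    exact image_mem_map hO
  obtain ⟨_, ⟨⟨y, hy, rfl⟩, hyP⟩, hyr⟩ := mem_closure_iff_nhds.mp hx _ h1
  exact ⟨y, hy, D.fixed_of_notMem_range hφ hg hgφ hgb hyr hyP⟩

theorem notMem_of_norm_eq_one (D : ArcChart P τ h) {z : ℂ} (hz : ‖z‖ = 1) : h (pr z) ∉ P := by
  rw [D.mem_iff z hz.le]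
  rintro (rfl | rfl) <;> norm_num at hz

/-- The twist is trivial on the circle, so `g` and the identity are two lifts of the same motion
along it. They agree over the one point of the circle that is a limit of the outside, hence along
the whole lifted circle. -/
theorem fixed_of_norm_eq_one (D : ArcChart P τ h) (hφ : IsBranchedAlong φ P) {k : ℤ} {g : F → F}
    (hg : Continuous g) (hgφ : ∀ x, φ (g x) = (τ ^ k) (φ x)) (hgb : ∀ x, ‖(φ x : ℂ)‖ = 1 → g x = x)
    {x : F} {z : ℂ} (hz : ‖z‖ = 1) (hx : φ x = h (pr z)) : g x = x := by
  obtain ⟨c, hc, hcc⟩ := D.exists_mem_closure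
  have hn : ∀ t : ℝ, ‖Complex.exp (t * Complex.I)‖ = 1 := Complex.norm_exp_ofReal_mul_I
  have harg : ∀ z : ℂ, ‖z‖ = 1 → Complex.exp (z.arg * Complex.I) = z := by
    intro z hz
    have := Complex.norm_mul_exp_arg_mul_I z
    rwa [hz, Complex.ofReal_one, one_mul] at this
  obtain ⟨L, hL, hLx, hLφ⟩ := exists_lift_of_convex (A := (univ : Set ℝ)) hφ.covering convex_univ
    (ψ := fun t : ℝ => h (pr (Complex.exp (t * Complex.I))))
    (D.continuous_chart.comp (by fun_prop : Continuous fun t : ℝ => Complex.exp (t * Complex.I))).continuousOn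
    (fun t _ => D.notMem_of_norm_eq_one (hn t)) (mem_univ z.arg) (x := x) (by
      rw [harg z hz, hx])
  have hgL : ∀ t, φ (g (L t)) = φ (L t) := fun t => by
    rw [hgφ, hLφ t (mem_univ t), D.zpow_chart k (hn t).le, twist_of_norm_eq_one k (hn t)]
  rw [← hLx]
  refine eqOn_of_lifts (f := fun t => g (L t)) (g := L) hφ.covering isPreconnected_univ
    (hg.comp_continuousOn hL) hL (fun t _ => ?_) (fun t _ => hgL t) (mem_univ (c : ℂ).arg) ?_
    (mem_univ z.arg)
  · rw [hgL, hLφ t (mem_univ t)]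
    exact D.notMem_of_norm_eq_one (hn t)
  · have e : φ (L (c : ℂ).arg) = h c := by
      rw [hLφ _ (mem_univ _), harg c hc, pr_coe]
    refine D.fixed_of_mem_closure hφ hg hgφ hgb ?_ ?_
    · rwa [e]
    · rw [e, ← pr_coe c]
      exact D.notMem_of_norm_eq_one hc

theorem twistLifts_comp (D : ArcChart P τ h) (hφ : IsBranchedAlong φ P)
    (S : ArcSections φ (fun z => h (pr z)) sm sp a b) {k : ℤ} {g : F → F}
    (hg : Continuous g) (hgφ : ∀ x, φ (g x) = (τ ^ k) (φ x))
    (hgb : ∀ x, ‖(φ x : ℂ)‖ = 1 → g x = x) :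
    TwistLifts φ (fun z => h (pr z)) sm sp k (fun v z => g (sm v z)) fun v z => g (sp v z) := by
  refine ⟨fun v => hg.comp_continuousOn (S.contLower v), fun v => hg.comp_continuousOn (S.contUpper v),
    fun v z hz => ?_, fun v z hz => ?_, fun v => ?_, fun v => ?_⟩
  · rw [hgφ, S.liftLower v z hz, D.zpow_chart k hz.1]
  · rw [hgφ, S.liftUpper v z hz, D.zpow_chart k hz.1]
  · exact D.fixed_of_norm_eq_one hφ hg hgφ hgb (z := -Complex.I) (by simp)
      (S.liftLower v _ negI_mem_lowerDisk)
  · exact D.fixed_of_norm_eq_one hφ hg hgφ hgb (z := Complex.I) (by simp)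
      (S.liftUpper v _ I_mem_upperDisk)

/-- Composed with the sections, a lift of `τ ^ k` gives twist lifts over both halves; these
automatically agree over `0`, because the sections do. -/
theorem zpow_eq_one_of_lifts (D : ArcChart P τ h) (hφ : IsBranchedAlong φ P)
    (S : ArcSections φ (fun z => h (pr z)) sm sp a b) (ha : Function.Involutive a)
    (hb : Function.Involutive b) {k : ℤ} (hk : Lifts φ (τ ^ k)) :
    (hb.toPerm * ha.toPerm) ^ k = 1 := by
  obtain ⟨g, hgb, hgφ⟩ := hk
  rw [← S.twistLifts_zero_iff hφ D.twoPunctured ha hb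
    (D.twistLifts_comp hφ S g.continuous hgφ hgb)]
  intro v
  rw [S.zero]

/-- Every point over the complement of the punctures lies outside the support of the twist or on one
of the sections. -/
theorem cover (D : ArcChart P τ h) (hφ : IsBranchedAlong φ P)
    (S : ArcSections φ (fun z => h (pr z)) sm sp a b) {x : F} (hx : φ x ∉ P) :
    φ x ∈ closure (range h)ᶜ ∨ (∃ v, ∃ z ∈ lowerDisk, sm v z = x) ∨
      ∃ v, ∃ z ∈ upperDisk, sp v z = x := by
  by_cases hr : φ x ∈ range h
  · right
    obtain ⟨w, hw⟩ := hr
    rw [← pr_coe w] at hw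
    have h1 : (w : ℂ) ≠ 1 / 2 ∧ (w : ℂ) ≠ -(1 / 2) := by
      rw [← hw, D.mem_iff _ (norm_coe_le w), not_or] at hx
      exact hx
    rcases le_total (w : ℂ).im 0 with him | him
    · have hz : (w : ℂ) ∈ lowerDisk := ⟨norm_coe_le w, him, h1⟩
      obtain ⟨v, hv⟩ := S.surj_lower hφ D.twoPunctured hz hw.symm
      exact Or.inl ⟨v, w, hz, hv⟩
    · have hz : (w : ℂ) ∈ upperDisk := ⟨norm_coe_le w, him, h1⟩
      obtain ⟨v, hv⟩ := S.surj_upper hφ D.twoPunctured hz hw.symm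
      exact Or.inr ⟨v, w, hz, hv⟩
  · exact Or.inl (subset_closure hr)

/-- Rigidity, used to see that the lifts of opposite powers are inverse to each other: identity over
`∂N` spreads from `∓i` over both halves, and the branch fibres follow by density. -/
theorem eq_id_of_fixed_boundary (D : ArcChart P τ h) (hφ : IsBranchedAlong φ P)
    (S : ArcSections φ (fun z => h (pr z)) sm sp a b) {g : F → F}
    (hg : Continuous g) (hgφ : ∀ x, φ (g x) = φ x)
    (hgb : ∀ x, ‖(φ x : ℂ)‖ = 1 → g x = x) (x : F) : g x = x := by
  have hgφ' : ∀ x, φ (g x) = (τ ^ (0 : ℤ)) (φ x) := hgφ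
  have hT := D.twistLifts_comp hφ S hg hgφ' hgb
  have hcl : IsClosed {x | g x = x} := isClosed_eq hg continuous_id
  refine hcl.closure_subset_iff.mpr ?_ (hφ.dense_compl D.finite x)
  intro x hx
  rcases D.cover hφ S hx with hx' | ⟨v, z, hz, rfl⟩ | ⟨v, z, hz, rfl⟩
  · exact D.fixed_of_mem_closure hφ hg hgφ' hgb hx' hx
  · exact ArcSections.eqOn_lower hφ D.twoPunctured (hT.contLower v) (S.contLower v)
      (fun z hz => by rw [hgφ, S.liftLower v z hz]) (S.liftLower v) negI_mem_lowerDisk (hT.base v) hz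
  · exact ArcSections.eqOn_upper hφ D.twoPunctured (hT.contUpper v) (S.contUpper v)
      (fun z hz => by rw [hgφ, S.liftUpper v z hz]) (S.liftUpper v) I_mem_upperDisk (hT.base' v) hz

end ArcChart

end LiftCriterion

end ArcTwist

namespace ArcTwist

/-! ### Gluing maps defined on sections; the lifting criterion -/

section LiftCriterion

set_option linter.unusedSectionVars false

variable {F : Type*} [TopologicalSpace F] [CompactSpace F] [T2Space F] {V : Type*} {φ : C(F, Disk)}
  {P : Set Disk} {τ : Disk ≃ₜ Disk} {h : Disk → Disk} {sm sp : V → ℂ → F} {a b : V → V}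

namespace ArcChart

/-- With `u` the coordinate of `φ x`, the image of the section is the locus `s (u x) = x` in a
closed set. It is closed because `F` is Hausdorff, and on it `g` is the continuous function `t ∘ u`.
-/
theorem _root_.ArcTwist.section_piece {κ : Disk → Disk} (hκ : IsEmbedding κ) {Q : Set Disk}
    (hQ : IsClosed Q) {E : Set ℂ} (hE : ∀ z : Disk, (z : ℂ) ∈ E ↔ z ∈ Q ∧ κ z ∉ P)
    (hE1 : ∀ z ∈ E, ‖z‖ ≤ 1) {Y : Type*} [TopologicalSpace Y] {s : ℂ → F} {t : ℂ → Y}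
    (hs : ContinuousOn s E) (ht : ContinuousOn t E) (hsφ : ∀ z ∈ E, φ (s z) = κ (pr z)) :
    IsClosed {x : ↥{x | φ x ∉ P} | ∃ z ∈ E, s z = x} ∧
      ∀ g : ↥{x | φ x ∉ P} → Y, (∀ x : ↥{x | φ x ∉ P}, ∀ z ∈ E, s z = x → g x = t z) →
        ContinuousOn g {x : ↥{x | φ x ∉ P} | ∃ z ∈ E, s z = x} := by
  have hne : Nonempty Disk := ⟨pr 0⟩
  have hinv : ∀ w : Disk, Function.invFun κ (κ w) = w := Function.leftInverse_invFun hκ.injective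
  have hic : ContinuousOn (Function.invFun κ) (range κ) := by
    rw [continuousOn_iff_continuous_domRestrict]
    refine hκ.toHomeomorph.symm.continuous.congr ?_
    rintro ⟨_, z, rfl⟩
    rw [domRestrict_apply, hinv, Homeomorph.symm_apply_eq]
    rfl
  set A : Set ↥{x | φ x ∉ P} := {x | φ x ∈ κ '' Q} with hA
  have hAc : IsClosed A :=
    ((hQ.isCompact.image hκ.continuous).isClosed.preimage φ.continuous).preimage
      continuous_subtype_val
  let u : ↥{x | φ x ∉ P} → ℂ := fun x => (Function.invFun κ (φ x) : Disk)
  have hu : ContinuousOn u A := by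
    refine continuous_subtype_val.comp_continuousOn (hic.comp
      (φ.continuous.comp continuous_subtype_val).continuousOn ?_)
    rintro x ⟨w, -, hw⟩
    exact ⟨w, hw⟩
  have huE : MapsTo u A E := by
    rintro x ⟨w, hw, hwx⟩
    have e : u x = w := by
      simp only [u, ← hwx, hinv]
    rw [e, hE, hwx]
    exact ⟨hw, x.2⟩
  have huz : ∀ x : ↥{x | φ x ∉ P}, ∀ z ∈ E, s z = x → x ∈ A ∧ u x = z := by
    intro x z hz hx
    have e : κ (pr z) = φ x := by rw [← hx, hsφ z hz]
    refine ⟨⟨pr z, ?_, e⟩, ?_⟩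
    · exact ((hE _).mp (by rwa [coe_pr (hE1 z hz)])).1
    · simp only [u, ← e, hinv, coe_pr (hE1 z hz)]
  have hpiece : {x : ↥{x | φ x ∉ P} | ∃ z ∈ E, s z = x} =
      A ∩ (fun x => (s (u x), (x : F))) ⁻¹' diagonal F := by
    ext x
    constructor
    · rintro ⟨z, hz, hx⟩
      obtain ⟨h1, h2⟩ := huz x z hz hx
      refine ⟨h1, ?_⟩
      simp only [mem_preimage, mem_diagonal_iff, h2, hx]
    · rintro ⟨h1, h2⟩
      exact ⟨u x, huE h1, h2⟩
  constructor
  · rw [hpiece]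
    exact ((hs.comp hu huE).prodMk continuous_subtype_val.continuousOn).preimage_isClosed_of_isClosed
      hAc isClosed_diagonal
  · intro g hg
    refine ContinuousOn.congr (f := fun x => t (u x)) ((ht.comp hu huE).mono ?_) ?_
    · rw [hpiece]
      exact inter_subset_left
    · rintro x ⟨z, hz, hx⟩
      simp only [hg x z hz hx, (huz x z hz hx).2]

/-- Continuous functions on finitely many sections, and on the part over a closed set, that agree
on the overlaps fit together to a continuous function over the complement of the punctures. -/
theorem _root_.ArcTwist.exists_glue_sections {ι : Type*} [Finite ι] {κ : ι → Disk → Disk}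
    (hκ : ∀ i, IsEmbedding (κ i)) {Q : ι → Set Disk} (hQ : ∀ i, IsClosed (Q i)) {E : ι → Set ℂ}
    (hE : ∀ i, ∀ z : Disk, (z : ℂ) ∈ E i ↔ z ∈ Q i ∧ κ i z ∉ P) (hE1 : ∀ i, ∀ z ∈ E i, ‖z‖ ≤ 1)
    {Y : Type*} [TopologicalSpace Y] {s : ι → ℂ → F} {t : ι → ℂ → Y}
    (hs : ∀ i, ContinuousOn (s i) (E i)) (ht : ∀ i, ContinuousOn (t i) (E i))
    (hsφ : ∀ i, ∀ z ∈ E i, φ (s i z) = κ i (pr z)) {C : Set Disk} (hC : IsClosed C) {u : F → Y}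
    (hu : Continuous u)
    (hcov : ∀ x, φ x ∉ P → φ x ∈ C ∨ ∃ i, ∃ z ∈ E i, s i z = x)
    (hcC : ∀ i, ∀ z ∈ E i, φ (s i z) ∈ C → t i z = u (s i z))
    (hc : ∀ i, ∀ z ∈ E i, ∀ j, ∀ w ∈ E j, s i z = s j w → t i z = t j w) :
    ∃ g : ↥{x | φ x ∉ P} → Y, Continuous g ∧
      (∀ x : ↥{x | φ x ∉ P}, φ x ∈ C → g x = u x) ∧
      ∀ x : ↥{x | φ x ∉ P}, ∀ i, ∀ z ∈ E i, s i z = x → g x = t i z := by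
  have hex : ∀ x : ↥{x | φ x ∉ P}, ∃ y : Y, (φ x ∈ C → y = u x) ∧
      ∀ i, ∀ z ∈ E i, s i z = x → y = t i z := by
    rintro ⟨x, hx⟩
    rcases hcov x hx with hx' | ⟨j, w, hw, rfl⟩
    · refine ⟨u x, fun _ => rfl, ?_⟩
      rintro i z hz rfl
      exact (hcC i z hz hx').symm
    · exact ⟨t j w, hcC j w hw, fun i z hz e => (hc i z hz j w hw e).symm⟩
  choose g hgC hgt using hex
  refine ⟨g, ?_, hgC, hgt⟩
  have hp := fun i => section_piece (φ := φ) (hκ i) (hQ i) (hE i) (hE1 i) (hs i) (ht i) (hsφ i)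
  refine (locallyFinite_of_finite fun i : Option ι => i.elim {x : ↥{x | φ x ∉ P} | φ x ∈ C}
    fun i => {x | ∃ z ∈ E i, s i z = x}).continuous ?_ ?_ ?_
  · refine eq_univ_of_forall fun x => ?_
    rcases hcov x x.2 with hx' | ⟨i, hi⟩
    · exact mem_iUnion.mpr ⟨none, hx'⟩
    · exact mem_iUnion.mpr ⟨some i, hi⟩
  · rintro (_ | i)
    · exact (hC.preimage φ.continuous).preimage continuous_subtype_val
    · exact (hp i).1
  · rintro (_ | i)
    · exact (hu.comp continuous_subtype_val).continuousOn.congr fun x hx => hgC x hx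
    · exact (hp i).2 g fun x z hz hx => hgt x i z hz hx

/-- Gluing over the two halves of the neighborhood of the arc and its complement. -/
theorem exists_glue [Finite V] (D : ArcChart P τ h) (hφ : IsBranchedAlong φ P)
    (S : ArcSections φ (fun z => h (pr z)) sm sp a b) {Y : Type*} [TopologicalSpace Y]
    {um up : V → ℂ → Y} (hum : ∀ v, ContinuousOn (um v) lowerDisk)
    (hup : ∀ v, ContinuousOn (up v) upperDisk) {u : F → Y} (hu : Continuous u)
    (hm1 : ∀ v, ∀ z ∈ lowerDisk, ‖z‖ = 1 → um v z = u (sm v z))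
    (hp1 : ∀ v, ∀ z ∈ upperDisk, ‖z‖ = 1 → up v z = u (sp v z))
    (hmp : ∀ v w, ∀ z ∈ lowerDisk, z ∈ upperDisk → sm v z = sp w z → um v z = up w z) :
    ∃ g : ↥{x | φ x ∉ P} → Y, Continuous g ∧
      (∀ x : ↥{x | φ x ∉ P}, φ x ∈ closure (range h)ᶜ → g x = u x) ∧
      (∀ x : ↥{x | φ x ∉ P}, ∀ v, ∀ z ∈ lowerDisk, sm v z = x → g x = um v z) ∧
      ∀ x : ↥{x | φ x ∉ P}, ∀ v, ∀ z ∈ upperDisk, sp v z = x → g x = up v z := by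
  have hκ := D.twoPunctured
  have hoff : ∀ z : Disk, h z ∉ P ↔ (z : ℂ) ≠ 1 / 2 ∧ (z : ℂ) ≠ -(1 / 2) := fun z => by
    rw [← not_or, ← D.mem_iff _ (norm_coe_le z), pr_coe]
  have hout : ∀ z : ℂ, ‖z‖ ≤ 1 → h (pr z) ∈ closure (range h)ᶜ → ‖z‖ = 1 := by
    intro z hz hc
    rw [← D.norm_eq_one_of_mem_closure hc, coe_pr hz]
  have key := exists_glue_sections (φ := φ) (P := P) (ι := V ⊕ V) (Y := Y)
    (κ := fun _ => h) (fun _ => D.emb)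
    (Q := Sum.elim (fun _ => {w : Disk | (w : ℂ).im ≤ 0}) fun _ => {w : Disk | 0 ≤ (w : ℂ).im})
    (E := Sum.elim (fun _ => lowerDisk) fun _ => upperDisk) (s := Sum.elim sm sp)
    (t := Sum.elim um up) (C := closure (range h)ᶜ) (u := u) ?_ ?_ ?_ ?_ ?_ ?_ isClosed_closure hu
    ?_ ?_ ?_
  · obtain ⟨g, hg, hgC, hgt⟩ := key
    exact ⟨g, hg, hgC, fun x v z hz e => hgt x (Sum.inl v) z hz e,
      fun x v z hz e => hgt x (Sum.inr v) z hz e⟩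
  · rintro (v | v)
    · exact isClosed_le (by fun_prop) continuous_const
    · exact isClosed_le continuous_const (by fun_prop)
  · rintro (v | v) z
    · rw [hoff]
      exact ⟨fun hz => hz.2, fun hz => ⟨norm_coe_le z, hz⟩⟩
    · rw [hoff]
      exact ⟨fun hz => hz.2, fun hz => ⟨norm_coe_le z, hz⟩⟩
  · rintro (v | v) z hz
    exacts [hz.1, hz.1]
  · rintro (v | v)
    exacts [S.contLower v, S.contUpper v]
  · rintro (v | v)
    exacts [hum v, hup v]
  · rintro (v | v)
    exacts [S.liftLower v, S.liftUpper v]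
  · intro x hx
    rcases D.cover hφ S hx with hx' | ⟨v, hv⟩ | ⟨v, hv⟩
    · exact Or.inl hx'
    · exact Or.inr ⟨Sum.inl v, hv⟩
    · exact Or.inr ⟨Sum.inr v, hv⟩
  · rintro (v | v) z hz hc
    · exact hm1 v z hz (hout z hz.1 (by rw [← S.liftLower v z hz]; exact hc))
    · exact hp1 v z hz (hout z hz.1 (by rw [← S.liftUpper v z hz]; exact hc))
  · rintro (v | v) z hz (w | w) z' hz' e
    · obtain rfl : z = z' := D.chart_injOn hz.1 hz'.1
        ((S.liftLower v z hz).symm.trans ((congrArg φ e).trans (S.liftLower w z' hz')))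
      obtain rfl := S.inj_lower hφ hκ hz e
      rfl
    · obtain rfl : z = z' := D.chart_injOn hz.1 hz'.1
        ((S.liftLower v z hz).symm.trans ((congrArg φ e).trans (S.liftUpper w z' hz')))
      exact hmp v w z hz hz' e
    · obtain rfl : z = z' := D.chart_injOn hz.1 hz'.1
        ((S.liftUpper v z hz).symm.trans ((congrArg φ e).trans (S.liftLower w z' hz')))
      exact (hmp w v z hz' hz e.symm).symm
    · obtain rfl : z = z' := D.chart_injOn hz.1 hz'.1
        ((S.liftUpper v z hz).symm.trans ((congrArg φ e).trans (S.liftUpper w z' hz')))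
      obtain rfl := S.inj_upper hφ hκ hz e
      rfl

/-- The lifts over the two halves of the disk fit together with the identity. -/
theorem exists_glued [Finite V] (D : ArcChart P τ h) (hφ : IsBranchedAlong φ P)
    (S : ArcSections φ (fun z => h (pr z)) sm sp a b) {k : ℤ} {gm gp : V → ℂ → F}
    (hg : TwistLifts φ (fun z => h (pr z)) sm sp k gm gp) (h0 : ∀ v, gm v 0 = gp v 0) :
    ∃ G : F → F, Continuous G ∧ (∀ x, φ (G x) = (τ ^ k) (φ x)) ∧
      ∀ x, ‖(φ x : ℂ)‖ = 1 → G x = x := by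
  have hκ := D.twoPunctured
  obtain ⟨g, hgc, hgout, hgm, hgp⟩ := D.exists_glue hφ S hg.contLower hg.contUpper continuous_id
    (fun v z hz h1 => S.lower_of_norm_eq_one hφ hκ hg v hz h1)
    (fun v z hz h1 => S.upper_of_norm_eq_one hφ hκ hg v hz h1)
    fun v w z hz hz' e => S.compat hφ hκ hg h0 hz hz' e
  have hgφ : ∀ x : ↥{x | φ x ∉ P}, φ (g x) = (τ ^ k) (φ x) := by
    intro x
    rcases D.cover hφ S x.2 with hx' | ⟨v, z, hz, e⟩ | ⟨v, z, hz, e⟩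
    · rw [hgout x hx']
      have hcl : IsClosed {y | y = (τ ^ k) y} := isClosed_eq continuous_id (τ ^ k).continuous
      exact hcl.closure_subset_iff.mpr (fun y hy => (D.zpow_fixed k hy).symm) hx'
    · rw [hgm x v z hz e, hg.liftLower v z hz, ← e, S.liftLower v z hz, D.zpow_chart k hz.1]
    · rw [hgp x v z hz e, hg.liftUpper v z hz, ← e, S.liftUpper v z hz, D.zpow_chart k hz.1]
  -- Extending over the branch fibres requires that the punctures be preserved: those in the chart
  -- are at radius `1/2`, where each power of the twist is the identity or `z ↦ -z`.
  have hTP : MapsTo (τ ^ k) P P := by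
    intro p hp
    by_cases hr : p ∈ range h
    · obtain ⟨w, rfl⟩ := hr
      rw [← pr_coe w] at hp ⊢
      have hw := norm_coe_le w
      rw [D.zpow_chart k hw, D.mem_iff _ (by rwa [norm_twist])]
      have hw' := (D.mem_iff _ hw).mp hp
      have hn : ‖(w : ℂ)‖ ≤ 1 / 2 := by rcases hw' with h | h <;> simp [h]
      rcases twist_of_norm_le k hn with e | e <;> rw [e]
      · exact hw'
      · rcases hw' with h | h <;> simp [h]
    · rwa [D.zpow_fixed k hr]
  obtain ⟨G, hG, hGg, hGφ⟩ := hφ.exists_extension D.finite (τ ^ k).continuous hTP hgc hgφ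
  refine ⟨G, hG, hGφ, fun x hx => ?_⟩
  have hxP : φ x ∉ P := fun hP => (D.interior _ hP).ne hx
  rw [hGg ⟨x, hxP⟩]
  refine hgout ⟨x, hxP⟩ (subset_closure ?_)
  rintro ⟨w, hw⟩
  have := D.norm_lt w
  rw [hw] at this
  exact this.ne hx

theorem lifts_iff [Finite V] (D : ArcChart P τ h) (hφ : IsBranchedAlong φ P)
    (S : ArcSections φ (fun z => h (pr z)) sm sp a b) (ha : Function.Involutive a)
    (hb : Function.Involutive b) (k : ℤ) :
    Lifts φ (τ ^ k) ↔ (hb.toPerm * ha.toPerm) ^ k = 1 := by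
  refine ⟨D.zpow_eq_one_of_lifts hφ S ha hb, fun hk => ?_⟩
  have hG : ∀ l : ℤ, (hb.toPerm * ha.toPerm) ^ l = 1 →
      ∃ G : F → F, Continuous G ∧ (∀ x, φ (G x) = (τ ^ l) (φ x)) ∧
        ∀ x, ‖(φ x : ℂ)‖ = 1 → G x = x := by
    intro l hl
    obtain ⟨gm, gp, hg⟩ := S.exists_twistLifts hφ D.twoPunctured l
    exact D.exists_glued hφ S hg ((S.twistLifts_zero_iff hφ D.twoPunctured ha hb hg).mpr hl)
  obtain ⟨G, hG1, hG2, hG3⟩ := hG k hk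
  -- The inverse homeomorphism is the lift for `-k`: both composites cover the identity and fix the
  -- boundary.
  obtain ⟨G', hG1', hG2', hG3'⟩ := hG (-k) (by rw [zpow_neg, hk, inv_one])
  have hinv : ∀ y, (τ ^ (-k)) ((τ ^ k) y) = y := fun y => by
    rw [zpow_neg]
    exact (τ ^ k).symm_apply_apply y
  have hinv' : ∀ y, (τ ^ k) ((τ ^ (-k)) y) = y := fun y => by
    rw [zpow_neg]
    exact (τ ^ k).apply_symm_apply y
  have hl : ∀ x, G' (G x) = x := D.eq_id_of_fixed_boundary hφ S (hG1'.comp hG1)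
    (fun x => by simp only [hG2', hG2, hinv])
    fun x hx => by simp only [hG3 x hx, hG3' x hx]
  have hr : ∀ x, G (G' x) = x := D.eq_id_of_fixed_boundary hφ S (hG1.comp hG1')
    (fun x => by simp only [hG2', hG2, hinv'])
    fun x hx => by simp only [hG3 x hx, hG3' x hx]
  exact ⟨⟨⟨G, G', hl, hr⟩, hG1, hG1'⟩, hG3, hG2⟩

end ArcChart

end LiftCriterion

end ArcTwist

namespace ArcTwist

/-! ### The sectors between the standard punctures -/

/-- The primitive `n`-th root of unity `e^{2πi/n}`. -/
noncomputable def root (n : ℕ) : ℂ := Complex.exp ((2 * Real.pi / n : ℝ) * Complex.I)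

theorem root_pow (n j : ℕ) : root n ^ j = Complex.exp ((2 * Real.pi * j / n : ℝ) * Complex.I) := by
  rw [root, ← Complex.exp_nat_mul]
  congr 1
  push_cast
  ring

theorem norm_root (n : ℕ) : ‖root n‖ = 1 := Complex.norm_exp_ofReal_mul_I _

theorem root_ne_zero (n : ℕ) : root n ≠ 0 := Complex.exp_ne_zero _

theorem root_pow_self (n : ℕ) [NeZero n] : root n ^ n = 1 := by
  rw [root_pow, mul_div_assoc, div_self (Nat.cast_ne_zero.mpr (NeZero.ne n)), mul_one]
  push_cast
  exact Complex.exp_two_pi_mul_I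

theorem root_pow_succ (n : ℕ) [NeZero n] (j : Fin n) :
    root n ^ ((j + 1 : Fin n) : ℕ) = root n ^ (j : ℕ) * root n := by
  rw [← pow_succ, Fin.val_add, Fin.val_one', Nat.add_mod_mod]
  exact (pow_eq_pow_mod _ (root_pow_self n)).symm

theorem coe_stdPoint (n : ℕ) (j : Fin n) : (stdPoint n j : ℂ) = root n ^ (j : ℕ) * (1 / 2) := by
  rw [root_pow, stdPoint]
  push_cast
  ring

/-- The closed sector of angle `2π/n`. -/
def wedge (n : ℕ) : Set ℂ := {z | 0 ≤ z.im ∧ (z / root n).im ≤ 0}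

/-- The closed sector of the unit disk of angle `2π/n`, without the punctures on its sides. -/
def sector (n : ℕ) : Set ℂ := {z | ‖z‖ ≤ 1 ∧ z ∈ wedge n ∧ z ≠ 1 / 2 ∧ z ≠ root n * (1 / 2)}

theorem isClosed_wedge (n : ℕ) : IsClosed (wedge n) :=
  (isClosed_le continuous_const Complex.continuous_im).inter
    (isClosed_le (Complex.continuous_im.comp (continuous_id.div_const _)) continuous_const)

theorem polar_im (r x : ℝ) : ((r : ℂ) * Complex.exp (x * Complex.I)).im = r * Real.sin x := by
  rw [Complex.im_ofReal_mul, Complex.exp_ofReal_mul_I_im]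

theorem polar_div_root (n : ℕ) (r x : ℝ) : (r : ℂ) * Complex.exp (x * Complex.I) / root n =
    r * Complex.exp ((x - 2 * Real.pi / n : ℝ) * Complex.I) := by
  rw [root, mul_div_assoc, ← Complex.exp_sub]
  congr 2
  push_cast
  ring

theorem angle_pos {n : ℕ} (hn : 2 ≤ n) : 0 < 2 * Real.pi / n ∧ 2 * Real.pi / n ≤ Real.pi := by
  have hn' : (2 : ℝ) ≤ n := by exact_mod_cast hn
  have := Real.pi_pos
  refine ⟨by positivity, ?_⟩
  rw [div_le_iff₀ (by linarith)]
  nlinarith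

theorem polar_mem_wedge {n : ℕ} (hn : 2 ≤ n) {r x : ℝ} (hr : 0 ≤ r) (hx : 0 ≤ x)
    (hx' : x ≤ 2 * Real.pi / n) : (r : ℂ) * Complex.exp (x * Complex.I) ∈ wedge n := by
  obtain ⟨h1, h2⟩ := angle_pos hn
  constructor
  · rw [polar_im]
    exact mul_nonneg hr (Real.sin_nonneg_of_nonneg_of_le_pi hx (by linarith))
  · rw [polar_div_root, polar_im]
    exact mul_nonpos_of_nonneg_of_nonpos hr
      (Real.sin_nonpos_of_nonpos_of_neg_pi_le (by linarith) (by linarith))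

theorem exists_polar_of_mem_wedge {n : ℕ} (hn : 2 ≤ n) {z : ℂ} (hz : z ∈ wedge n) :
    ∃ x : ℝ, 0 ≤ x ∧ x ≤ 2 * Real.pi / n ∧ z = (‖z‖ : ℂ) * Complex.exp (x * Complex.I) := by
  obtain ⟨h1, h2⟩ := angle_pos hn
  by_cases h0 : z = 0
  · exact ⟨0, le_rfl, h1.le, by simp [h0]⟩
  have he := Complex.norm_mul_exp_arg_mul_I z
  have hpos : 0 < ‖z‖ := norm_pos_iff.mpr h0
  have ha : 0 ≤ z.arg := Complex.arg_nonneg_iff.mpr hz.1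
  refine ⟨z.arg, ha, ?_, he.symm⟩
  by_contra! hlt
  have h3 := hz.2
  rw [← he, polar_div_root, polar_im] at h3
  have h4 : 0 < Real.sin (z.arg - 2 * Real.pi / n) :=
    Real.sin_pos_of_pos_of_lt_pi (by linarith) (by linarith [Complex.arg_le_pi z])
  nlinarith

/-- The center is the boundary point on the bisector. A segment towards it enters the interior of
the wedge immediately, while the punctures lie on the sides. -/
theorem starConvex_sector {n : ℕ} (hn : 2 ≤ n) :
    StarConvex ℝ (Complex.exp ((Real.pi / n : ℝ) * Complex.I)) (sector n) := by
  obtain ⟨h1, h2⟩ := angle_pos hn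
  have e : 2 * Real.pi / n = Real.pi / n + Real.pi / n := by ring
  rw [e] at h1 h2
  set c := Complex.exp ((Real.pi / n : ℝ) * Complex.I) with hc
  have hcn : ‖c‖ = 1 := Complex.norm_exp_ofReal_mul_I _
  have hc1 : 0 < c.im := by
    rw [hc, Complex.exp_ofReal_mul_I_im]
    exact Real.sin_pos_of_pos_of_lt_pi (by linarith) (by linarith [Real.pi_pos])
  have hc2 : (c / root n).im < 0 := by
    have := polar_div_root n 1 (Real.pi / n)
    rw [Complex.ofReal_one, one_mul, one_mul] at this
    rw [this, Complex.exp_ofReal_mul_I_im]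
    exact Real.sin_neg_of_neg_of_neg_pi_lt (by linarith) (by linarith [Real.pi_pos])
  intro z hz s t hs ht hst
  rcases hs.eq_or_lt with rfl | hs'
  · rw [zero_add] at hst
    simpa [hst] using hz
  have him : 0 < (s • c + t • z).im := by
    simp only [Complex.add_im, Complex.smul_im, smul_eq_mul]
    have := mul_nonneg ht hz.2.1.1
    have := mul_pos hs' hc1
    linarith
  have him' : ((s • c + t • z) / root n).im < 0 := by
    rw [add_div, smul_div_assoc, smul_div_assoc]
    simp only [Complex.add_im, Complex.smul_im, smul_eq_mul]
    have := mul_nonpos_of_nonneg_of_nonpos ht hz.2.1.2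
    have := mul_neg_of_pos_of_neg hs' hc2
    linarith
  refine ⟨?_, ⟨him.le, him'.le⟩, fun h => ?_, fun h => ?_⟩
  · have := (convex_closedBall (0 : ℂ) 1) (x := c) (by simp [hcn]) (y := z) (by simpa using hz.1) hs ht hst
    simpa using this
  · rw [h] at him
    norm_num at him
  · rw [h, mul_div_assoc, mul_comm, div_mul_cancel₀ _ (root_ne_zero n)] at him'
    norm_num at him'

theorem exp_mem_sector {n : ℕ} (hn : 2 ≤ n) :
    Complex.exp ((Real.pi / n : ℝ) * Complex.I) ∈ sector n := by
  have hm := polar_mem_wedge hn zero_le_one (x := Real.pi / n)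
    (div_nonneg Real.pi_pos.le (Nat.cast_nonneg n))
    (div_le_div_of_nonneg_right (by linarith [Real.pi_pos]) (Nat.cast_nonneg n))
  rw [Complex.ofReal_one, one_mul] at hm
  have hn := Complex.norm_exp_ofReal_mul_I (Real.pi / n)
  refine ⟨hn.le, hm, fun h => ?_, fun h => ?_⟩ <;> rw [h] at hn
  · norm_num at hn
  · rw [norm_mul, norm_root] at hn
    norm_num at hn

theorem isPreconnected_sector {n : ℕ} (hn : 2 ≤ n) : IsPreconnected (sector n) :=
  ((starConvex_sector hn).isPathConnected (exp_mem_sector hn)).isConnected.isPreconnected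

/-- A nonzero multiple of the sides of the sector is in the sector. -/
theorem ofReal_mem_sector {n : ℕ} (hn : 2 ≤ n) {t : ℝ} (h0 : 0 ≤ t) (h1 : t ≤ 1) (h : t ≠ 1 / 2) :
    (t : ℂ) ∈ sector n := by
  have := polar_mem_wedge hn h0 le_rfl (angle_pos hn).1.le
  rw [Complex.ofReal_zero, zero_mul, Complex.exp_zero, mul_one] at this
  refine ⟨by simpa [abs_of_nonneg h0] using h1, this, fun e => h ?_, fun e => h ?_⟩
  · exact_mod_cast (by push_cast; exact e : ((t : ℝ) : ℂ) = ((1 / 2 : ℝ) : ℂ))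
  · have := congrArg norm e
    rw [norm_mul, norm_root] at this
    simpa [abs_of_nonneg h0] using this

theorem root_mul_mem_sector {n : ℕ} (hn : 2 ≤ n) {t : ℝ} (h0 : 0 ≤ t) (h1 : t ≤ 1) (h : t ≠ 1 / 2) :
    root n * t ∈ sector n := by
  have := polar_mem_wedge hn h0 (angle_pos hn).1.le le_rfl
  rw [mul_comm] at this
  have hh : t = 1 / 2 → False := h
  refine ⟨by simpa [norm_root, abs_of_nonneg h0] using h1, this, fun e => h ?_, fun e => h ?_⟩
  · have := congrArg norm e
    rw [norm_mul, norm_root] at this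
    simpa [abs_of_nonneg h0] using this
  · have := mul_left_cancel₀ (root_ne_zero n) e
    exact_mod_cast (by push_cast; exact this : ((t : ℝ) : ℂ) = ((1 / 2 : ℝ) : ℂ))

theorem zero_mem_sector {n : ℕ} (hn : 2 ≤ n) : (0 : ℂ) ∈ sector n := by
  simpa using ofReal_mem_sector hn (t := 0) le_rfl zero_le_one (by norm_num)

theorem val_eq_mod {n : ℕ} {a : ℕ} {j : Fin n} {l : ℤ} (h : (a : ℤ) = j + n * l) :
    a % n = j := by
  have h1 : (a : ℤ) % n = j := by
    rw [h, Int.add_mul_emod_self_left]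
    exact Int.emod_eq_of_lt (by positivity) (by exact_mod_cast j.2)
  exact_mod_cast h1

/-- The position of two points of the sector whose rotations agree. -/
theorem wedge_overlap {n : ℕ} [NeZero n] (hn : 2 ≤ n) {i j : Fin n} {z w : ℂ} (hz : z ∈ wedge n)
    (hw : w ∈ wedge n) (h : root n ^ (i : ℕ) * z = root n ^ (j : ℕ) * w) :
    (z = 0 ∧ w = 0) ∨ (i = j ∧ z = w) ∨ (j = i + 1 ∧ ∃ t : ℝ, 0 ≤ t ∧ w = t ∧ z = root n * t) ∨
      (i = j + 1 ∧ ∃ t : ℝ, 0 ≤ t ∧ z = t ∧ w = root n * t) := by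
  obtain ⟨x, hx0, hx1, hx⟩ := exists_polar_of_mem_wedge hn hz
  obtain ⟨y, hy0, hy1, hy⟩ := exists_polar_of_mem_wedge hn hw
  have hnorm : ‖z‖ = ‖w‖ := by
    have := congrArg norm h
    simpa [norm_root] using this
  by_cases h0 : z = 0
  · left
    rw [h0, norm_zero] at hnorm
    exact ⟨h0, norm_eq_zero.mp hnorm.symm⟩
  right
  have hr : (‖z‖ : ℂ) ≠ 0 := by simpa using h0
  have hn0 : (n : ℝ) ≠ 0 := Nat.cast_ne_zero.mpr (NeZero.ne n)
  have hpi := Real.pi_pos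
  have hexp : Complex.exp ((2 * Real.pi * i / n + x : ℝ) * Complex.I) =
      Complex.exp ((2 * Real.pi * j / n + y : ℝ) * Complex.I) := by
    apply mul_left_cancel₀ hr
    have e : ∀ (m : Fin n) (u : ℝ),
        (‖z‖ : ℂ) * Complex.exp ((2 * Real.pi * m / n + u : ℝ) * Complex.I) =
          root n ^ (m : ℕ) * (‖z‖ * Complex.exp (u * Complex.I)) := by
      intro m u
      rw [root_pow, Complex.ofReal_add, add_mul, Complex.exp_add]
      ring
    rw [e, e, ← hx, h, hy, hnorm]
  obtain ⟨l, hl⟩ := Complex.exp_eq_exp_iff_exists_int.mp hexp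
  have hl' : 2 * Real.pi * i / n + x = 2 * Real.pi * j / n + y + l * (2 * Real.pi) := by
    have e1 : ((2 * Real.pi * i / n + x : ℝ) : ℂ) * Complex.I =
        ((2 * Real.pi * j / n + y + l * (2 * Real.pi) : ℝ) : ℂ) * Complex.I := by
      rw [hl]
      push_cast
      ring
    exact_mod_cast mul_right_cancel₀ Complex.I_ne_zero e1
  -- The angles `x` and `y` lie in `[0, 2π/n]` and differ by `N` times `2π/n`, so `N` is `0` or
  -- `±1`: the sectors are equal or adjacent, and in the adjacent case both angles are extreme.
  set N : ℤ := j - i + n * l with hN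
  have hxy : x - y = 2 * Real.pi / n * N := by
    rw [hN]
    push_cast
    field_simp
    field_simp at hl'
    linarith
  have ha := (angle_pos hn).1
  have hN1 : N ≤ 1 := by
    by_contra! hlt
    have : (2 : ℝ) ≤ N := by exact_mod_cast hlt
    nlinarith
  have hN2 : -1 ≤ N := by
    by_contra! hlt
    have : (N : ℝ) ≤ -2 := by exact_mod_cast (by omega : N ≤ -2)
    nlinarith
  have h3 : N = 0 ∨ N = 1 ∨ N = -1 := by omega
  rcases h3 with e | e | e
  · left
    rw [e, Int.cast_zero, mul_zero] at hxy
    refine ⟨?_, by rw [hx, hy, hnorm, sub_eq_zero.mp hxy]⟩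
    have := val_eq_mod (a := i) (j := j) (l := l) (by omega)
    rw [Nat.mod_eq_of_lt i.2] at this
    exact Fin.ext this
  · right; left
    rw [e, Int.cast_one, mul_one] at hxy
    have hy' : y = 0 := by linarith
    have hx' : x = 2 * Real.pi / n := by linarith
    refine ⟨?_, ‖z‖, norm_nonneg _, ?_, ?_⟩
    · have := val_eq_mod (a := i + 1) (j := j) (l := l) (by push_cast; omega)
      refine Fin.ext ?_
      rw [← this, Fin.val_add, Fin.val_one', Nat.add_mod_mod]
    · rw [hy, hy', hnorm]
      simp
    · nth_rewrite 1 [hx]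
      rw [hx', mul_comm]
      rfl
  · right; right
    rw [e] at hxy
    push_cast at hxy
    have hy' : x = 0 := by linarith
    have hx' : y = 2 * Real.pi / n := by linarith
    refine ⟨?_, ‖z‖, norm_nonneg _, ?_, ?_⟩
    · have := val_eq_mod (a := j + 1) (j := i) (l := -l) (by push_cast; rw [mul_neg]; omega)
      refine Fin.ext ?_
      rw [← this, Fin.val_add, Fin.val_one', Nat.add_mod_mod]
    · nth_rewrite 1 [hx]
      rw [hy']
      simp
    · nth_rewrite 1 [hy]
      rw [hx', mul_comm, hnorm]
      rfl

theorem exists_wedge {n : ℕ} [NeZero n] (hn : 2 ≤ n) (w : ℂ) :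
    ∃ j : Fin n, ∃ z ∈ wedge n, w = root n ^ (j : ℕ) * z := by
  have ha := (angle_pos hn).1
  have hn0 : (n : ℂ) ≠ 0 := Nat.cast_ne_zero.mpr (NeZero.ne n)
  have hnz : (n : ℤ) ≠ 0 := Nat.cast_ne_zero.mpr (NeZero.ne n)
  set k : ℤ := ⌊w.arg / (2 * Real.pi / n)⌋ with hk
  have h1 : 2 * Real.pi / n * k ≤ w.arg := by
    have := Int.floor_le (w.arg / (2 * Real.pi / n))
    rw [le_div_iff₀ ha, ← hk, mul_comm] at this
    exact this
  have h2 : w.arg ≤ 2 * Real.pi / n * k + 2 * Real.pi / n := by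
    have := (Int.lt_floor_add_one (w.arg / (2 * Real.pi / n))).le
    rw [div_le_iff₀ ha, ← hk, add_mul, one_mul, mul_comm] at this
    exact this
  have hm := Int.emod_nonneg k hnz
  have hm' := Int.emod_lt_of_pos k (by omega : 0 < (n : ℤ))
  have hkm := Int.emod_add_mul_ediv k n
  refine ⟨⟨(k % n).toNat, by omega⟩, ‖w‖ * Complex.exp ((w.arg - 2 * Real.pi / n * k : ℝ) * Complex.I),
    polar_mem_wedge hn (norm_nonneg w) (by linarith) (by linarith), ?_⟩
  nth_rewrite 1 [← Complex.norm_mul_exp_arg_mul_I w]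
  rw [root_pow, mul_left_comm, ← Complex.exp_add]
  congr 1
  rw [Complex.exp_eq_exp_iff_exists_int]
  refine ⟨k / n, ?_⟩
  have e1 : (((k % n).toNat : ℕ) : ℂ) = k - n * (k / n : ℤ) := by
    have : (((k % n).toNat : ℕ) : ℤ) = k - n * (k / n) := by omega
    exact_mod_cast this
  push_cast
  rw [e1]
  field_simp
  ring

end ArcTwist

namespace ArcTwist

/-! ### Sections over the sectors and the standard generators -/

section Sectors

set_option linter.unusedSectionVars false

/-- The coordinates on the disk in which the `j`-th sector becomes the standard one. -/
noncomputable def rotChart (n : ℕ) (H : Disk ≃ₜ Disk) (j : Fin n) (z : ℂ) : Disk :=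
  H (pr (root n ^ (j : ℕ) * z))

variable {n : ℕ} {H : Disk ≃ₜ Disk}

theorem norm_rot (j : Fin n) (z : ℂ) : ‖root n ^ (j : ℕ) * z‖ = ‖z‖ := by
  simp [norm_root]

theorem continuous_rotChart (j : Fin n) : Continuous (rotChart n H j) :=
  H.continuous.comp (continuous_pr.comp (continuous_const.mul continuous_id))

theorem rotChart_eq_iff {i j : Fin n} {z w : ℂ} (hz : ‖z‖ ≤ 1) (hw : ‖w‖ ≤ 1) :
    rotChart n H i z = rotChart n H j w ↔ root n ^ (i : ℕ) * z = root n ^ (j : ℕ) * w := by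
  constructor
  · intro h
    rw [← coe_pr (z := root n ^ (i : ℕ) * z) (by rwa [norm_rot]), H.injective h,
      coe_pr (by rwa [norm_rot])]
  · intro h
    rw [rotChart, h]
    rfl

theorem rotChart_injOn {j : Fin n} {z w : ℂ} (hz : ‖z‖ ≤ 1) (hw : ‖w‖ ≤ 1)
    (h : rotChart n H j z = rotChart n H j w) : z = w :=
  mul_left_cancel₀ (pow_ne_zero _ (root_ne_zero n)) ((rotChart_eq_iff hz hw).mp h)

theorem isEmbedding_rotChart (j : Fin n) : IsEmbedding fun z : Disk => rotChart n H j z :=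
  (((continuous_rotChart j).comp continuous_subtype_val).isClosedEmbedding fun z w h =>
    Subtype.ext (rotChart_injOn (norm_coe_le z) (norm_coe_le w) h)).isEmbedding

theorem rotChart_half (j : Fin n) : rotChart n H j (1 / 2) = H (stdPoint n j) := by
  rw [rotChart]
  congr 1
  apply Subtype.ext
  rw [coe_pr (by rw [norm_rot]; norm_num), coe_stdPoint]

theorem rotChart_root_mul [NeZero n] (j : Fin n) (z : ℂ) :
    rotChart n H j (root n * z) = rotChart n H (j + 1) z := by
  rw [rotChart, rotChart, root_pow_succ, mul_assoc]

theorem mem_sector_iff [NeZero n] (hn : 2 ≤ n) (j : Fin n) {z : ℂ} (hz : ‖z‖ ≤ 1) :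
    z ∈ sector n ↔ z ∈ wedge n ∧ rotChart n H j z ∉ punctures n H := by
  have hh : ‖(1 / 2 : ℂ)‖ ≤ 1 := by norm_num
  constructor
  · rintro ⟨-, hw, h1, h2⟩
    refine ⟨hw, ?_⟩
    rintro ⟨m, hm⟩
    simp only [← rotChart_half] at hm
    rw [rotChart_eq_iff hh hz] at hm
    have hhalf : (1 / 2 : ℂ) ∈ wedge n := by
      have := polar_mem_wedge hn (r := 1 / 2) (by norm_num) le_rfl (angle_pos hn).1.le
      simpa using this
    rcases wedge_overlap hn hw hhalf hm.symm with h | h | ⟨-, t, -, ht, hz'⟩ | ⟨-, t, ht0, ht, hz'⟩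
    · norm_num at h
    · exact h1 h.2
    · exact h2 (by rw [hz', ht])
    · refine h1 ?_
      have := congrArg norm hz'
      rw [norm_mul, norm_root, one_mul, Complex.norm_real, Real.norm_of_nonneg ht0] at this
      rw [ht, ← this]
      norm_num
  · rintro ⟨hw, hP⟩
    refine ⟨hz, hw, fun h => hP ⟨j, ?_⟩, fun h => hP ⟨j + 1, ?_⟩⟩
    · simp only [← rotChart_half, h]
    · simp only [← rotChart_half, h, rotChart_root_mul]

theorem polar_mem_sector (hn : 2 ≤ n) {r x : ℝ} (hr : 0 ≤ r) (hr1 : r ≤ 1) (hx : 0 ≤ x)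
    (hx' : x ≤ 2 * Real.pi / n) (h0 : x = 0 → r ≠ 1 / 2) (h1 : x = 2 * Real.pi / n → r ≠ 1 / 2) :
    (r : ℂ) * Complex.exp (x * Complex.I) ∈ sector n := by
  have ha := angle_pos hn
  have hpi := Real.pi_pos
  have hnorm : ∀ y : ℝ, ‖(r : ℂ) * Complex.exp (y * Complex.I)‖ = r := fun y => by
    rw [norm_mul, Complex.norm_exp_ofReal_mul_I, mul_one, Complex.norm_real,
      Real.norm_of_nonneg hr]
  have key : ∀ y : ℝ, -(2 * Real.pi) < y → y < 2 * Real.pi →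
      (r : ℂ) * Complex.exp (y * Complex.I) = 1 / 2 → y = 0 ∧ r = 1 / 2 := by
    intro y hy hy' h
    have h2 : r = 1 / 2 := by
      rw [← hnorm y, h]
      norm_num
    refine ⟨?_, h2⟩
    have h3 := congrArg Complex.re h
    rw [Complex.re_ofReal_mul, Complex.exp_ofReal_mul_I_re, h2] at h3
    norm_num at h3
    exact (Real.cos_eq_one_iff_of_lt_of_lt hy hy').mp h3
  refine ⟨(hnorm x).le.trans hr1, polar_mem_wedge hn hr hx hx', fun h => ?_, fun h => ?_⟩
  · obtain ⟨e1, e2⟩ := key x (by linarith) (by linarith) h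
    exact h0 e1 e2
  · have h2 := polar_div_root n r x
    rw [h, mul_div_cancel_left₀ _ (root_ne_zero n)] at h2
    obtain ⟨e1, e2⟩ := key _ (by linarith) (by linarith) h2.symm
    exact h1 (by linarith) e2

/-- The standard generator, in the coordinates of the sector that begins at its puncture. -/
noncomputable def loopChart (n : ℕ) (t : ℝ) : ℂ :=
  (3 / 4 * Real.sin (Real.pi * t) : ℝ) *
    Complex.exp ((Real.pi / n * (t - 1 / 2) : ℝ) * Complex.I)

theorem continuous_loopChart (n : ℕ) : Continuous (loopChart n) := by
  unfold loopChart
  fun_prop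

theorem loopChart_half (n : ℕ) : loopChart n (1 / 2) = (3 / 4 : ℝ) := by
  rw [loopChart, sub_self, mul_zero, Complex.ofReal_zero, zero_mul, Complex.exp_zero, mul_one,
    mul_one_div, Real.sin_pi_div_two, mul_one]

theorem loopChart_radius {t : ℝ} (h0 : 0 ≤ t) (h1 : t ≤ 1) :
    0 ≤ 3 / 4 * Real.sin (Real.pi * t) ∧ 3 / 4 * Real.sin (Real.pi * t) ≤ 1 := by
  have := Real.sin_nonneg_of_nonneg_of_le_pi (x := Real.pi * t) (by positivity)
    (by nlinarith [Real.pi_pos])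
  have := Real.sin_le_one (Real.pi * t)
  constructor <;> linarith

theorem rotChart_loopChart (j : Fin n) (t : I) :
    rotChart n H j (loopChart n t) = H (stdLoop n j t) := by
  have e : root n ^ (j : ℕ) * loopChart n t = stdLoop n j t := by
    rw [root_pow, loopChart, mul_left_comm, ← Complex.exp_add, ← add_mul, ← Complex.ofReal_add]
    rfl
  rw [rotChart, e, pr_coe]

theorem loopChart_mem_sector (hn : 2 ≤ n) {t : ℝ} (h0 : 1 / 2 ≤ t) (h1 : t ≤ 1) :
    loopChart n t ∈ sector n := by
  obtain ⟨hr, hr1⟩ := loopChart_radius (t := t) (by linarith) h1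
  have ha := (angle_pos hn).1
  have e : 2 * Real.pi / n = 2 * (Real.pi / n) := by ring
  rw [e] at ha
  refine polar_mem_sector hn hr hr1 (mul_nonneg (by linarith) (by linarith)) ?_ ?_ ?_
  · rw [e]
    nlinarith
  · intro h
    rcases mul_eq_zero.mp h with h | h
    · linarith
    · rw [show t = 1 / 2 by linarith, mul_one_div, Real.sin_pi_div_two]
      norm_num
  · rw [e]
    intro h
    nlinarith

theorem root_mul_loopChart_mem_sector (hn : 2 ≤ n) {t : ℝ} (h0 : 0 ≤ t) (h1 : t ≤ 1 / 2) :
    root n * loopChart n t ∈ sector n := by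
  obtain ⟨hr, hr1⟩ := loopChart_radius (t := t) (by linarith) (by linarith)
  have ha := (angle_pos hn).1
  have e : 2 * Real.pi / n = 2 * (Real.pi / n) := by ring
  have e2 : root n * loopChart n t = (3 / 4 * Real.sin (Real.pi * t) : ℝ) *
      Complex.exp ((2 * Real.pi / n + Real.pi / n * (t - 1 / 2) : ℝ) * Complex.I) := by
    rw [root, loopChart, mul_left_comm, ← Complex.exp_add, ← add_mul, ← Complex.ofReal_add]
  rw [e] at ha
  rw [e2]
  refine polar_mem_sector hn hr hr1 ?_ ?_ ?_ ?_
  · rw [e]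
    nlinarith
  · nlinarith
  · rw [e]
    intro h
    nlinarith
  · intro h
    have h' : Real.pi / n * (t - 1 / 2) = 0 := by linarith
    rcases mul_eq_zero.mp h' with h | h
    · linarith
    · rw [show t = 1 / 2 by linarith, mul_one_div, Real.sin_pi_div_two]
      norm_num

variable {F : Type*} [TopologicalSpace F] {V : Type*} {φ : C(F, Disk)}

/-- Sections over the sectors, indexed by the fibre over the center, and the permutations that
describe how they fit together beyond the punctures. -/
structure SectorSections [NeZero n] (φ : C(F, Disk)) (H : Disk ≃ₜ Disk) (s : Fin n → V → ℂ → F)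
    (ρ : Fin n → V → V) : Prop where
  cont : ∀ j v, ContinuousOn (s j v) (sector n)
  lift : ∀ j v, ∀ z ∈ sector n, φ (s j v z) = rotChart n H j z
  zero : ∀ i j v, s i v 0 = s j v 0
  inj : ∀ j v w, s j v 0 = s j w 0 → v = w
  surj : ∀ j y, φ y = H center → ∃ v, s j v 0 = y
  outer : ∀ j v, s j v (root n) = s (j + 1) (ρ (j + 1) v) 1

theorem exists_sector_lift [NeZero n] (hn : 2 ≤ n) (hφ : IsBranchedAlong φ (punctures n H))
    (j : Fin n) {z : ℂ} (hz : z ∈ sector n) {y : F} (hy : φ y = rotChart n H j z) :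
    ∃ f : ℂ → F, ContinuousOn f (sector n) ∧ f z = y ∧ ∀ z ∈ sector n, φ (f z) = rotChart n H j z :=
  exists_lift_of_starConvex hφ.covering (starConvex_sector hn) (continuous_rotChart j).continuousOn
    (fun _ hw => ((mem_sector_iff hn j hw.1).mp hw).2) hz hy

theorem eqOn_sector [NeZero n] (hφ : IsBranchedAlong φ (punctures n H)) (hn : 2 ≤ n)
    {X : Type*} [TopologicalSpace X] {j : Fin n} {A : Set X} (hA : IsPreconnected A) {c : X → ℂ}
    (hc : MapsTo c A (sector n)) {f g : X → F} (hf : ContinuousOn f A) (hg : ContinuousOn g A)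
    (hfl : ∀ x ∈ A, φ (f x) = rotChart n H j (c x)) (hgl : ∀ x ∈ A, φ (g x) = rotChart n H j (c x))
    {x : X} (hx : x ∈ A) (e : f x = g x) : EqOn f g A :=
  eqOn_of_lifts hφ.covering hA hf hg (fun x hx => by
    rw [hfl x hx]
    exact ((mem_sector_iff hn j (hc hx).1).mp (hc hx)).2) (fun x hx => by rw [hfl x hx, hgl x hx])
    hx e

theorem rotChart_zero (j : Fin n) : rotChart n H j 0 = H center := by
  rw [rotChart, mul_zero]
  congr 1
  apply Subtype.ext
  rw [coe_pr (by simp)]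
  rfl

/-- The standard generators describe how the sections over adjacent sectors fit together. -/
theorem exists_sectorSections [NeZero n] (hn : 2 ≤ n) (hφ : IsBranchedAlong φ (punctures n H))
    {e : V ≃ (φ ⁻¹' {H center} : Set F)} {ρ : Fin n → V → V}
    (he : ∀ (j : Fin n) (v : V), ∃ L : C(unitInterval, F), L 0 = e v ∧ L 1 = e (ρ j v) ∧
      ∀ t, φ (L t) = H (stdLoop n j t)) :
    ∃ s, SectorSections φ H s ρ := by
  choose s hs hs0 hsl using fun (j : Fin n) (v : V) =>
    exists_sector_lift hn hφ j (zero_mem_sector hn) (y := (e v : F)) (by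
      rw [rotChart_zero]
      exact (e v).2)
  refine ⟨s, hs, hsl, fun i j v => by rw [hs0, hs0], fun j v w h => ?_, fun j y hy => ?_,
    fun j v => ?_⟩
  · rw [hs0, hs0] at h
    exact e.injective (Subtype.ext h)
  · exact ⟨e.symm ⟨y, hy⟩, by rw [hs0, Equiv.apply_symm_apply]⟩
  · obtain ⟨L, hL0, hL1, hL⟩ := he (j + 1) v
    -- The loop around the puncture `j + 1` lies in sector `j` up to time `1/2` and in sector `j +
    -- 1` afterwards. It crosses the common side at radius `3/4`, beyond the puncture, where its
    -- lift passes from index `v` to `ρ (j + 1) v`; the agreement then spreads along the side to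
    -- radius `1`.
    have hhalf : (⟨1 / 2, by norm_num, by norm_num⟩ : I) ∈ {t : I | (t : ℝ) ≤ 1 / 2} ∩
        {t : I | 1 / 2 ≤ (t : ℝ)} := ⟨le_refl (1 / 2 : ℝ), le_refl (1 / 2 : ℝ)⟩
    have hlc : Continuous fun t : I => loopChart n t :=
      (continuous_loopChart n).comp continuous_subtype_val
    have h1 : EqOn L (fun t : I => s j v (root n * loopChart n t)) {t : I | (t : ℝ) ≤ 1 / 2} := by
      have hm : MapsTo (fun t : I => root n * loopChart n t) {t : I | (t : ℝ) ≤ 1 / 2} (sector n) :=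
        fun t ht => root_mul_loopChart_mem_sector hn t.2.1 ht
      refine eqOn_sector hφ hn (j := j) (c := fun t : I => root n * loopChart n t)
        (OrdConnected.isPreconnected ⟨fun _ _ _ h _ h' => (Subtype.coe_le_coe.mpr h'.2).trans h⟩)
        hm L.continuous.continuousOn
        ((hs j v).comp (continuous_const.mul hlc).continuousOn hm) (fun t _ => ?_)
        (fun t ht => hsl j v _ (hm ht)) (x := 0) (show ((0 : I) : ℝ) ≤ 1 / 2 by norm_num) ?_
      · rw [hL, rotChart_root_mul, rotChart_loopChart]
      · rw [hL0, loopChart]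
        simp [hs0]
    have h2 : EqOn L (fun t : I => s (j + 1) (ρ (j + 1) v) (loopChart n t))
        {t : I | 1 / 2 ≤ (t : ℝ)} := by
      have hm : MapsTo (fun t : I => loopChart n t) {t : I | 1 / 2 ≤ (t : ℝ)} (sector n) :=
        fun t ht => loopChart_mem_sector hn ht t.2.2
      refine eqOn_sector hφ hn (j := j + 1) (c := fun t : I => loopChart n t)
        (OrdConnected.isPreconnected ⟨fun _ h _ _ _ h' => le_trans h (Subtype.coe_le_coe.mpr h'.1)⟩)
        hm L.continuous.continuousOn ((hs _ _).comp hlc.continuousOn hm) (fun t _ => ?_)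
        (fun t ht => hsl _ _ _ (hm ht)) (x := 1) (by
          change (1 / 2 : ℝ) ≤ ((1 : I) : ℝ)
          norm_num) ?_
      · rw [hL, rotChart_loopChart]
      · rw [hL1]
        simp [hs0, loopChart]
    have h3 := (h1 hhalf.1).symm.trans (h2 hhalf.2)
    simp only [loopChart_half] at h3
    have hm : MapsTo (fun t : ℝ => (t : ℂ)) (Ioc (1 / 2) 1) (sector n) := fun t ht =>
      ofReal_mem_sector hn (by linarith [ht.1]) ht.2 ht.1.ne'
    have hm' : MapsTo (fun t : ℝ => root n * (t : ℂ)) (Ioc (1 / 2) 1) (sector n) := fun t ht =>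
      root_mul_mem_sector hn (by linarith [ht.1]) ht.2 ht.1.ne'
    have h4 := eqOn_sector hφ hn (j := j + 1) (c := fun t : ℝ => (t : ℂ)) isPreconnected_Ioc hm
      (f := fun t => s j v (root n * t)) (g := fun t => s (j + 1) (ρ (j + 1) v) t)
      ((hs j v).comp (continuous_const.mul Complex.continuous_ofReal).continuousOn hm')
      ((hs _ _).comp Complex.continuous_ofReal.continuousOn hm)
      (fun t ht => by rw [hsl j v _ (hm' ht), rotChart_root_mul])
      (fun t ht => hsl _ _ _ (hm ht)) (x := 3 / 4) (by norm_num) h3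
    simpa using h4 (right_mem_Ioc.mpr (by norm_num))

end Sectors

end ArcTwist

namespace ArcTwist

/-! ### Gluing over the sectors; coordinate disks at the punctures -/

section Sectors

set_option linter.unusedSectionVars false

variable {n : ℕ} [NeZero n] {H : Disk ≃ₜ Disk} {F : Type*} [TopologicalSpace F] {V : Type*}
  {φ : C(F, Disk)} {s : Fin n → V → ℂ → F} {ρ : Fin n → V → V}

namespace SectorSections

theorem inj_sector (S : SectorSections φ H s ρ) (hn : 2 ≤ n)
    (hφ : IsBranchedAlong φ (punctures n H)) {j : Fin n} {v w : V} {z : ℂ} (hz : z ∈ sector n)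
    (h : s j v z = s j w z) : v = w :=
  S.inj j v w (eqOn_sector hφ hn (isPreconnected_sector hn) (mapsTo_id _) (S.cont j v) (S.cont j w)
    (S.lift j v) (S.lift j w) hz h (zero_mem_sector hn))

theorem surj_sector (S : SectorSections φ H s ρ) (hn : 2 ≤ n)
    (hφ : IsBranchedAlong φ (punctures n H)) {j : Fin n} {y : F} {z : ℂ} (hz : z ∈ sector n)
    (hy : φ y = rotChart n H j z) : ∃ v, s j v z = y := by
  obtain ⟨f, hf, hfz, hfl⟩ := exists_sector_lift hn hφ j hz hy
  obtain ⟨v, hv⟩ := S.surj j (f 0) (by rw [hfl 0 (zero_mem_sector hn), rotChart_zero])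
  refine ⟨v, ?_⟩
  rw [← hfz]
  exact eqOn_sector hφ hn (isPreconnected_sector hn) (mapsTo_id _) (S.cont j v) hf
    (S.lift j v) hfl (zero_mem_sector hn) hv hz

theorem cover (S : SectorSections φ H s ρ) (hn : 2 ≤ n) (hφ : IsBranchedAlong φ (punctures n H))
    {x : F} (hx : φ x ∉ punctures n H) : ∃ j v, ∃ z ∈ sector n, s j v z = x := by
  obtain ⟨j, z, hz, hw⟩ := exists_wedge hn (H.symm (φ x) : Disk)
  have hz1 : ‖z‖ ≤ 1 := by
    rw [← norm_rot j, ← hw]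
    exact norm_coe_le _
  have e : φ x = rotChart n H j z := by
    rw [rotChart, ← hw, pr_coe, H.apply_symm_apply]
  have hzs : z ∈ sector n := (mem_sector_iff hn j hz1).mpr ⟨hz, e ▸ hx⟩
  obtain ⟨v, hv⟩ := S.surj_sector hn hφ hzs e
  exact ⟨j, v, z, hzs, hv⟩

theorem side (S : SectorSections φ H s ρ) (hn : 2 ≤ n) (hφ : IsBranchedAlong φ (punctures n H))
    {T : Set ℝ} (hT : IsPreconnected T) (hT1 : ∀ t ∈ T, 0 ≤ t ∧ t ≤ 1 ∧ t ≠ 1 / 2) {j : Fin n}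
    {v w : V} {t₀ : ℝ} (ht₀ : t₀ ∈ T) (h : s j v (root n * t₀) = s (j + 1) w t₀) {t : ℝ}
    (ht : t ∈ T) : s j v (root n * t) = s (j + 1) w t := by
  have hm : MapsTo (fun t : ℝ => (t : ℂ)) T (sector n) := fun t ht =>
    ofReal_mem_sector hn (hT1 t ht).1 (hT1 t ht).2.1 (hT1 t ht).2.2
  have hm' : MapsTo (fun t : ℝ => root n * (t : ℂ)) T (sector n) := fun t ht =>
    root_mul_mem_sector hn (hT1 t ht).1 (hT1 t ht).2.1 (hT1 t ht).2.2
  exact eqOn_sector hφ hn (j := j + 1) (c := fun t : ℝ => (t : ℂ)) hT hm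
    (f := fun t => s j v (root n * t)) (g := fun t => s (j + 1) w t)
    ((S.cont j v).comp (continuous_const.mul Complex.continuous_ofReal).continuousOn hm')
    ((S.cont _ _).comp Complex.continuous_ofReal.continuousOn hm)
    (fun t ht => by rw [S.lift j v _ (hm' ht), rotChart_root_mul])
    (fun t ht => S.lift _ _ _ (hm ht)) ht₀ h ht

theorem side_inner (S : SectorSections φ H s ρ) (hn : 2 ≤ n)
    (hφ : IsBranchedAlong φ (punctures n H)) (j : Fin n) (v : V) {t : ℝ} (h0 : 0 ≤ t)
    (h1 : t < 1 / 2) : s j v (root n * t) = s (j + 1) v t :=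
  S.side hn hφ (T := Ico 0 (1 / 2)) isPreconnected_Ico
    (fun t ht => ⟨ht.1, by linarith [ht.2], ht.2.ne⟩) (t₀ := 0) (by norm_num)
    (by simpa using S.zero j (j + 1) v) ⟨h0, h1⟩

theorem side_outer (S : SectorSections φ H s ρ) (hn : 2 ≤ n)
    (hφ : IsBranchedAlong φ (punctures n H)) (j : Fin n) (v : V) {t : ℝ} (h0 : 1 / 2 < t)
    (h1 : t ≤ 1) : s j v (root n * t) = s (j + 1) (ρ (j + 1) v) t :=
  S.side hn hφ (T := Ioc (1 / 2) 1) isPreconnected_Ioc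
    (fun t ht => ⟨by linarith [ht.1], ht.2, ht.1.ne'⟩) (t₀ := 1) (by norm_num)
    (by simpa using S.outer j v) ⟨h0, h1⟩

/-- Functions on the sectors that agree along their sides fit together. -/
theorem exists_glue [T2Space F] [Finite V] (S : SectorSections φ H s ρ) (hn : 2 ≤ n)
    (hφ : IsBranchedAlong φ (punctures n H)) {Y : Type*} [TopologicalSpace Y] [Nonempty Y]
    [CompactSpace F]
    {t : Fin n → V → ℂ → Y} (ht : ∀ j v, ContinuousOn (t j v) (sector n))
    (h0 : ∀ i j v, t i v 0 = t j v 0)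
    (hin : ∀ j v, ∀ r : ℝ, 0 ≤ r → r < 1 / 2 → t j v (root n * r) = t (j + 1) v r)
    (hout : ∀ j v, ∀ r : ℝ, 1 / 2 < r → r ≤ 1 →
      t j v (root n * r) = t (j + 1) (ρ (j + 1) v) r) :
    ∃ g : ↥{x | φ x ∉ punctures n H} → Y, Continuous g ∧
      ∀ x : ↥{x | φ x ∉ punctures n H}, ∀ j v, ∀ z ∈ sector n, s j v z = x → g x = t j v z := by
  -- Adjacent sections meet below the puncture with equal indices and beyond it with indices related
  -- by `ρ`, so the two matching conditions cover the whole side.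
  have hadj : ∀ j v w, ∀ r : ℝ, 0 ≤ r → (r : ℂ) ∈ sector n →
      s j v (root n * r) = s (j + 1) w r → t j v (root n * r) = t (j + 1) w r := by
    intro j v w r hr hrs e
    have hr1 : r ≤ 1 := by simpa [abs_of_nonneg hr] using hrs.1
    rcases lt_trichotomy r (1 / 2) with h | h | h
    · rw [S.side_inner hn hφ j v hr h] at e
      rw [hin j v r hr h, S.inj_sector hn hφ hrs e]
    · exact absurd (by rw [h]; push_cast; rfl) hrs.2.2.1
    · rw [S.side_outer hn hφ j v h hr1] at e
      rw [hout j v r h hr1, S.inj_sector hn hφ hrs e]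
  have key := exists_glue_sections (φ := φ) (P := punctures n H) (ι := Fin n × V) (Y := Y)
    (κ := fun i z => rotChart n H i.1 z) (fun i => isEmbedding_rotChart i.1)
    (Q := fun _ => {z : Disk | (z : ℂ) ∈ wedge n})
    (fun _ => (isClosed_wedge n).preimage continuous_subtype_val)
    (E := fun _ => sector n) (fun i z => mem_sector_iff hn i.1 (norm_coe_le z))
    (fun _ z hz => hz.1) (s := fun i => s i.1 i.2) (t := fun i => t i.1 i.2)
    (fun i => S.cont _ _) (fun i => ht _ _)
    (fun i z hz => by simp only [S.lift i.1 i.2 z hz, coe_pr hz.1]) isClosed_empty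
    (continuous_const (y := Classical.arbitrary Y))
    (fun x hx => by
      obtain ⟨j, v, z, hz, e⟩ := S.cover hn hφ hx
      exact Or.inr ⟨(j, v), z, hz, e⟩)
    (fun _ _ _ h => h.elim) ?_
  · obtain ⟨g, hg, -, hgt⟩ := key
    exact ⟨g, hg, fun x j v z hz e => hgt x (j, v) z hz e⟩
  · rintro ⟨i, v⟩ z hz ⟨j, w⟩ z' hz' e
    simp only at e ⊢
    have e2 := congrArg φ e
    rw [S.lift i v z hz, S.lift j w z' hz', rotChart_eq_iff hz.1 hz'.1] at e2
    rcases wedge_overlap hn hz.2.1 hz'.2.1 e2 with ⟨rfl, rfl⟩ | ⟨rfl, rfl⟩ | ⟨rfl, r, hr, rfl, rfl⟩ |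
      ⟨rfl, r, hr, rfl, rfl⟩
    · rw [S.zero i j] at e
      rw [S.inj j v w e, h0 i j]
    · rw [S.inj_sector hn hφ hz e]
    · exact hadj i v w r hr hz' e
    · exact (hadj j w v r hr hz e.symm).symm

end SectorSections

/-- Close to a puncture only the side through it should matter. For `n ≥ 3` the inequality for the
other side is strict at the puncture, hence holds nearby; for `n = 2` both sides lie on one line and
the inequalities coincide with those assumed. -/
theorem eventually_sector_sides (hn : 2 ≤ n) : ∀ᶠ z : ℂ in 𝓝 0,
    (z.im ≤ 0 → 0 ≤ (root n * (1 / 2 + z)).im) ∧ (0 ≤ z.im → ((1 / 2 + z) / root n).im ≤ 0) := by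
  rcases hn.eq_or_lt with rfl | h3
  · have e : root 2 = -1 := by
      rw [root, ← Complex.exp_pi_mul_I]
      congr 2
      push_cast
      ring
    refine Eventually.of_forall fun z => ⟨fun h => ?_, fun h => ?_⟩ <;> rw [e]
    · simpa using h
    · rw [div_neg, div_one]
      simpa using h
  · have ha := (angle_pos hn).1
    have hlt : 2 * Real.pi / n < Real.pi := by
      have : (3 : ℝ) ≤ n := by exact_mod_cast h3
      rw [div_lt_iff₀ (by linarith)]
      nlinarith [Real.pi_pos]
    have hs := Real.sin_pos_of_pos_of_lt_pi ha hlt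
    have c1 : ContinuousAt (fun z : ℂ => (root n * (1 / 2 + z)).im) 0 := by fun_prop
    have c2 : ContinuousAt (fun z : ℂ => ((1 / 2 + z) / root n).im) 0 :=
      (Complex.continuous_im.comp
        ((continuous_const.add continuous_id).div_const (root n))).continuousAt
    have e1 : 0 < (root n * (1 / 2 + 0)).im := by
      have := polar_im (1 / 2) (2 * Real.pi / n)
      rw [← root, mul_comm] at this
      push_cast at this
      rw [add_zero, this]
      linarith
    have e2 : ((1 / 2 + 0) / root n).im < 0 := by
      have := polar_div_root n (1 / 2) 0
      push_cast at this
      rw [zero_mul, Complex.exp_zero, mul_one] at this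
      rw [add_zero, this]
      have h2 := polar_im (1 / 2) (0 - 2 * Real.pi / n)
      push_cast at h2
      rw [h2, zero_sub, Real.sin_neg]
      linarith
    filter_upwards [c1.eventually (lt_mem_nhds e1), c2.eventually (gt_mem_nhds e2)] with z h1 h2
    exact ⟨fun _ => h1.le, fun _ => h2.le⟩

theorem finite_punctures : (punctures n H).Finite := finite_range _

/-- The sections over the two sectors adjacent to a puncture. -/
theorem SectorSections.exists_halfSections (S : SectorSections φ H s ρ) (hn : 2 ≤ n)
    (hφ : IsBranchedAlong φ (punctures n H)) (j : Fin n) : ∃ δ : ℝ, δ < 1 / 2 ∧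
      PunctureChart (punctures n H) (fun z => rotChart n H (j + 1) (1 / 2 + z)) δ ∧
      (∀ z ∈ lowerHalf δ, root n * (1 / 2 + z) ∈ sector n) ∧
      (∀ z ∈ upperHalf δ, 1 / 2 + z ∈ sector n) ∧
      HalfSections φ (fun z => rotChart n H (j + 1) (1 / 2 + z)) δ
        (fun v z => s j v (root n * (1 / 2 + z))) (fun v z => s (j + 1) v (1 / 2 + z))
        (ρ (j + 1)) := by
  set κ : ℂ → Disk := fun z => rotChart n H (j + 1) (1 / 2 + z) with hκ
  have hκc : Continuous κ := (continuous_rotChart _).comp (continuous_const.add continuous_id)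
  have hκ0 : κ 0 = H (stdPoint n (j + 1)) := by
    simp only [hκ, add_zero, rotChart_half]
  have hev : ∀ᶠ z in 𝓝 (0 : ℂ), κ z ∉ punctures n H \ {κ 0} :=
    hκc.continuousAt.eventually_mem
      ((finite_punctures.subset sdiff_subset).isClosed.isOpen_compl.mem_nhds (by simp))
  obtain ⟨ε, hε, hball⟩ := Metric.eventually_nhds_iff.mp (hev.and (eventually_sector_sides hn))
  -- The bound `ε / 2` keeps the closed disk away from the other punctures and inside the two
  -- adjacent sectors; the bound `1/4` keeps it inside the unit disk and off the center.
  set δ := min (ε / 2) (1 / 4) with hδ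
  have hδ0 : 0 < δ := lt_min (by linarith) (by norm_num)
  have hδ1 : δ ≤ 1 / 4 := min_le_right _ _
  have hsm : ∀ z : ℂ, ‖z‖ ≤ δ → dist z 0 < ε := fun z hz => by
    rw [dist_zero_right]
    exact (hz.trans (min_le_left _ _)).trans_lt (by linarith)
  have hn1 : ∀ z : ℂ, ‖z‖ ≤ δ → ‖1 / 2 + z‖ ≤ 1 := fun z hz =>
    ArcChart.norm_half_add_le (hz.trans (hδ1.trans (by norm_num)))
  have hinj : InjOn κ (Metric.closedBall 0 δ) := fun z hz w hw e =>
    add_left_cancel (rotChart_injOn (hn1 z (by simpa using hz)) (hn1 w (by simpa using hw)) e)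
  have hoff : ∀ z, ‖z‖ ≤ δ → z ≠ 0 → κ z ∉ punctures n H := fun z hz h0 hP =>
    (hball (hsm z hz)).1 ⟨hP, fun e => h0 (hinj (by simpa using hz)
      (by simpa using hδ0.le) e)⟩
  have hchart : PunctureChart (punctures n H) κ δ := by
    refine ⟨hδ0, hκc.continuousOn, hinj, ?_, hoff, fun r hr hrδ => ?_⟩
    · rw [hκ0]
      exact ⟨j + 1, rfl⟩
    · have ho : IsOpen {w : Disk | dist (w : ℂ) (stdPoint n (j + 1)) < r} :=
        isOpen_lt (by fun_prop) continuous_const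
      rw [hκ0]
      refine mem_of_superset ((H.isOpenMap _ ho).mem_nhds ⟨stdPoint n (j + 1), by simpa using hr, rfl⟩) ?_
      rintro _ ⟨w, hw, rfl⟩
      have hr0 : root n ^ ((j + 1 : Fin n) : ℕ) ≠ 0 := pow_ne_zero _ (root_ne_zero n)
      have e : root n ^ ((j + 1 : Fin n) : ℕ) * (1 / 2 + ((w : ℂ) / root n ^ ((j + 1 : Fin n) : ℕ) - 1 / 2))
          = w := by
        field_simp
        ring
      refine ⟨(w : ℂ) / root n ^ ((j + 1 : Fin n) : ℕ) - 1 / 2, ?_, ?_⟩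
      · rw [mem_ball_zero_iff, ← norm_rot (j + 1)]
        convert (show dist (w : ℂ) (stdPoint n (j + 1)) < r from hw) using 1
        rw [dist_eq_norm, coe_stdPoint]
        congr 1
        rw [mul_sub, mul_div_cancel₀ _ hr0]
      · simp only [hκ, rotChart, e, pr_coe]
  have hlo : ∀ z ∈ lowerHalf δ, root n * (1 / 2 + z) ∈ sector n := by
    intro z hz
    have h1 : ‖root n * (1 / 2 + z)‖ ≤ 1 := by
      rw [norm_mul, norm_root, one_mul]
      exact hn1 z hz.1
    refine (mem_sector_iff (H := H) hn j h1).mpr ⟨⟨(hball (hsm z hz.1)).2.1 hz.2.1, ?_⟩, ?_⟩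
    · rw [mul_div_cancel_left₀ _ (root_ne_zero n)]
      simpa using hz.2.1
    · rw [rotChart_root_mul]
      exact hoff z hz.1 hz.2.2
  have hup : ∀ z ∈ upperHalf δ, 1 / 2 + z ∈ sector n := by
    intro z hz
    refine (mem_sector_iff (H := H) hn (j + 1) (hn1 z hz.1)).mpr
      ⟨⟨by simpa using hz.2.1, (hball (hsm z hz.1)).2.2 hz.2.1⟩, hoff z hz.1 hz.2.2⟩
  have hmem : (-δ : ℂ) ∈ lowerHalf δ := by
    simp [lowerHalf, abs_of_pos hδ0, hδ0.ne']
  have e1 : (1 / 2 + -(δ : ℂ)) = ((1 / 2 - δ : ℝ) : ℂ) := by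
    push_cast
    ring
  have e2 : (1 / 2 + (δ : ℂ)) = ((1 / 2 + δ : ℝ) : ℂ) := by
    push_cast
    ring
  refine ⟨δ, by linarith, hchart, hlo, hup, ?_⟩
  refine ⟨fun v => (S.cont j v).comp (by fun_prop) hlo, fun v => (S.cont _ v).comp (by fun_prop) hup,
    fun v z hz => ?_, fun v z hz => S.lift _ v _ (hup z hz), fun v => ?_, fun v => ?_,
    fun v w h => S.inj_sector hn hφ (hlo _ hmem) h, fun y hy => ?_⟩
  · rw [S.lift j v _ (hlo z hz), rotChart_root_mul]
  · rw [e1]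
    exact S.side_inner hn hφ j v (by linarith) (by linarith)
  · rw [e2]
    exact S.side_outer hn hφ j v (by linarith) (by linarith)
  · exact S.surj_sector hn hφ (hlo _ hmem) (by rw [rotChart_root_mul]; exact hy)

end Sectors

end ArcTwist

namespace ArcTwist

/-! ### Potentials on trees -/

/-- On a tree, every antisymmetric function of the oriented edges is the coboundary of a function on
the vertices. -/
theorem exists_potential {V A : Type*} [AddCommGroup A] {G : SimpleGraph V} (hG : G.IsTree)
    {f : V → V → A} (hf : ∀ v w, G.Adj v w → f w v = -f v w) :
    ∃ k : V → A, ∀ v w, G.Adj v w → f v w = k w - k v := by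
  classical
  obtain ⟨o⟩ := hG.connected.nonempty
  -- The potential is the sum of `f` along the unique path from a root; the paths to adjacent
  -- vertices differ by a single edge, and antisymmetry covers both orders.
  choose p hp hpu using fun v => hG.existsUnique_path o v
  have key : ∀ v w, G.Adj v w → w ∉ (p v).support →
      ((p w).darts.map fun d => f d.fst d.snd).sum =
        ((p v).darts.map fun d => f d.fst d.snd).sum + f v w := by
    intro v w h hw
    have : (p v).concat h = p w := hpu w _ ((hp v).concat hw h)
    rw [← this, SimpleGraph.Walk.darts_concat]
    simp
  refine ⟨fun v => ((p v).darts.map fun d => f d.fst d.snd).sum, fun v w h => ?_⟩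
  by_cases hw : w ∈ (p v).support
  · have hv : v ∉ (p w).support := by
      have e : (p v).takeUntil w hw = p w := hpu w _ ((hp v).takeUntil hw)
      rw [← e]
      exact SimpleGraph.Walk.endpoint_notMem_support_takeUntil (hp v) hw h.ne
    have := key w v h.symm hv
    rw [hf v w h] at this
    beta_reduce
    rw [this]
    abel
  · beta_reduce
    rw [key v w h hw]
    abel

/-- Involutions of the vertices of a tree such as the representation given by an edge coloring. -/
structure IsTreeAction {V : Type*} {n : ℕ} (ρ : Fin n → V → V) : Prop where
  involutive : ∀ j v, ρ j (ρ j v) = v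
  potential : ∀ d : Fin n → V → ℂ, (∀ j v, d j (ρ j v) = -d j v) →
    ∃ k : V → ℂ, ∀ j v, d j v = k (ρ j v) - k v
  invariant : ∀ f : V → ℂ, (∀ j v, f (ρ j v) = f v) → ∀ v w, f v = f w

theorem isTreeAction_rho {V : Type*} {G : SimpleGraph V} (hG : G.IsTree) {n : ℕ}
    (c : G.lineGraph.Coloring (Fin n)) :
    IsTreeAction fun (j : Fin n) (v : V) => rho c (FreeGroup.of j) v := by
  classical
  have hrho : ∀ (j : Fin n) (v : V), rho c (FreeGroup.of j) v = colorSwap c j v := fun j v => by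
    rw [rho, FreeGroup.lift_apply_of]
    rfl
  simp only [hrho]
  have hcol : ∀ v w (h : G.Adj v w), colorSwap c (c ⟨s(v, w), h⟩) v = w := fun v w h =>
    colorSwap_of_adj ⟨h, rfl⟩
  refine ⟨fun j v => colorSwap_involutive c j v, fun d hd => ?_, fun f hf v w => ?_⟩
  · obtain ⟨k, hk⟩ := exists_potential hG
      (f := fun v w => if h : G.Adj v w then d (c ⟨s(v, w), h⟩) v else 0) (by
        intro v w h
        have e : c ⟨s(w, v), h.symm⟩ = c ⟨s(v, w), h⟩ := by
          congr 1
          exact Subtype.ext Sym2.eq_swap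
        rw [dif_pos h.symm, dif_pos h, e, ← hd, hcol])
    refine ⟨k, fun j v => ?_⟩
    by_cases h : ∃ w, ColoredAdj c j v w
    · obtain ⟨w, hw⟩ := h
      rw [colorSwap_of_adj hw]
      obtain ⟨hvw, rfl⟩ := hw
      rw [← hk v w hvw, dif_pos hvw]
    -- A vertex without an edge of color `j` is fixed, and there antisymmetry forces `d j v = 0`.
    · have e : colorSwap c j v = v := by rw [colorSwap, dif_neg h]
      have := hd j v
      rw [e] at this
      rw [e, sub_self]
      exact self_eq_neg.mp this
  · obtain ⟨p⟩ := hG.connected.preconnected v w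
    induction p with
    | nil => rfl
    | cons h p ih => rw [← ih, ← hf (c ⟨s(_, _), h⟩), hcol]

/-- A family that changes between consecutive indices by the involutions is constant. -/
theorem IsTreeAction.eq_of_cyclic {V : Type*} [Finite V] {n : ℕ} [NeZero n] {ρ : Fin n → V → V}
    (T : IsTreeAction ρ) {f : Fin n → V → ℂ} (hf : ∀ j v, f j v = f (j + 1) (ρ (j + 1) v))
    (i j : Fin n) (v w : V) : f i v = f j w := by
  have := Fintype.ofFinite V
  have hf' : ∀ j v, f j (ρ j v) = f (j - 1) v := fun j v => by
    rw [hf (j - 1) v, sub_add_cancel]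
  set d : Fin n → V → ℂ := fun j v => f j (ρ j v) - f j v with hd
  have hanti : ∀ j v, d j (ρ j v) = -d j v := fun j v => by
    simp only [hd, T.involutive]
    ring
  have hsum : ∀ v, ∑ j, d j v = 0 := fun v => by
    simp only [hd, hf', Finset.sum_sub_distrib]
    exact sub_eq_zero.mpr ((Equiv.subRight (1 : Fin n)).sum_comp fun j => f j v)
  -- On the tree `d` is also a gradient, and a divergence-free gradient is orthogonal to itself: the
  -- two sums below vanish, and their difference is `∑ |d|²`. This replaces the fact that the
  -- product of the transpositions of a tree is a single cycle, that is, the connectedness of `∂F`.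
  obtain ⟨k, hk⟩ := T.potential d hanti
  have h1 : ∑ j, ∑ v, (starRingEnd ℂ) (d j v) * k v = 0 := by
    rw [Finset.sum_comm]
    refine Finset.sum_eq_zero fun v _ => ?_
    rw [← Finset.sum_mul, ← map_sum, hsum, map_zero, zero_mul]
  have h2 : ∑ j, ∑ v, (starRingEnd ℂ) (d j v) * k (ρ j v) = 0 := by
    have : ∀ j, ∑ v, (starRingEnd ℂ) (d j v) * k (ρ j v) =
        -∑ v, (starRingEnd ℂ) (d j v) * k v := by
      intro j
      refine (Equiv.sum_comp (Function.Involutive.toPerm (ρ j) (T.involutive j)) fun v =>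
        (starRingEnd ℂ) (d j v) * k (ρ j v)).symm.trans ?_
      rw [← Finset.sum_neg_distrib]
      refine Finset.sum_congr rfl fun v _ => ?_
      change (starRingEnd ℂ) (d j (ρ j v)) * k (ρ j (ρ j v)) = _
      rw [hanti, T.involutive, map_neg, neg_mul]
    simp only [this, Finset.sum_neg_distrib, h1, neg_zero]
  have h3 : ∑ j, ∑ v, Complex.normSq (d j v) = 0 := by
    have : ((∑ j, ∑ v, Complex.normSq (d j v) : ℝ) : ℂ) =
        ∑ j, ∑ v, (starRingEnd ℂ) (d j v) * k (ρ j v) - ∑ j, ∑ v, (starRingEnd ℂ) (d j v) * k v := by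
      simp only [← Finset.sum_sub_distrib, ← mul_sub, ← hk]
      push_cast
      simp only [Complex.normSq_eq_conj_mul_self]
    rw [h1, h2, sub_zero] at this
    exact_mod_cast this
  have h4 : ∀ j v, d j v = 0 := by
    intro j v
    rw [Finset.sum_eq_zero_iff_of_nonneg fun j _ => Finset.sum_nonneg fun v _ =>
      Complex.normSq_nonneg _] at h3
    have h5 := h3 j (Finset.mem_univ j)
    rw [Finset.sum_eq_zero_iff_of_nonneg fun v _ => Complex.normSq_nonneg _] at h5
    exact Complex.normSq_eq_zero.mp (h5 v (Finset.mem_univ v))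
  have hstep : ∀ (j : Fin n) v, f (j + 1) v = f j v := fun j v => by
    have := h4 (j + 1) v
    simp only [hd, hf', add_sub_cancel_right] at this
    exact (sub_eq_zero.mp this).symm
  have hzero : ∀ (m : ℕ) (j : Fin n), (j : ℕ) = m → ∀ v, f j v = f 0 v := by
    intro m
    induction m with
    | zero => exact fun j hj v => by rw [Fin.ext (a := j) (b := 0) (by simpa using hj)]
    | succ m ih =>
      intro j hj v
      have hm : m < n := by omega
      have : j = ⟨m, hm⟩ + 1 := Fin.ext (by
        rw [Fin.val_add, Fin.val_one', Nat.add_mod_mod, hj]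
        exact (Nat.mod_eq_of_lt (by omega)).symm)
      rw [this, hstep, ih _ rfl]
  have hall : ∀ (j : Fin n) v, f j v = f 0 v := fun j v => hzero j j rfl v
  rw [hall i, hall j]
  refine T.invariant (f 0) (fun j v => ?_) v w
  rw [← hall j, ← hall j]
  exact sub_eq_zero.mp (h4 j v)

end ArcTwist

namespace ArcTwist

/-! ### Logarithms on the total space -/

section Log

set_option linter.unusedSectionVars false

section Half

variable {F B : Type*} [TopologicalSpace F] [TopologicalSpace B] [CompactSpace F] [T2Space F]
  [T2Space B] {φ : C(F, B)} {P : Set B} {κ : ℂ → B} {δ : ℝ} {V : Type*} {sm sp : V → ℂ → F}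
  {a : V → V}

/-- The function is constant near every point over a puncture. -/
def LocallyConstantAt (φ : C(F, B)) (P : Set B) {Y : Type*} (χ : F → Y) (x : F) : Prop :=
  ∃ O ∈ 𝓝 x, ∃ c, ∀ y ∈ O, φ y ∉ P → χ y = c

theorem HalfSections.exists_const (hφ : IsBranchedAlong φ P) (hκ : PunctureChart P κ δ)
    (hs : HalfSections φ κ δ sm sp a) {Y : Type*} {χ : F → Y}
    (hχ : ∀ x, φ x = κ 0 → LocallyConstantAt φ P χ x) (v : V) :
    ∃ ε, 0 < ε ∧ ε ≤ δ ∧ ∃ c, (∀ z ∈ lowerHalf ε, χ (sm v z) = c) ∧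
      ∀ z ∈ upperHalf ε, χ (sp (a v) z) = c := by
  obtain ⟨Ψ, hΨ, h⟩ := hs.exists_expLift hφ hκ v
  obtain ⟨x, hx, hlim⟩ := hΨ.exists_limit hφ hκ
  obtain ⟨O, hO, c, hc⟩ := hχ x hx
  obtain ⟨R, hR⟩ := hlim O hO
  have hcw : ∀ w : ℂ, w.re < R → χ (Ψ w) = c := fun w hw => by
    refine hc _ (hR w hw).2 ?_
    rw [hΨ.lift w (hR w hw).1]
    exact hκ.exp_notMem (hR w hw).1
  refine ⟨min δ (Real.exp (R - 1)), lt_min hκ.pos (Real.exp_pos _), min_le_left _ _, c, ?_, ?_⟩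
  all_goals
    intro z hz
    have hpos : 0 < ‖z‖ := norm_pos_iff.mpr hz.2.2
    have hre : Real.log ‖z‖ < R := by
      have := Real.log_le_log hpos (hz.1.trans (min_le_right _ _))
      rw [Real.log_exp] at this
      linarith
    have hdom : ∀ w : ℂ, Complex.exp w = z → w ∈ expDomain δ := fun w hw => by
      rw [mem_expDomain hκ.pos, hw]
      exact hz.1.trans (min_le_left _ _)
  · obtain ⟨w, hw, hre', h1, h2⟩ : ∃ w : ℂ, Complex.exp w = z ∧ w.re = Real.log ‖z‖ ∧
        -Real.pi ≤ w.im ∧ w.im ≤ 0 := by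
      rcases le_or_gt z.arg 0 with h0 | h0
      · exact ⟨Complex.log z, Complex.exp_log hz.2.2, Complex.log_re z,
          by rw [Complex.log_im]; exact (Complex.neg_pi_lt_arg z).le, by rwa [Complex.log_im]⟩
      · have him : z.im = 0 := le_antisymm hz.2.1 (Complex.arg_nonneg_iff.mp h0.le)
        have hpi : z.arg = Real.pi := by
          rw [Complex.arg_eq_pi_iff]
          refine ⟨?_, him⟩
          by_contra! hge
          rw [Complex.arg_eq_zero_iff.mpr ⟨hge, him⟩] at h0
          exact lt_irrefl _ h0
        -- On the negative axis the principal argument is `π`, but the strip over the lower half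
        -- needs the angle `-π`.
        refine ⟨Complex.log z - 2 * Real.pi * Complex.I, ?_, ?_, ?_⟩
        · rw [Complex.exp_sub, Complex.exp_two_pi_mul_I, div_one, Complex.exp_log hz.2.2]
        · simp [Complex.log_re]
        · simp only [Complex.sub_im, Complex.log_im, hpi]
          constructor <;> simp <;> linarith [Real.pi_pos]
    rw [← hw, ← hs.eq_lower hφ hκ hΨ h (hdom w hw) h1 h2]
    exact hcw w (by rw [hre']; exact hre)
  · have hw := Complex.exp_log hz.2.2
    rw [← hw, ← hs.eq_upper hφ hκ hΨ h (hdom _ hw)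
      (by rw [Complex.log_im]; exact Complex.arg_nonneg_iff.mpr hz.2.1)
      (by rw [Complex.log_im]; exact Complex.arg_le_pi z)]
    exact hcw _ (by rw [Complex.log_re]; exact hre)

/-- The mismatch beyond a puncture of the logarithms on the two sides of it is antisymmetric. -/
theorem HalfSections.log_antisymm (hφ : IsBranchedAlong φ P) (hκ : PunctureChart P κ δ)
    (hs : HalfSections φ κ δ sm sp a) (ha : ∀ v, a (a v) = v) {χ : F → ℂ}
    (hχ : ∀ x, φ x = κ 0 → LocallyConstantAt φ P χ x) {fm fp : V → ℂ → ℂ}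
    (hfm : ∀ v, ContinuousOn (fm v) (lowerHalf δ)) (hfp : ∀ v, ContinuousOn (fp v) (upperHalf δ))
    (hem : ∀ v, ∀ z ∈ lowerHalf δ, Complex.exp (fm v z) = χ (sm v z))
    (hep : ∀ v, ∀ z ∈ upperHalf δ, Complex.exp (fp v z) = χ (sp v z))
    (hin : ∀ v, ∀ t : ℝ, 0 < t → t ≤ δ → fm v (-t) = fp v (-t))
    (hout : ∀ v, ∀ t : ℝ, 0 < t → t ≤ δ → sm v t = sp (a v) t) (v : V) :
    fm (a v) δ - fp (a (a v)) δ = -(fm v δ - fp (a v) δ) := by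
  have hlo : ∀ t : ℝ, t ≠ 0 → |t| ≤ δ → (t : ℂ) ∈ lowerHalf δ := fun t h0 ht =>
    ⟨by simpa using ht, by simp, by simpa using h0⟩
  have hup : ∀ t : ℝ, t ≠ 0 → |t| ≤ δ → (t : ℂ) ∈ upperHalf δ := fun t h0 ht =>
    ⟨by simpa using ht, by simp, by simpa using h0⟩
  have hn : ∀ t : ℝ, ‖Complex.exp (t * Complex.I)‖ = 1 := Complex.norm_exp_ofReal_mul_I
  -- Close to the puncture `χ` is constant along a turn, so each logarithm is constant on small
  -- half-circles and has the same value at both ends.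
  have key : ∀ v, ∃ ε, 0 < ε ∧ ∀ r, 0 < r → r ≤ ε → r ≤ δ → fm v (r : ℂ) = fm v (-r) ∧
      fp (a v) (r : ℂ) = fp (a v) (-r) := by
    intro v
    obtain ⟨ε, hε, hεδ, c, hc, hc'⟩ := hs.exists_const hφ hκ hχ v
    refine ⟨ε, hε, fun r hr hrε hrδ => ⟨?_, ?_⟩⟩
    · have hm : ∀ η : ℝ, r ≤ η → ∀ t ∈ Icc (-Real.pi) 0,
          (r : ℂ) * Complex.exp (t * Complex.I) ∈ lowerHalf η := by
        intro η hη t ht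
        refine ⟨?_, ?_, mul_ne_zero (by simpa using hr.ne') (Complex.exp_ne_zero _)⟩
        · rw [norm_mul, hn, mul_one, Complex.norm_real, Real.norm_of_nonneg hr.le]
          exact hη
        · rw [polar_im]
          exact mul_nonpos_of_nonneg_of_nonpos hr.le
            (Real.sin_nonpos_of_nonpos_of_neg_pi_le ht.2 ht.1)
      have hpi : -Real.pi ∈ Icc (-Real.pi) 0 := ⟨le_rfl, by linarith [Real.pi_pos]⟩
      have h0 : (0 : ℝ) ∈ Icc (-Real.pi) 0 := ⟨by linarith [Real.pi_pos], le_rfl⟩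
      have hcon := log_sub_log_const isPreconnected_Icc
        (f := fun t : ℝ => fm v (r * Complex.exp (t * Complex.I)))
        (g := fun _ => fm v (r * Complex.exp ((0 : ℝ) * Complex.I)))
        ((hfm v).comp (by fun_prop) (hm δ hrδ)) continuousOn_const
        (fun t ht => by
          rw [hem v _ (hm δ hrδ t ht), hem v _ (hm δ hrδ 0 h0), hc _ (hm ε hrε t ht),
            hc _ (hm ε hrε 0 h0)]) hpi h0
      have e : Complex.exp ((-Real.pi : ℝ) * Complex.I) = -1 := by
        push_cast
        rw [neg_mul, Complex.exp_neg, Complex.exp_pi_mul_I]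
        norm_num
      rw [sub_self, e] at hcon
      have := sub_eq_zero.mp hcon
      simp only [Complex.ofReal_zero, zero_mul, Complex.exp_zero, mul_one, mul_neg] at this
      exact this.symm
    · have hm : ∀ η : ℝ, r ≤ η → ∀ t ∈ Icc 0 Real.pi,
          (r : ℂ) * Complex.exp (t * Complex.I) ∈ upperHalf η := by
        intro η hη t ht
        refine ⟨?_, ?_, mul_ne_zero (by simpa using hr.ne') (Complex.exp_ne_zero _)⟩
        · rw [norm_mul, hn, mul_one, Complex.norm_real, Real.norm_of_nonneg hr.le]
          exact hη
        · rw [polar_im]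
          exact mul_nonneg hr.le (Real.sin_nonneg_of_nonneg_of_le_pi ht.1 ht.2)
      have hpi : Real.pi ∈ Icc 0 Real.pi := ⟨Real.pi_pos.le, le_rfl⟩
      have h0 : (0 : ℝ) ∈ Icc 0 Real.pi := ⟨le_rfl, Real.pi_pos.le⟩
      have hcon := log_sub_log_const isPreconnected_Icc
        (f := fun t : ℝ => fp (a v) (r * Complex.exp (t * Complex.I)))
        (g := fun _ => fp (a v) (r * Complex.exp ((0 : ℝ) * Complex.I)))
        ((hfp (a v)).comp (by fun_prop) (hm δ hrδ)) continuousOn_const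
        (fun t ht => by
          rw [hep _ _ (hm δ hrδ t ht), hep _ _ (hm δ hrδ 0 h0), hc' _ (hm ε hrε t ht),
            hc' _ (hm ε hrε 0 h0)]) hpi h0
      rw [sub_self, Complex.exp_pi_mul_I] at hcon
      have := sub_eq_zero.mp hcon
      simp only [Complex.ofReal_zero, zero_mul, Complex.exp_zero, mul_one, mul_neg] at this
      exact this.symm
  -- On the outer radius both logarithms belong to the same function, so their difference is
  -- constant and may be computed close to the puncture.
  have hconst : ∀ v, ∀ r, 0 < r → r ≤ δ →
      fm v (δ : ℂ) - fp (a v) (δ : ℂ) = fm v (r : ℂ) - fp (a v) (r : ℂ) := by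
    intro v r hr hrδ
    have hab : ∀ t ∈ Ioc 0 δ, |t| ≤ δ := fun t ht => by rw [abs_of_pos ht.1]; exact ht.2
    exact log_sub_log_const (isPreconnected_Ioc (a := (0 : ℝ)) (b := δ))
      (f := fun t : ℝ => fm v t) (g := fun t : ℝ => fp (a v) t)
      ((hfm v).comp Complex.continuous_ofReal.continuousOn fun t ht => hlo t ht.1.ne' (hab t ht))
      ((hfp _).comp Complex.continuous_ofReal.continuousOn fun t ht => hup t ht.1.ne' (hab t ht))
      (fun t ht => by
        rw [hem v _ (hlo t ht.1.ne' (hab t ht)), hep _ _ (hup t ht.1.ne' (hab t ht)),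
          hout v t ht.1 ht.2]) ⟨hκ.pos, le_rfl⟩ ⟨hr, hrδ⟩
  obtain ⟨ε₁, h₁, k₁⟩ := key v
  obtain ⟨ε₂, h₂, k₂⟩ := key (a v)
  set r := min (min ε₁ ε₂) δ with hr
  have hr0 : 0 < r := lt_min (lt_min h₁ h₂) hκ.pos
  have hrδ : r ≤ δ := min_le_right _ _
  have hr1 : r ≤ ε₁ := (min_le_left _ _).trans (min_le_left _ _)
  have hr2 : r ≤ ε₂ := (min_le_left _ _).trans (min_le_right _ _)
  obtain ⟨e1, e2⟩ := k₁ r hr0 hr1 hrδ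
  obtain ⟨e3, e4⟩ := k₂ r hr0 hr2 hrδ
  -- Moved to the inner radius, the mismatch becomes `fm v (-r) - fm (a v) (-r)`, which is visibly
  -- antisymmetric.
  rw [hconst v r hr0 hrδ, hconst (a v) r hr0 hrδ, e1, e2, e3, e4, ha, ← hin v r hr0 hrδ,
    ← hin (a v) r hr0 hrδ]
  ring

end Half

end Log

end ArcTwist

namespace ArcTwist

/-! ### The global logarithm and its boundary values -/

section Log

set_option linter.unusedSectionVars false

theorem exists_continuousOn_of_subtype {X Y : Type*} [TopologicalSpace X] [TopologicalSpace Y]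
    [Nonempty Y] {A : Set X} {g : ↥A → Y} (hg : Continuous g) :
    ∃ f : X → Y, ContinuousOn f A ∧ ∀ x : ↥A, f x = g x := by
  classical
  refine ⟨fun x => if h : x ∈ A then g ⟨x, h⟩ else Classical.arbitrary Y, ?_, fun x => by simp⟩
  rw [continuousOn_iff_continuous_domRestrict]
  refine hg.congr fun x => ?_
  simp

variable {n : ℕ} [NeZero n] {H : Disk ≃ₜ Disk} {F : Type*} [TopologicalSpace F] [CompactSpace F]
  [T2Space F] {V : Type*} {φ : C(F, Disk)} {s : Fin n → V → ℂ → F} {ρ : Fin n → V → V}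

namespace SectorSections

/-- Around a standard puncture the local monodromy is the involution `ρ j`, as seen in the
half-sections of the adjacent sectors; independence of the chart transfers this to any coordinate
disk at the same point. -/
theorem doublePeriodic (S : SectorSections φ H s ρ) (T : IsTreeAction ρ) (hn : 2 ≤ n)
    (hφ : IsBranchedAlong φ (punctures n H)) {κ : ℂ → Disk} {δ : ℝ}
    (hκ : PunctureChart (punctures n H) κ δ) : DoublePeriodic φ κ δ := by
  obtain ⟨j, hj⟩ := hκ.center
  obtain ⟨δ', -, hc, -, -, hs⟩ := S.exists_halfSections hn hφ (j - 1)
  refine (hs.doublePeriodic hφ hc (T.involutive _)).of_chart hφ hc hκ ?_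
  simp only [add_zero, rotChart_half, sub_add_cancel]
  exact hj

theorem mapsTo (S : SectorSections φ H s ρ) (hn : 2 ≤ n) (j : Fin n) (v : V) :
    MapsTo (s j v) (sector n) {x | φ x ∉ punctures n H} := fun z hz => by
  rw [mem_ofPred_eq, S.lift j v z hz]
  exact ((mem_sector_iff hn j hz.1).mp hz).2

/-- A nowhere vanishing function, constant near the points over the punctures, has a logarithm. -/
theorem exists_log [Finite V] (S : SectorSections φ H s ρ) (T : IsTreeAction ρ) (hn : 2 ≤ n)
    (hφ : IsBranchedAlong φ (punctures n H)) {χ : F → ℂ}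
    (hχ : ContinuousOn χ {x | φ x ∉ punctures n H}) (h0 : ∀ x, φ x ∉ punctures n H → χ x ≠ 0)
    (hloc : ∀ x, φ x ∈ punctures n H → LocallyConstantAt φ (punctures n H) χ x) :
    ∃ f : F → ℂ, ContinuousOn f {x | φ x ∉ punctures n H} ∧
      ∀ x, φ x ∉ punctures n H → Complex.exp (f x) = χ x := by
  have hz := zero_mem_sector hn
  have hlog : ∀ j v, ∃ f : ℂ → ℂ, ContinuousOn f (sector n) ∧ f 0 = Complex.log (χ (s 0 v 0)) ∧
      ∀ z ∈ sector n, Complex.exp (f z) = χ (s j v z) := fun j v =>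
    exists_log_of_starConvex (starConvex_sector hn) (ψ := fun z => χ (s j v z))
      (hχ.comp (S.cont j v) (S.mapsTo hn j v)) (fun z hz => h0 _ (S.mapsTo hn j v hz)) hz
      (by rw [Complex.exp_log (h0 _ (S.mapsTo hn 0 v hz)), S.zero j 0])
  choose f hf hf0 hfe using hlog
  have hside : ∀ (A : Set ℝ), IsPreconnected A → (∀ t ∈ A, 0 ≤ t ∧ t ≤ 1 ∧ t ≠ 1 / 2) →
      ∀ j v w, (∀ t ∈ A, s j v (root n * t) = s (j + 1) w t) → ∀ a ∈ A, ∀ b ∈ A,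
      f j v (root n * a) - f (j + 1) w a = f j v (root n * b) - f (j + 1) w b := by
    intro A hA hA1 j v w hs a ha b hb
    have hm : MapsTo (fun t : ℝ => (t : ℂ)) A (sector n) := fun t ht =>
      ofReal_mem_sector hn (hA1 t ht).1 (hA1 t ht).2.1 (hA1 t ht).2.2
    have hm' : MapsTo (fun t : ℝ => root n * (t : ℂ)) A (sector n) := fun t ht =>
      root_mul_mem_sector hn (hA1 t ht).1 (hA1 t ht).2.1 (hA1 t ht).2.2
    exact log_sub_log_const hA (f := fun t : ℝ => f j v (root n * t))
      (g := fun t : ℝ => f (j + 1) w t)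
      ((hf j v).comp (continuous_const.mul Complex.continuous_ofReal).continuousOn hm')
      ((hf _ _).comp Complex.continuous_ofReal.continuousOn hm)
      (fun t ht => by rw [hfe _ _ _ (hm' ht), hfe _ _ _ (hm ht), hs t ht]) ha hb
  have hin : ∀ j v, ∀ r : ℝ, 0 ≤ r → r < 1 / 2 → f j v (root n * r) = f (j + 1) v r := by
    intro j v r h h'
    have := hside (Ico 0 (1 / 2)) isPreconnected_Ico
      (fun t ht => ⟨ht.1, by linarith [ht.2], ht.2.ne⟩) j v v
      (fun t ht => S.side_inner hn hφ j v ht.1 ht.2) r ⟨h, h'⟩ 0 (by norm_num)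
    rw [Complex.ofReal_zero, mul_zero, hf0, hf0, sub_self] at this
    exact sub_eq_zero.mp this
  have hout : ∀ j v, ∀ r : ℝ, 1 / 2 < r → r ≤ 1 → f j v (root n * r) - f (j + 1) (ρ (j + 1) v) r =
      f j v (root n) - f (j + 1) (ρ (j + 1) v) 1 := by
    intro j v r h h'
    have := hside (Ioc (1 / 2) 1) isPreconnected_Ioc
      (fun t ht => ⟨by linarith [ht.1], ht.2, ht.1.ne'⟩) j v (ρ (j + 1) v)
      (fun t ht => S.side_outer hn hφ j v ht.1 ht.2) r ⟨h, h'⟩ 1 (by norm_num)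
    simpa using this
  -- The logarithms are normalized at the center, so they agree below the punctures; `d j` is their
  -- jump across the outer part of the ray `j`, always a multiple of `2πi`. A potential for `d`
  -- corrects the logarithms.
  set d : Fin n → V → ℂ := fun j v => f (j - 1) v (root n) - f j (ρ j v) 1 with hd
  have hdr : ∀ j v, ∀ r : ℝ, 1 / 2 < r → r ≤ 1 →
      f j v (root n * r) - f (j + 1) (ρ (j + 1) v) r = d (j + 1) v := by
    intro j v r h h'
    rw [hout j v r h h', hd]
    simp only [add_sub_cancel_right]
  have hanti : ∀ j v, d (j + 1) (ρ (j + 1) v) = -d (j + 1) v := by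
    intro j v
    obtain ⟨δ, hδ, hc, hlo, hup, hs⟩ := S.exists_halfSections hn hφ j
    have hpos := hc.pos
    have e : (1 / 2 + (δ : ℂ)) = ((1 / 2 + δ : ℝ) : ℂ) := by
      push_cast
      ring
    have e' : ∀ t : ℝ, (1 / 2 + -(t : ℂ)) = ((1 / 2 - t : ℝ) : ℂ) := fun t => by
      push_cast
      ring
    have e'' : ∀ t : ℝ, (1 / 2 + (t : ℂ)) = ((1 / 2 + t : ℝ) : ℂ) := fun t => by
      push_cast
      ring
    have := hs.log_antisymm hφ hc (T.involutive _) (χ := χ)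
      (fun x hx => hloc x (by rw [hx]; exact hc.center))
      (fm := fun v z => f j v (root n * (1 / 2 + z))) (fp := fun v z => f (j + 1) v (1 / 2 + z))
      (fun v => (hf j v).comp (by fun_prop) hlo) (fun v => (hf _ v).comp (by fun_prop) hup)
      (fun v z hz => hfe j v _ (hlo z hz)) (fun v z hz => hfe _ v _ (hup z hz))
      (fun v t h0 ht => by
        rw [e']
        exact hin j v _ (by linarith) (by linarith))
      (fun v t h0 ht => by
        rw [e'']
        exact S.side_outer hn hφ j v (by linarith) (by linarith)) v
    rw [e'', hdr j v _ (by linarith) (by linarith), hdr j (ρ (j + 1) v) _ (by linarith)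
      (by linarith)] at this
    exact this
  obtain ⟨k, hk⟩ := T.potential d fun j v => by
    have := hanti (j - 1) v
    rwa [sub_add_cancel] at this
  have hr1 : (1 : ℂ) ∈ sector n := by
    simpa using ofReal_mem_sector hn (t := 1) zero_le_one le_rfl (by norm_num)
  have hr2 : root n ∈ sector n := by
    simpa using root_mul_mem_sector hn (t := 1) zero_le_one le_rfl (by norm_num)
  have hd1 : ∀ j v, Complex.exp (d j v) = 1 := by
    intro j v
    have h1 := S.outer (j - 1) v
    rw [sub_add_cancel] at h1
    rw [hd]
    simp only
    rw [Complex.exp_sub, hfe _ _ _ hr2, hfe _ _ _ hr1, h1,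
      div_self (h0 _ (S.mapsTo hn _ _ hr1))]
  -- Since the jumps are multiples of `2πi`, the function `exp ∘ k` is invariant under all `ρ j`,
  -- hence constant. After subtracting `k₀` the correction no longer affects exponentials.
  obtain ⟨k₀, hk₀⟩ : ∃ k₀, ∀ v, Complex.exp (k v - k₀) = 1 := by
    rcases isEmpty_or_nonempty V with hV | ⟨⟨o⟩⟩
    · exact ⟨0, fun v => hV.elim v⟩
    · refine ⟨k o, fun v => ?_⟩
      rw [Complex.exp_sub, div_eq_one_iff_eq (Complex.exp_ne_zero _)]
      refine T.invariant (fun v => Complex.exp (k v)) (fun j v => ?_) v o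
      have h1 := hd1 j v
      rwa [hk, Complex.exp_sub, div_eq_one_iff_eq (Complex.exp_ne_zero _)] at h1
  obtain ⟨g, hg, hgf⟩ := S.exists_glue hn hφ (t := fun j v z => f j v z + (k v - k₀))
    (fun j v => (hf j v).add continuousOn_const) (fun i j v => by simp only [hf0])
    (fun j v r h h' => by simp only [hin j v r h h'])
    (fun j v r h h' => by
      have h1 := hdr j v r h h'
      rw [hk] at h1
      linear_combination h1)
  obtain ⟨G, hG, hGg⟩ := exists_continuousOn_of_subtype hg
  refine ⟨G, hG, fun x hx => ?_⟩
  obtain ⟨j, v, z, hz, e⟩ := S.cover hn hφ hx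
  rw [hGg ⟨x, hx⟩, hgf ⟨x, hx⟩ j v z hz e, Complex.exp_add, hk₀, mul_one, hfe j v z hz, e]

/-- A function whose exponential is `1` over the boundary circle is constant there. -/
theorem eq_on_boundary [Finite V] (S : SectorSections φ H s ρ) (T : IsTreeAction ρ) (hn : 2 ≤ n)
    (hφ : IsBranchedAlong φ (punctures n H)) {f : F → ℂ}
    (hf : ContinuousOn f {x | φ x ∉ punctures n H})
    (h1 : ∀ x, ‖(φ x : ℂ)‖ = 1 → Complex.exp (f x) = 1) {x y : F} (hx : ‖(φ x : ℂ)‖ = 1)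
    (hy : ‖(φ y : ℂ)‖ = 1) : f x = f y := by
  have hn1 : ∀ t : ℝ, ‖Complex.exp (t * Complex.I)‖ = 1 := Complex.norm_exp_ofReal_mul_I
  have ha := (angle_pos hn).1
  have hm : MapsTo (fun t : ℝ => Complex.exp (t * Complex.I)) (Icc 0 (2 * Real.pi / n))
      (sector n) := fun t ht => by
    have := polar_mem_sector hn zero_le_one le_rfl ht.1 ht.2 (fun _ => by norm_num)
      fun _ => by norm_num
    simpa using this
  have hrot : ∀ (j : Fin n) (z : ℂ), ‖z‖ = 1 → ‖(rotChart n H j z : ℂ)‖ = 1 := fun j z hz => by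
    refine norm_homeomorph_eq_one H ?_
    rw [coe_pr (by rw [norm_rot, hz]), norm_rot, hz]
  have harc : ∀ j v, ∀ t ∈ Icc 0 (2 * Real.pi / n),
      f (s j v (Complex.exp (t * Complex.I))) = f (s j v 1) := by
    intro j v t ht
    have := log_sub_log_const isPreconnected_Icc
      (f := fun t : ℝ => f (s j v (Complex.exp (t * Complex.I)))) (g := fun _ => (0 : ℂ))
      (hf.comp ((S.cont j v).comp (by fun_prop) hm) fun t ht => S.mapsTo hn j v (hm ht))
      continuousOn_const (fun t ht => by
        rw [Complex.exp_zero, h1]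
        rw [S.lift j v _ (hm ht)]
        exact hrot j _ (hn1 t)) ht (left_mem_Icc.mpr ha.le)
    simpa using this
  -- Along the outer arc of a sector `f` is constant, and at its end the next sector continues with
  -- index `ρ (j + 1) v`: this is the cyclic relation of `eq_of_cyclic`.
  have hcyc : ∀ j v, f (s j v 1) = f (s (j + 1) (ρ (j + 1) v) 1) := by
    intro j v
    rw [← S.outer, ← harc j v _ (right_mem_Icc.mpr ha.le)]
    rfl
  have hP : ∀ x, ‖(φ x : ℂ)‖ = 1 → φ x ∉ punctures n H := by
    rintro x hx ⟨m, hm⟩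
    have h2 := norm_homeomorph_eq_one H.symm hx
    rw [← hm, H.symm_apply_apply, coe_stdPoint, norm_rot] at h2
    norm_num at h2
  have hall : ∀ x, ‖(φ x : ℂ)‖ = 1 → ∃ j v, f x = f (s j v 1) := by
    intro x hx
    obtain ⟨j, v, z, hz, rfl⟩ := S.cover hn hφ (hP x hx)
    refine ⟨j, v, ?_⟩
    have hz1 : ‖z‖ = 1 := by
      rw [S.lift j v z hz, rotChart] at hx
      have h2 := norm_homeomorph_eq_one H.symm hx
      rwa [H.symm_apply_apply, coe_pr (by rw [norm_rot]; exact hz.1), norm_rot] at h2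
    obtain ⟨t, ht0, ht1, ht⟩ := exists_polar_of_mem_wedge hn hz.2.1
    rw [hz1, Complex.ofReal_one, one_mul] at ht
    rw [ht]
    exact harc j v t ⟨ht0, ht1⟩
  obtain ⟨i, v, e⟩ := hall x hx
  obtain ⟨j, w, e'⟩ := hall y hy
  rw [e, e']
  exact T.eq_of_cyclic hcyc i j v w

end SectorSections

end Log

end ArcTwist

namespace ArcTwist

/-! ### No component of the preimage is a circle -/

section NoCycle

set_option linter.unusedSectionVars false

namespace ArcSections

variable {F : Type*} [TopologicalSpace F] {V : Type*} {φ : C(F, Disk)} {P : Set Disk} {κ : ℂ → Disk}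
  {sm sp : V → ℂ → F} {a b : V → V}

theorem eq_of_preconnected (S : ArcSections φ κ sm sp a b) (hφ : IsBranchedAlong φ P)
    (hκ : TwoPunctured P κ) {A : Set ℝ} (hA : IsPreconnected A)
    (hA1 : ∀ t ∈ A, |t| ≤ 1 ∧ t ≠ 1 / 2 ∧ t ≠ -(1 / 2)) {t₀ t : ℝ} (ht₀ : t₀ ∈ A) (ht : t ∈ A)
    {v w : V} (h : sm v (t₀ : ℂ) = sp w t₀) : sm v (t : ℂ) = sp w t := by
  have hl : ∀ t ∈ A, (t : ℂ) ∈ lowerDisk := fun t ht =>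
    ofReal_mem_lowerDisk (hA1 t ht).1 (hA1 t ht).2.1 (hA1 t ht).2.2
  have hu : ∀ t ∈ A, (t : ℂ) ∈ upperDisk := fun t ht =>
    ofReal_mem_upperDisk (hA1 t ht).1 (hA1 t ht).2.1 (hA1 t ht).2.2
  refine eqOn_of_lifts_disk hφ hκ (A := (fun t : ℝ => (t : ℂ)) '' A)
    (hA.image _ Complex.continuous_ofReal.continuousOn) ?_ ((S.contLower v).mono ?_)
    ((S.contUpper w).mono ?_) ?_ ?_ ⟨t₀, ht₀, rfl⟩ h ⟨t, ht, rfl⟩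
  all_goals rintro _ ⟨r, hr, rfl⟩
  exacts [lowerDisk_bounds (hl r hr), hl r hr, hu r hr, S.liftLower v _ (hl r hr),
    S.liftUpper w _ (hu r hr)]

theorem eq_mid (S : ArcSections φ κ sm sp a b) (hφ : IsBranchedAlong φ P) (hκ : TwoPunctured P κ)
    (v : V) {t : ℝ} (h1 : -(1 / 2) < t) (h2 : t < 1 / 2) : sm v (t : ℂ) = sp v t :=
  S.eq_of_preconnected hφ hκ (A := Ioo (-(1 / 2)) (1 / 2)) isPreconnected_Ioo
    (fun s hs => ⟨abs_le.mpr ⟨by linarith [hs.1], by linarith [hs.2]⟩, hs.2.ne, hs.1.ne'⟩)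
    (t₀ := 0) (by norm_num) ⟨h1, h2⟩ (by simpa using S.zero v)

theorem eq_right (S : ArcSections φ κ sm sp a b) (hφ : IsBranchedAlong φ P) (hκ : TwoPunctured P κ)
    (v : V) {t : ℝ} (h1 : 1 / 2 < t) (h2 : t ≤ 1) : sm v (t : ℂ) = sp (a v) t :=
  S.eq_of_preconnected hφ hκ (A := Ioc (1 / 2) 1) isPreconnected_Ioc
    (fun s hs => ⟨abs_le.mpr ⟨by linarith [hs.1], hs.2⟩, hs.1.ne', by linarith [hs.1]⟩)
    (t₀ := 1) (by norm_num) ⟨h1, h2⟩ (by simpa using S.right v)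

theorem eq_left (S : ArcSections φ κ sm sp a b) (hφ : IsBranchedAlong φ P) (hκ : TwoPunctured P κ)
    (v : V) {t : ℝ} (h1 : -1 ≤ t) (h2 : t < -(1 / 2)) : sm (b v) (t : ℂ) = sp v t :=
  S.eq_of_preconnected hφ hκ (A := Ico (-1) (-(1 / 2))) isPreconnected_Ico
    (fun s hs => ⟨abs_le.mpr ⟨hs.1, by linarith [hs.2]⟩, by linarith [hs.2], hs.2.ne⟩)
    (t₀ := -1) (by norm_num) ⟨h1, h2⟩ (by simpa using (S.left v).symm)

end ArcSections

variable {F : Type*} [TopologicalSpace F] [CompactSpace F] [T2Space F] {φ : C(F, Disk)}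
  {τ : Disk ≃ₜ Disk} {h : Disk → Disk}

/-- A function on the total space that is locally constant outside of the neighborhood of the arc,
and constant over the boundary, is constant over the boundary of the neighborhood. -/
theorem ArcChart.eq_const {P : Set Disk} (D : ArcChart P τ h) (hφ : IsBranchedAlong φ P) {f : F → ℂ}
    (hf : ContinuousOn f {x | φ x ∉ P})
    (h1 : ∀ x, φ x ∉ P → φ x ∉ range h → Complex.exp (f x) = 1)
    (h2 : ∀ x z, ‖z‖ = 1 → φ x = h (pr z) → Complex.exp (f x) = 1) {C : ℂ}
    (hC : ∀ x, ‖(φ x : ℂ)‖ = 1 → f x = C) {x : F} {z : ℂ} (hz : ‖z‖ = 1) (hx : φ x = h (pr z)) :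
    f x = C := by
  have hopen : IsOpen {x | φ x ∉ P} := D.finite.isClosed.isOpen_compl.preimage φ.continuous
  have hout : ∀ x, φ x ∉ P → φ x ∉ range h → f x = C := by
    intro x hxP hxr
    obtain ⟨y, hy, γ, hγ⟩ := D.joinedIn_boundary D.finite hxr hxP
    have hγP : ∀ t, γ t ∈ Pᶜ := fun t ht => hγ t (Or.inr ht)
    obtain ⟨L, hL0, hL⟩ := exists_lift_path hφ.covering (γ := γ.toContinuousMap) hγP
      (x := x) γ.source.symm
    have hL' : ∀ t, φ (L t) = γ t := hL
    have := log_sub_log_const (isPreconnected_univ (α := I)) (f := fun t => f (L t))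
      (g := fun _ => (0 : ℂ))
      (hf.comp L.continuous.continuousOn fun t _ => by
        rw [mem_ofPred_eq, hL']
        exact hγP t) continuousOn_const (fun t _ => by
        rw [Complex.exp_zero, h1 (L t) (by rw [hL']; exact hγP t)
          (by rw [hL']; exact fun ht => hγ t (Or.inl ht))]) (mem_univ 0) (mem_univ 1)
    simp only [sub_zero, hL0] at this
    rw [this]
    exact hC _ (by rw [hL', γ.target, hy])
  obtain ⟨c, hc, hcc⟩ := D.exists_mem_closure
  have hcl : ∀ x, φ x = h c → f x = C := by
    intro x hx
    have hxP : φ x ∉ P := by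
      rw [hx, ← pr_coe c]
      exact D.notMem_of_norm_eq_one hc
    by_contra hne
    have hev : ∀ᶠ y in 𝓝 x, f y ≠ C ∧ φ y ∉ P :=
      ((hf.continuousAt (hopen.mem_nhds hxP)).eventually_ne hne).and (hopen.mem_nhds hxP)
    have hm : φ '' {y | f y ≠ C ∧ φ y ∉ P} ∈ 𝓝 (φ x) := by
      rw [← hφ.map_nhds hxP]
      exact image_mem_map hev
    rw [hx] at hm
    obtain ⟨_, ⟨y, hy, rfl⟩, hyr⟩ := mem_closure_iff_nhds.mp hcc _ hm
    exact hy.1 (hout y hy.2 hyr)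
  have hn : ∀ t : ℝ, ‖Complex.exp (t * Complex.I)‖ = 1 := Complex.norm_exp_ofReal_mul_I
  have harg : ∀ z : ℂ, ‖z‖ = 1 → Complex.exp (z.arg * Complex.I) = z := by
    intro z hz
    have := Complex.norm_mul_exp_arg_mul_I z
    rwa [hz, Complex.ofReal_one, one_mul] at this
  obtain ⟨L, hL, hLx, hLφ⟩ := exists_lift_of_convex (A := (univ : Set ℝ)) hφ.covering convex_univ
    (ψ := fun t : ℝ => h (pr (Complex.exp (t * Complex.I))))
    (D.continuous_chart.comp
      (by fun_prop : Continuous fun t : ℝ => Complex.exp (t * Complex.I))).continuousOn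
    (fun t _ => D.notMem_of_norm_eq_one (hn t)) (mem_univ z.arg) (x := x) (by
      rw [harg z hz, hx])
  have := log_sub_log_const (isPreconnected_univ (α := ℝ)) (f := fun t => f (L t))
    (g := fun _ => (0 : ℂ))
    (hf.comp hL fun t _ => by
      rw [mem_ofPred_eq, hLφ t (mem_univ t)]
      exact D.notMem_of_norm_eq_one (hn t)) continuousOn_const (fun t _ => by
      rw [Complex.exp_zero, h2 (L t) _ (hn t) (hLφ t (mem_univ t))])
    (mem_univ z.arg) (mem_univ (c : ℂ).arg)
  simp only [sub_zero, hLx] at this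
  rw [this]
  exact hcl _ (by rw [hLφ _ (mem_univ _), harg c hc, pr_coe])

/-- The radial function that is `1/2` near the arc and vanishes on the unit circle. -/
noncomputable def bump (z : ℂ) : ℝ := min (1 / 2) (2 * (1 - ‖z‖))

theorem continuous_bump : Continuous bump := by
  unfold bump
  fun_prop

theorem bump_of_norm_eq_one {z : ℂ} (hz : ‖z‖ = 1) : bump z = 0 := by
  simp [bump, hz]

theorem bump_of_norm_le {z : ℂ} (hz : ‖z‖ ≤ 3 / 4) : bump z = 1 / 2 :=
  min_eq_left (by linarith)

theorem exp_int_bump (m : ℤ) {z : ℂ} (hz : ‖z‖ ≤ 3 / 4) :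
    Complex.exp (2 * Real.pi * Complex.I * m * bump z) ^ 2 = 1 ∧
      Complex.exp (-(2 * Real.pi * Complex.I * m * bump z)) =
        Complex.exp (2 * Real.pi * Complex.I * m * bump z) := by
  rw [bump_of_norm_le hz]
  have h1 : Complex.exp (2 * Real.pi * Complex.I * m * ((1 / 2 : ℝ) : ℂ)) ^ 2 = 1 := by
    rw [← Complex.exp_nat_mul, Complex.exp_eq_one_iff]
    refine ⟨m, ?_⟩
    push_cast
    ring
  refine ⟨h1, ?_⟩
  rw [Complex.exp_neg, inv_eq_iff_eq_inv]
  exact eq_inv_of_mul_eq_one_left (by rw [← sq, h1])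

variable {n : ℕ} [NeZero n] {H : Disk ≃ₜ Disk} {V W : Type*} [Finite V] [Finite W]
  {s : Fin n → W → ℂ → F} {ρ : Fin n → W → W} {sm sp : V → ℂ → F} {a b : V → V}

/-- An alternating function on the fibre over the midpoint of the arc vanishes. -/
theorem ArcChart.alternating_eq_zero (D : ArcChart (punctures n H) τ h) (hn : 2 ≤ n)
    (hφ : IsBranchedAlong φ (punctures n H)) (SS : SectorSections φ H s ρ) (T : IsTreeAction ρ)
    (S : ArcSections φ (fun z => h (pr z)) sm sp a b) {ε : V → ℤ} (hεa : ∀ v, ε (a v) = -ε v)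
    (hεb : ∀ v, ε (b v) = -ε v) (v : V) : ε v = 0 := by
  have hκ := D.twoPunctured
  -- `e m` is `0` on the circle and `πim` on the plateau of the bump. The function is `exp e` below
  -- and `exp (-e)` above: across the arc they match because `exp (πim) = ±1`, beyond the punctures
  -- because `ε` changes sign under `a` and `b`, and on the circle both are `1`.
  set e : ℤ → ℂ → ℂ := fun m z => 2 * Real.pi * Complex.I * m * bump z with he
  have hec : ∀ m, Continuous (e m) := fun m => by
    have := continuous_bump
    simp only [he]
    fun_prop
  have he1 : ∀ m z, ‖z‖ = 1 → e m z = 0 := fun m z hz => by simp [he, bump_of_norm_eq_one hz]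
  have hen : ∀ m z, e (-m) z = -e m z := fun m z => by
    simp only [he]
    push_cast
    ring
  obtain ⟨g, hg, hgout, hgm, hgp⟩ := D.exists_glue hφ S (Y := ℂ)
    (um := fun v z => Complex.exp (e (ε v) z)) (up := fun v z => Complex.exp (-e (ε v) z))
    (u := fun _ => 1)
    (fun v => (Complex.continuous_exp.comp (hec _)).continuousOn)
    (fun v => (Complex.continuous_exp.comp (hec _).neg).continuousOn) continuous_const
    (fun v z _ hz => by rw [he1 _ z hz, Complex.exp_zero])
    (fun v z _ hz => by rw [he1 _ z hz, neg_zero, Complex.exp_zero]) (by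
      intro v w z hl hu hvw
      obtain ⟨t, rfl⟩ : ∃ t : ℝ, (t : ℂ) = z :=
        ⟨z.re, Complex.ext (by simp) (by simpa using le_antisymm hu.2.1 hl.2.1)⟩
      have ht : |t| ≤ 1 := by simpa using hl.1
      have ht1 : t ≠ 1 / 2 := fun h => hl.2.2.1 (by rw [h]; push_cast; rfl)
      have ht2 : t ≠ -(1 / 2) := fun h => hl.2.2.2 (by rw [h]; push_cast; rfl)
      rw [abs_le] at ht
      rcases lt_or_gt_of_ne ht1 with h1 | h1
      · rcases lt_or_gt_of_ne ht2 with h2 | h2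
        · rw [← S.eq_left hφ hκ w ht.1 h2] at hvw
          rw [S.inj_lower hφ hκ hl hvw, hεb, hen]
        · rw [S.eq_mid hφ hκ v h2 h1] at hvw
          rw [S.inj_upper hφ hκ hu hvw]
          refine ((exp_int_bump (ε w) ?_).2).symm
          rw [Complex.norm_real, Real.norm_eq_abs, abs_le]
          constructor <;> linarith
      · rw [S.eq_right hφ hκ v h1 ht.2] at hvw
        rw [← S.inj_upper hφ hκ hu hvw, hεa, hen, neg_neg])
  obtain ⟨χ, hχ, hχg⟩ := exists_continuousOn_of_subtype hg
  have hχout : ∀ x, φ x ∉ punctures n H → φ x ∈ closure (range h)ᶜ → χ x = 1 := fun x hx hx' => by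
    rw [hχg ⟨x, hx⟩, hgout ⟨x, hx⟩ hx']
  have hχm : ∀ v, ∀ z ∈ lowerDisk, χ (sm v z) = Complex.exp (e (ε v) z) := fun v z hz => by
    have hx : φ (sm v z) ∉ punctures n H := by
      rw [S.liftLower v z hz]
      exact hκ.mapsTo_lower hz
    rw [hχg ⟨_, hx⟩, hgm ⟨_, hx⟩ v z hz rfl]
  have hχp : ∀ v, ∀ z ∈ upperDisk, χ (sp v z) = Complex.exp (-e (ε v) z) := fun v z hz => by
    have hx : φ (sp v z) ∉ punctures n H := by
      rw [S.liftUpper v z hz]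
      exact hκ.mapsTo_upper hz
    rw [hχg ⟨_, hx⟩, hgp ⟨_, hx⟩ v z hz rfl]
  have hχ0 : ∀ x, φ x ∉ punctures n H → χ x ≠ 0 := by
    intro x hx
    rcases D.cover hφ S hx with hx' | ⟨v, z, hz, rfl⟩ | ⟨v, z, hz, rfl⟩
    · rw [hχout x hx hx']
      exact one_ne_zero
    · rw [hχm v z hz]
      exact Complex.exp_ne_zero _
    · rw [hχp v z hz]
      exact Complex.exp_ne_zero _
  have hloc : ∀ x, φ x ∈ punctures n H → LocallyConstantAt φ (punctures n H) χ x := by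
    intro x hx
    by_cases hr : φ x ∈ range h
    · obtain ⟨w, hw⟩ := hr
      have hw2 : ‖(w : ℂ)‖ = 1 / 2 := by
        rw [← hw, ← pr_coe w] at hx
        rcases (D.mem_iff _ (norm_coe_le w)).mp hx with h | h <;> simp [h]
      have hnh : h '' {w : Disk | ‖(w : ℂ)‖ < 3 / 4} ∈ 𝓝 (φ x) := by
        rw [← hw]
        refine D.image_mem_nhds (by rw [hw2]; norm_num) (IsOpen.mem_nhds ?_ ?_)
        · exact isOpen_lt (by fun_prop) continuous_const
        · rw [mem_ofPred_eq, hw2]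
          norm_num
      have hO : φ ⁻¹' (h '' {w : Disk | ‖(w : ℂ)‖ < 3 / 4} ∩ (punctures n H \ {φ x})ᶜ) ∈ 𝓝 x :=
        φ.continuous.continuousAt (inter_mem hnh
          ((D.finite.subset sdiff_subset).isClosed.isOpen_compl.mem_nhds (by simp)))
      obtain ⟨U, hUO, hUo, hxU, hU, hUx⟩ := hφ.punctured x hx _ hO
      have hUP : ∀ y ∈ U \ {x}, φ y ∉ punctures n H := fun y hy hyP =>
        (hUO hy.1).2 ⟨hyP, fun e => hy.2 (hUx y hy.1 e)⟩
      -- The plateau `‖z‖ ≤ 3/4` contains both punctures, and `χ = ±1` over it; a connected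
      -- punctured neighborhood allows only one sign.
      have hsq : EqOn (χ ^ 2) 1 (U \ {x}) := by
        intro y hy
        simp only [Pi.pow_apply, Pi.one_apply]
        obtain ⟨u, hu, huy⟩ := (hUO hy.1).1
        have hnz : ∀ z : ℂ, ‖z‖ ≤ 1 → φ y = h (pr z) → ‖z‖ ≤ 3 / 4 := by
          intro z hz e
          rw [← huy, ← pr_coe u] at e
          rw [← D.chart_injOn (norm_coe_le u) hz e]
          exact (show ‖(u : ℂ)‖ < 3 / 4 from hu).le
        rcases D.cover hφ S (hUP y hy) with hy' | ⟨v, z, hz, rfl⟩ | ⟨v, z, hz, rfl⟩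
        · rw [hχout y (hUP y hy) hy', one_pow]
        · rw [hχm v z hz]
          exact (exp_int_bump _ (hnz z hz.1 (S.liftLower v z hz))).1
        · have := exp_int_bump (ε v) (hnz z hz.1 (S.liftUpper v z hz))
          rw [hχp v z hz]
          simp only [he]
          rw [this.2]
          exact this.1
      have hyx : ∀ y ∈ U, φ y ∉ punctures n H → y ∈ U \ {x} := fun y hy hyP =>
        ⟨hy, fun e => hyP ((show y = x from e) ▸ hx)⟩
      rcases hU.isConnected.isPreconnected.eq_one_or_eq_neg_one_of_sq_eq
        (hχ.mono fun y hy => hUP y hy) hsq with h' | h'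
      · exact ⟨U, hUo.mem_nhds hxU, 1, fun y hy hyP => h' (hyx y hy hyP)⟩
      · exact ⟨U, hUo.mem_nhds hxU, -1, fun y hy hyP => h' (hyx y hy hyP)⟩
    · refine ⟨φ ⁻¹' (range h)ᶜ,
        φ.continuous.continuousAt (D.isClosed_range.isOpen_compl.mem_nhds hr), 1, fun y hy hyP => ?_⟩
      exact hχout y hyP (subset_closure hy)
  obtain ⟨f, hf, hfe⟩ := SS.exists_log T hn hφ hχ hχ0 hloc
  have hbr : ∀ x, ‖(φ x : ℂ)‖ = 1 → φ x ∉ punctures n H ∧ φ x ∉ range h := fun x hx =>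
    ⟨fun hP => (D.interior _ hP).ne hx, fun ⟨w, hw⟩ => (D.norm_lt w).ne (by rw [hw]; exact hx)⟩
  obtain ⟨C, hC⟩ : ∃ C, ∀ x, ‖(φ x : ℂ)‖ = 1 → f x = C := by
    by_cases hne : ∃ y, ‖(φ y : ℂ)‖ = 1
    · obtain ⟨y, hy⟩ := hne
      refine ⟨f y, fun x hx => SS.eq_on_boundary T hn hφ hf (fun z hz => ?_) hx hy⟩
      rw [hfe z (hbr z hz).1, hχout z (hbr z hz).1 (subset_closure (hbr z hz).2)]
    · exact ⟨0, fun x hx => (hne ⟨x, hx⟩).elim⟩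
  have hcirc : ∀ x z, ‖z‖ = 1 → φ x = h (pr z) → f x = C := by
    intro x z hz hx
    refine D.eq_const hφ hf (fun x hx hxr => ?_) (fun x z hz hx => ?_) hC hz hx
    · rw [hfe x hx, hχout x hx (subset_closure hxr)]
    · have hxP : φ x ∉ punctures n H := by
        rw [hx]
        exact D.notMem_of_norm_eq_one hz
      rw [hfe x hxP]
      rcases D.cover hφ S hxP with hx' | ⟨v, w, hw, rfl⟩ | ⟨v, w, hw, rfl⟩
      · exact hχout x hxP hx'
      · rw [S.liftLower v w hw] at hx
        rw [hχm v w hw, he1 _ w (by rw [D.chart_injOn hw.1 hz.le hx, hz]), Complex.exp_zero]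
      · rw [S.liftUpper v w hw] at hx
        rw [hχp v w hw, he1 _ w (by rw [D.chart_injOn hw.1 hz.le hx, hz]), neg_zero,
          Complex.exp_zero]
  have hml : MapsTo (sm v) lowerDisk {x | φ x ∉ punctures n H} := fun z hz => by
    rw [mem_ofPred_eq, S.liftLower v z hz]
    exact hκ.mapsTo_lower hz
  have hmu : MapsTo (sp v) upperDisk {x | φ x ∉ punctures n H} := fun z hz => by
    rw [mem_ofPred_eq, S.liftUpper v z hz]
    exact hκ.mapsTo_upper hz
  -- From `-i` up to `0` the logarithm `f` changes from `C` by `πi ε v`; computed from `i` down to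
  -- `0` it changes from the same `C` by `-πi ε v`. Both give the value of `f` at the same point, so
  -- `ε v = 0`.
  have k1 := log_sub_log_const isPreconnected_lowerDisk (hf.comp (S.contLower v) hml)
    (hec (ε v)).continuousOn (fun z hz => by rw [Function.comp_apply, hfe _ (hml hz), hχm v z hz])
    negI_mem_lowerDisk zero_mem_lowerDisk
  have k2 := log_sub_log_const isPreconnected_upperDisk (hf.comp (S.contUpper v) hmu)
    (g := fun z => -e (ε v) z) (hec (ε v)).neg.continuousOn
    (fun z hz => by rw [Function.comp_apply, hfe _ (hmu hz), hχp v z hz])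
    I_mem_upperDisk zero_mem_upperDisk
  simp only [Function.comp_apply] at k1 k2
  rw [hcirc _ _ (by simp) (S.liftLower v _ negI_mem_lowerDisk), he1 _ _ (by simp)] at k1
  rw [hcirc _ _ (by simp) (S.liftUpper v _ I_mem_upperDisk), he1 _ _ (by simp), ← S.zero] at k2
  have k3 : e (ε v) 0 = 0 := by linear_combination (k1 - k2) / 2
  simp only [he, bump_of_norm_le (show ‖(0 : ℂ)‖ ≤ 3 / 4 by norm_num)] at k3
  simpa [Real.pi_ne_zero, Complex.I_ne_zero] using k3

end NoCycle

end ArcTwist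

namespace ArcTwist

/-! ### Components of the preimage of the arc -/

section Components

set_option linter.unusedSectionVars false

variable {F : Type*} [TopologicalSpace F] [CompactSpace F] [T2Space F] {V : Type*} {φ : C(F, Disk)}
  {P α : Set Disk} {τ : Disk ≃ₜ Disk} {h : Disk → Disk} {sm sp : V → ℂ → F} {a b : V → V}

/-- The lift of the open segment between the punctures by the section with index `v`. -/
def openArc (sm : V → ℂ → F) (v : V) : Set F := (fun t : ℝ => sm v t) '' Ioo (-(1 / 2)) (1 / 2)

theorem abs_le_one_of_mem {t : ℝ} (ht : t ∈ Icc (-(1 / 2) : ℝ) (1 / 2)) : ‖(t : ℂ)‖ ≤ 1 := by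
  rw [Complex.norm_real, Real.norm_eq_abs, abs_le]
  constructor <;> linarith [ht.1, ht.2]

theorem mem_lowerDisk_of_mem_Ioo {t : ℝ} (ht : t ∈ Ioo (-(1 / 2) : ℝ) (1 / 2)) :
    (t : ℂ) ∈ lowerDisk :=
  ofReal_mem_lowerDisk (abs_le.mpr ⟨by linarith [ht.1], by linarith [ht.2]⟩) ht.2.ne ht.1.ne'

namespace ArcSections

variable (S : ArcSections φ (fun z => h (pr z)) sm sp a b)
include S

theorem continuousOn_arc (v : V) :
    ContinuousOn (fun t : ℝ => sm v t) (Ioo (-(1 / 2)) (1 / 2)) :=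
  (S.contLower v).comp Complex.continuous_ofReal.continuousOn fun _ => mem_lowerDisk_of_mem_Ioo

theorem isPreconnected_openArc (v : V) : IsPreconnected (openArc sm v) :=
  isPreconnected_Ioo.image _ (S.continuousOn_arc v)

theorem exists_mem_Icc_of_mem_closure (D : ArcChart P τ h) {T : Set ℝ} {lo hi : ℝ}
    (hT : T ⊆ Icc lo hi) (hT' : T ⊆ Ioo (-(1 / 2)) (1 / 2)) {v : V} {x : F}
    (hx : x ∈ closure ((fun t : ℝ => sm v t) '' T)) : ∃ t ∈ Icc lo hi, φ x = h (pr (t : ℝ)) := by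
  have hc : IsClosed (φ ⁻¹' ((fun t : ℝ => h (pr t)) '' Icc lo hi)) :=
    (isCompact_Icc.image (D.continuous_chart.comp Complex.continuous_ofReal)).isClosed.preimage
      φ.continuous
  have : closure ((fun t : ℝ => sm v t) '' T) ⊆ _ := hc.closure_subset_iff.mpr (by
    rintro _ ⟨t, ht, rfl⟩
    exact ⟨t, hT ht, (S.liftLower v _ (mem_lowerDisk_of_mem_Ioo (hT' ht))).symm⟩)
  obtain ⟨t, ht, e⟩ := this hx
  exact ⟨t, ht, e.symm⟩

/-- Closing up a lift of the open arc adds nothing over interior points: the part over a compact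
segment around `t` is already closed, and the two tails accumulate only over segments that do not
contain `t`. -/
theorem eq_of_mem_closure (D : ArcChart P τ h) {v : V} {x : F} (hx : x ∈ closure (openArc sm v))
    {t : ℝ} (ht : t ∈ Ioo (-(1 / 2) : ℝ) (1 / 2)) (hxt : φ x = h (pr t)) : x = sm v t := by
  have habs : |t| < 1 / 2 := abs_lt.mpr ht
  obtain ⟨s, hs, hs'⟩ := exists_between habs
  obtain ⟨h1, h2⟩ := abs_lt.mp hs
  have hsplit : Ioo (-(1 / 2) : ℝ) (1 / 2) ⊆
      Icc (-s) s ∪ (Ioo (-(1 / 2)) (-s) ∪ Ioo s (1 / 2)) := by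
    intro r hr
    rcases lt_or_ge r (-s) with h | h
    · exact Or.inr (Or.inl ⟨hr.1, h⟩)
    · rcases lt_or_ge s r with h' | h'
      · exact Or.inr (Or.inr ⟨h', hr.2⟩)
      · exact Or.inl ⟨h, h'⟩
  have hmid : Icc (-s) s ⊆ Ioo (-(1 / 2) : ℝ) (1 / 2) := fun r hr =>
    ⟨by linarith [hr.1], by linarith [hr.2]⟩
  have hx' := closure_mono (image_mono hsplit) hx
  have hinj : ∀ {r : ℝ}, r ∈ Icc (-(1 / 2) : ℝ) (1 / 2) → φ x = h (pr r) → r = t := by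
    intro r hr e
    exact_mod_cast D.chart_injOn (abs_le_one_of_mem hr) (abs_le_one_of_mem (Ioo_subset_Icc_self ht))
      (e.symm.trans hxt)
  rw [image_union, image_union, closure_union, closure_union] at hx'
  rcases hx' with hx' | hx' | hx'
  · rw [(isCompact_Icc.image_of_continuousOn
      ((S.continuousOn_arc v).mono hmid)).isClosed.closure_eq] at hx'
    obtain ⟨r, hr, rfl⟩ := hx'
    simp only
    rw [hinj (Ioo_subset_Icc_self (hmid hr)) (S.liftLower v _ (mem_lowerDisk_of_mem_Ioo (hmid hr)))]
  · obtain ⟨r, hr, e⟩ := S.exists_mem_Icc_of_mem_closure D (lo := -(1 / 2)) (hi := -s)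
      Ioo_subset_Icc_self (fun r hr => ⟨hr.1, by linarith [hr.2]⟩) hx'
    have := hinj ⟨hr.1, by linarith [hr.2]⟩ e
    linarith [hr.2]
  · obtain ⟨r, hr, e⟩ := S.exists_mem_Icc_of_mem_closure D (lo := s) (hi := 1 / 2)
      Ioo_subset_Icc_self (fun r hr => ⟨by linarith [hr.1], hr.2⟩) hx'
    have := hinj ⟨by linarith [hr.1], hr.2⟩ e
    linarith [hr.1]

omit S in
theorem image_innerRay_right (v : V) :
    (fun z => sm v (1 / 2 + z)) '' innerRay (1 / 2) = (fun t : ℝ => sm v t) '' Ico 0 (1 / 2) := by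
  rw [innerRay, image_image]
  ext x
  constructor
  · rintro ⟨t, ht, rfl⟩
    refine ⟨1 / 2 - t, ⟨by linarith [ht.2], by linarith [ht.1]⟩, ?_⟩
    simp only
    congr 1
    push_cast
    ring
  · rintro ⟨t, ht, rfl⟩
    refine ⟨1 / 2 - t, ⟨by linarith [ht.2], by linarith [ht.1]⟩, ?_⟩
    simp only
    congr 1
    push_cast
    ring

theorem image_innerRay_left (hφ : IsBranchedAlong φ P) (D : ArcChart P τ h) (v : V) :
    (fun z => sp v (-(1 / 2 + z))) '' innerRay (1 / 2) =
      (fun t : ℝ => sm v t) '' Ioc (-(1 / 2)) 0 := by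
  have hmid : ∀ t : ℝ, t ∈ Ioo (-(1 / 2) : ℝ) (1 / 2) → sm v (t : ℂ) = sp v t := fun t ht =>
    S.eq_mid hφ D.twoPunctured v ht.1 ht.2
  rw [innerRay, image_image]
  ext x
  constructor
  · rintro ⟨t, ht, rfl⟩
    refine ⟨t - 1 / 2, ⟨by linarith [ht.1], by linarith [ht.2]⟩, ?_⟩
    simp only
    rw [hmid _ ⟨by linarith [ht.1], by linarith [ht.2]⟩]
    congr 1
    push_cast
    ring
  · rintro ⟨t, ht, rfl⟩
    refine ⟨t + 1 / 2, ⟨by linarith [ht.1], by linarith [ht.2]⟩, ?_⟩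
    simp only
    rw [hmid _ ⟨ht.1, by linarith [ht.2]⟩]
    congr 1
    push_cast
    ring

theorem mem_closure_right (D : ArcChart P τ h) {v : V} {x : F} (hx : x ∈ closure (openArc sm v))
    (hxt : φ x = h (pr (1 / 2))) : x ∈ closure ((fun z => sm v (1 / 2 + z)) '' innerRay (1 / 2)) := by
  have hsplit : Ioo (-(1 / 2) : ℝ) (1 / 2) ⊆ Ioc (-(1 / 2)) 0 ∪ Ico 0 (1 / 2) := by
    intro r hr
    rcases le_total r 0 with h | h
    exacts [Or.inl ⟨hr.1, h⟩, Or.inr ⟨h, hr.2⟩]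
  have hx' := closure_mono (image_mono hsplit) hx
  rw [image_union, closure_union] at hx'
  rw [image_innerRay_right]
  refine hx'.resolve_left fun hx' => ?_
  obtain ⟨r, hr, e⟩ := S.exists_mem_Icc_of_mem_closure D (lo := -(1 / 2)) (hi := 0)
    Ioc_subset_Icc_self (fun r hr => ⟨hr.1, by linarith [hr.2]⟩) hx'
  have : (r : ℂ) = ((1 / 2 : ℝ) : ℂ) := D.chart_injOn
    (abs_le_one_of_mem ⟨hr.1, by linarith [hr.2]⟩) (by norm_num) (e.symm.trans (by
      rw [hxt]; push_cast; rfl))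
  have := Complex.ofReal_injective this
  linarith [hr.2]

theorem mem_closure_left (hφ : IsBranchedAlong φ P) (D : ArcChart P τ h) {v : V} {x : F}
    (hx : x ∈ closure (openArc sm v)) (hxt : φ x = h (pr (-(1 / 2)))) :
    x ∈ closure ((fun z => sp v (-(1 / 2 + z))) '' innerRay (1 / 2)) := by
  have hsplit : Ioo (-(1 / 2) : ℝ) (1 / 2) ⊆ Ioc (-(1 / 2)) 0 ∪ Ico 0 (1 / 2) := by
    intro r hr
    rcases le_total r 0 with h | h
    exacts [Or.inl ⟨hr.1, h⟩, Or.inr ⟨h, hr.2⟩]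
  have hx' := closure_mono (image_mono hsplit) hx
  rw [image_union, closure_union] at hx'
  rw [S.image_innerRay_left hφ D]
  refine hx'.resolve_right fun hx' => ?_
  obtain ⟨r, hr, e⟩ := S.exists_mem_Icc_of_mem_closure D (lo := 0) (hi := 1 / 2)
    Ico_subset_Icc_self (fun r hr => ⟨by linarith [hr.1], hr.2⟩) hx'
  have : (r : ℂ) = ((-(1 / 2) : ℝ) : ℂ) := D.chart_injOn
    (abs_le_one_of_mem ⟨by linarith [hr.1], hr.2⟩) (by norm_num) (e.symm.trans (by
      rw [hxt]; push_cast; rfl))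
  have := Complex.ofReal_injective this
  linarith [hr.1]

theorem closure_right_subset (v : V) :
    closure ((fun z => sm v (1 / 2 + z)) '' innerRay (1 / 2)) ⊆ closure (openArc sm v) := by
  rw [image_innerRay_right]
  exact closure_mono (image_mono fun r hr => ⟨by linarith [hr.1], hr.2⟩)

theorem closure_left_subset (hφ : IsBranchedAlong φ P) (D : ArcChart P τ h) (v : V) :
    closure ((fun z => sp v (-(1 / 2 + z))) '' innerRay (1 / 2)) ⊆ closure (openArc sm v) := by
  rw [S.image_innerRay_left hφ D]
  exact closure_mono (image_mono fun r hr => ⟨hr.1, by linarith [hr.2]⟩)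

theorem exists_mem_closure_inter_right (hφ : IsBranchedAlong φ P) (D : ArcChart P τ h) (v : V) :
    (closure (openArc sm v) ∩ closure (openArc sm (a v))).Nonempty := by
  obtain ⟨x, -, h1, h2⟩ := S.half_right.exists_common_limit hφ D.punctureChart_right v
  exact ⟨x, S.closure_right_subset v h1, S.closure_right_subset _ h2⟩

theorem exists_mem_closure_inter_left (hφ : IsBranchedAlong φ P) (D : ArcChart P τ h) (v : V) :
    (closure (openArc sm v) ∩ closure (openArc sm (b v))).Nonempty := by
  obtain ⟨x, -, h1, h2⟩ := S.neg.half_right.exists_common_limit hφ D.punctureChart_left v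
  exact ⟨x, S.closure_left_subset hφ D v h1, S.closure_left_subset hφ D _ h2⟩

theorem exists_mem_closure_openArc (hφ : IsBranchedAlong φ P) (D : ArcChart P τ h) {x : F} {t : ℝ}
    (ht : t ∈ Icc (-(1 / 2) : ℝ) (1 / 2)) (hx : φ x = h (pr t)) :
    ∃ v, x ∈ closure (openArc sm v) := by
  rcases ht.1.eq_or_lt with h1 | h1
  · obtain ⟨v, hv⟩ := S.neg.half_right.exists_mem_closure hφ D.punctureChart_left (x := x) (by
      rw [hx, ← h1]
      simp)
    exact ⟨v, S.closure_left_subset hφ D v hv⟩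
  rcases ht.2.eq_or_lt with h2 | h2
  · obtain ⟨v, hv⟩ := S.half_right.exists_mem_closure hφ D.punctureChart_right (x := x) (by
      rw [hx, h2]
      simp)
    exact ⟨v, S.closure_right_subset v hv⟩
  · obtain ⟨v, rfl⟩ := S.surj_lower hφ D.twoPunctured (mem_lowerDisk_of_mem_Ioo ⟨h1, h2⟩) hx
    exact ⟨v, subset_closure ⟨t, ⟨h1, h2⟩, rfl⟩⟩

/-- Over interior points distinct lifts of the arc are disjoint; over an end of the arc the double
periodicity allows only the lift itself and its partner under `a` or `b`. -/
theorem eq_or_eq_of_mem_closure (hφ : IsBranchedAlong φ P) (D : ArcChart P τ h)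
    (hr : DoublePeriodic φ (fun z => h (pr (1 / 2 + z))) (1 / 2))
    (hl : DoublePeriodic φ (fun z => h (pr (-(1 / 2 + z)))) (1 / 2)) {v w : V} {x : F}
    (hv : x ∈ closure (openArc sm v)) (hw : x ∈ closure (openArc sm w)) :
    w = v ∨ w = a v ∨ w = b v := by
  obtain ⟨t, ht, hx⟩ := S.exists_mem_Icc_of_mem_closure D Ioo_subset_Icc_self subset_rfl hv
  rcases ht.1.eq_or_lt with h1 | h1
  · have hx' : φ x = h (pr (-(1 / 2))) := by
      rw [hx, ← h1]
      simp
    have := S.neg.half_right.eq_or_eq_of_mem_closure hφ D.punctureChart_left hl (x := x)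
      (by rw [hx']; simp) (S.mem_closure_left hφ D hv hx') (S.mem_closure_left hφ D hw hx')
    tauto
  rcases ht.2.eq_or_lt with h2 | h2
  · have hx' : φ x = h (pr (1 / 2)) := by
      rw [hx, h2]
      simp
    have := S.half_right.eq_or_eq_of_mem_closure hφ D.punctureChart_right hr (x := x)
      (by rw [hx']; simp) (S.mem_closure_right D hv hx') (S.mem_closure_right D hw hx')
    tauto
  · refine Or.inl (S.inj_lower hφ D.twoPunctured (mem_lowerDisk_of_mem_Ioo ⟨h1, h2⟩) ?_)
    rw [← S.eq_of_mem_closure D hv ⟨h1, h2⟩ hx, ← S.eq_of_mem_closure D hw ⟨h1, h2⟩ hx]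

/-- The components of the preimage of the arc are the unions of the closed lifts of the arc with
indices in an orbit. -/
theorem mem_component_iff [Finite V] (hφ : IsBranchedAlong φ P) (D : ArcChart P τ h)
    (hr : DoublePeriodic φ (fun z => h (pr (1 / 2 + z))) (1 / 2))
    (hl : DoublePeriodic φ (fun z => h (pr (-(1 / 2 + z)))) (1 / 2))
    (hα : α = (fun t : ℝ => h (pr t)) '' Icc (-(1 / 2)) (1 / 2)) {R : Set V} {v : V} (hv : v ∈ R)
    (hRa : ∀ w ∈ R, a w ∈ R) (hRb : ∀ w ∈ R, b w ∈ R)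
    (hR : ∀ Q : V → Prop, Q v → (∀ w, Q w → Q (a w)) → (∀ w, Q w → Q (b w)) → ∀ w ∈ R, Q w)
    {x : F} (hx : x ∈ closure (openArc sm v)) :
    connectedComponentIn (φ ⁻¹' α) x = ⋃ w ∈ R, closure (openArc sm w) := by
  have hsub : ∀ w, closure (openArc sm w) ⊆ φ ⁻¹' α := by
    intro w y hy
    obtain ⟨t, ht, e⟩ := S.exists_mem_Icc_of_mem_closure D Ioo_subset_Icc_self subset_rfl hy
    rw [hα]
    exact ⟨t, ht, e.symm⟩
  have hpre : ∀ w, IsPreconnected (closure (openArc sm w)) := fun w =>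
    (S.isPreconnected_openArc w).closure
  have hstep : ∀ w w', closure (openArc sm w) ⊆ connectedComponentIn (φ ⁻¹' α) x →
      (closure (openArc sm w) ∩ closure (openArc sm w')).Nonempty →
      closure (openArc sm w') ⊆ connectedComponentIn (φ ⁻¹' α) x := by
    rintro w w' hw ⟨y, h1, h2⟩
    rw [connectedComponentIn_eq (hw h1)]
    exact (hpre w').subset_connectedComponentIn h2 (hsub w')
  have hxα := hsub v hx
  apply Subset.antisymm
  · have hclosed : ∀ T : Set V, IsClosed (⋃ w ∈ T, closure (openArc sm w)) := fun T =>
      T.toFinite.isClosed_biUnion fun w _ => isClosed_closure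
    -- The lifts with indices in `R` and those with indices outside of it form two disjoint closed
    -- sets covering the preimage, closed because there are finitely many, so a component lies in
    -- one of them.
    have hdisj : Disjoint (⋃ w ∈ R, closure (openArc sm w)) (⋃ w ∈ Rᶜ, closure (openArc sm w)) := by
      rw [Set.disjoint_left]
      intro y hy hy'
      obtain ⟨w, hw, h1⟩ := mem_iUnion₂.mp hy
      obtain ⟨w', hw', h2⟩ := mem_iUnion₂.mp hy'
      rcases S.eq_or_eq_of_mem_closure hφ D hr hl h1 h2 with rfl | rfl | rfl
      exacts [hw' hw, hw' (hRa _ hw), hw' (hRb _ hw)]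
    refine (isPreconnected_iff_subset_of_disjoint_closed.mp
      isPreconnected_connectedComponentIn _ _ (hclosed R) (hclosed Rᶜ) ?_ ?_).resolve_right ?_
    · intro y hy
      have hyα := connectedComponentIn_subset _ _ hy
      rw [hα] at hyα
      obtain ⟨t, ht, e⟩ := hyα
      obtain ⟨w, hw⟩ := S.exists_mem_closure_openArc hφ D ht e.symm
      by_cases hwR : w ∈ R
      · exact Or.inl (mem_biUnion hwR hw)
      · exact Or.inr (mem_biUnion (s := Rᶜ) hwR hw)
    · rw [hdisj.inter_eq, inter_empty]
    · intro h
      exact Set.disjoint_left.mp hdisj (mem_biUnion hv hx) (h (mem_connectedComponentIn hxα))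
  · refine iUnion₂_subset (hR _ ?_ ?_ ?_)
    · exact (hpre v).subset_connectedComponentIn hx (hsub v)
    · exact fun w hw => hstep w _ hw (S.exists_mem_closure_inter_right hφ D w)
    · exact fun w hw => hstep w _ hw (S.exists_mem_closure_inter_left hφ D w)

end ArcSections

end Components

end ArcTwist

namespace ArcTwist

/-! ### Orbits of two involutions -/

section Orbits

variable {V : Type*} {a b : V → V}

/-- Two involutions without nonzero alternating functions have the same orbits as their product. -/
theorem exists_zpow_eq_of_alternating (ha : Function.Involutive a) (hb : Function.Involutive b)
    (hε : ∀ ε : V → ℤ, (∀ v, ε (a v) = -ε v) → (∀ v, ε (b v) = -ε v) → ∀ v, ε v = 0) (v : V) :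
    ∃ i : ℤ, ((hb.toPerm * ha.toPerm) ^ i) v = a v := by
  classical
  set r := hb.toPerm * ha.toPerm with hr
  have hstep : ∀ w, (∃ i : ℤ, (r ^ i) v = b (a w)) ↔ ∃ i : ℤ, (r ^ i) v = w := by
    intro w
    have hw : b (a w) = r w := rfl
    rw [hw]
    constructor
    · rintro ⟨i, hi⟩
      refine ⟨-1 + i, ?_⟩
      rw [zpow_add, Equiv.Perm.mul_apply, hi, zpow_neg_one, Equiv.Perm.inv_eq_iff_eq]
    · rintro ⟨i, hi⟩
      refine ⟨1 + i, ?_⟩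
      rw [zpow_add, Equiv.Perm.mul_apply, hi, zpow_one]
  -- `ε` is the indicator of the cycle of `v` minus its composite with `a`. It is alternating under
  -- `a` by construction and under `b` because the cycle is invariant under `b a`. If `a v` were not
  -- in the cycle, `ε v` would be `1`.
  let ε : V → ℤ := fun w => (if ∃ i : ℤ, (r ^ i) v = w then 1 else 0) -
    if ∃ i : ℤ, (r ^ i) v = a w then 1 else 0
  have h0 : ε v = 0 := by
    refine hε ε (fun w => ?_) (fun w => ?_) v
    · simp only [ε, ha w]
      ring
    · have h1 := hstep (a w)
      have h2 := hstep (a (b w))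
      rw [ha] at h1 h2
      rw [hb] at h2
      simp only [ε, h1, ← h2]
      ring
  have h1 : ∃ i : ℤ, (r ^ i) v = v := ⟨0, by simp⟩
  by_contra h2
  simp only [ε, if_pos h1, if_neg h2] at h0
  norm_num at h0

end Orbits

/-! ### Degrees as cycle lengths -/

section Degree

set_option linter.unusedSectionVars false

variable {F : Type*} [TopologicalSpace F] [CompactSpace F] [T2Space F] {V : Type*} [Finite V]
  {φ : C(F, Disk)} {P α : Set Disk} {τ : Disk ≃ₜ Disk} {h : Disk → Disk} {sm sp : V → ℂ → F}
  {a b : V → V}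

/-- In the absence of alternating functions the orbits of `a` and `b` are single cycles of `b a`.
Each lift of the arc has one point over `q`, so the degree of a component is the length of its
cycle; a power of a permutation is trivial exactly when all cycle lengths divide the exponent. -/
theorem ArcSections.zpow_eq_one_iff_forall_degreeAt_dvd
    (S : ArcSections φ (fun z => h (pr z)) sm sp a b) (hφ : IsBranchedAlong φ P)
    (D : ArcChart P τ h) (hr : DoublePeriodic φ (fun z => h (pr (1 / 2 + z))) (1 / 2))
    (hl : DoublePeriodic φ (fun z => h (pr (-(1 / 2 + z)))) (1 / 2))
    (hα : α = (fun t : ℝ => h (pr t)) '' Icc (-(1 / 2)) (1 / 2))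
    (ha : Function.Involutive a) (hb : Function.Involutive b)
    (hε : ∀ ε : V → ℤ, (∀ v, ε (a v) = -ε v) → (∀ v, ε (b v) = -ε v) → ∀ v, ε v = 0)
    {q : Disk} (hq : q ∈ α \ P) (k : ℤ) :
    (hb.toPerm * ha.toPerm) ^ k = 1 ↔ ∀ β, IsComponentOver φ α β → (degreeAt φ q β : ℤ) ∣ k := by
  classical
  set r := hb.toPerm * ha.toPerm with hr'
  have hra : ∀ v, r v = b (a v) := fun v => rfl
  have hcomp : ∀ v, ∀ x ∈ closure (openArc sm v), connectedComponentIn (φ ⁻¹' α) x =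
      ⋃ w ∈ MulAction.orbit (Subgroup.zpowers r) v, closure (openArc sm w) := by
    intro v x hx
    have hmem : ∀ w, w ∈ MulAction.orbit (Subgroup.zpowers r) v ↔ ∃ i : ℤ, (r ^ i) v = w := by
      intro w
      constructor
      · rintro ⟨⟨_, i, rfl⟩, rfl⟩
        exact ⟨i, rfl⟩
      · rintro ⟨i, rfl⟩
        exact ⟨⟨r ^ i, i, rfl⟩, rfl⟩
    have hRa : ∀ w ∈ MulAction.orbit (Subgroup.zpowers r) v,
        a w ∈ MulAction.orbit (Subgroup.zpowers r) v := by
      intro w hw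
      obtain ⟨i, rfl⟩ := (hmem w).mp hw
      obtain ⟨j, hj⟩ := exists_zpow_eq_of_alternating ha hb hε ((r ^ i) v)
      exact (hmem _).mpr ⟨j + i, by rw [zpow_add, Equiv.Perm.mul_apply, hj]⟩
    refine S.mem_component_iff hφ D hr hl hα (MulAction.mem_orbit_self v) hRa ?_ ?_ hx
    · intro w hw
      obtain ⟨i, hi⟩ := (hmem _).mp (hRa w hw)
      refine (hmem _).mpr ⟨1 + i, ?_⟩
      rw [zpow_add, Equiv.Perm.mul_apply, hi, zpow_one, hra, ha]
    · intro Q hQ hQa hQb w hw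
      obtain ⟨i, rfl⟩ := (hmem w).mp hw
      induction i using Int.induction_on with
      | zero => exact hQ
      | succ i ih =>
        rw [add_comm, zpow_add, Equiv.Perm.mul_apply, zpow_one, hra]
        exact hQb _ (hQa _ (ih ((hmem _).mpr ⟨_, rfl⟩)))
      | pred i ih =>
        have e : (r ^ (-(i : ℤ) - 1)) v = a (b ((r ^ (-(i : ℤ))) v)) := by
          rw [sub_eq_neg_add, zpow_add, Equiv.Perm.mul_apply, zpow_neg_one, Equiv.Perm.inv_eq_iff_eq,
            hra, ha, hb]
        rw [e]
        exact hQa _ (hQb _ (ih ((hmem _).mpr ⟨_, rfl⟩)))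
  obtain ⟨t₀, ht₀, rfl⟩ : ∃ t ∈ Ioo (-(1 / 2) : ℝ) (1 / 2), h (pr t) = q := by
    obtain ⟨hqα, hqP⟩ := hq
    rw [hα] at hqα
    obtain ⟨t, ht, rfl⟩ := hqα
    simp only [D.mem_iff _ (abs_le_one_of_mem ht)] at hqP
    refine ⟨t, ⟨ht.1.lt_of_ne fun e => hqP (Or.inr ?_), ht.2.lt_of_ne fun e => hqP (Or.inl ?_)⟩, rfl⟩
    · rw [← e]
      push_cast
      rfl
    · rw [e]
      push_cast
      rfl
  have hlow := mem_lowerDisk_of_mem_Ioo ht₀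
  have hdeg : ∀ v, ∀ x ∈ closure (openArc sm v),
      degreeAt φ (h (pr t₀)) (connectedComponentIn (φ ⁻¹' α) x) =
        Function.minimalPeriod (r • ·) v := by
    intro v x hx
    have : φ ⁻¹' {h (pr t₀)} ∩ (⋃ w ∈ MulAction.orbit (Subgroup.zpowers r) v, closure (openArc sm w))
        = (fun w => sm w (t₀ : ℂ)) '' MulAction.orbit (Subgroup.zpowers r) v := by
      ext y
      constructor
      · rintro ⟨hy, hy'⟩
        obtain ⟨w, hw, hyw⟩ := mem_iUnion₂.mp hy'
        exact ⟨w, hw, (S.eq_of_mem_closure D hyw ht₀ hy).symm⟩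
      · rintro ⟨w, hw, rfl⟩
        exact ⟨S.liftLower w _ hlow, mem_biUnion hw (subset_closure ⟨t₀, ht₀, rfl⟩)⟩
    have hfin := Fintype.ofFinite (MulAction.orbit (Subgroup.zpowers r) v)
    rw [degreeAt, hcomp v x hx, this, MulAction.minimalPeriod_eq_card, Set.ncard_image_of_injective,
      ← Nat.card_coe_set_eq, Nat.card_eq_fintype_card]
    exact fun w w' e => S.inj_lower hφ D.twoPunctured hlow e
  rw [Equiv.ext_iff]
  constructor
  · rintro hk _ ⟨x, hx, rfl⟩
    rw [hα] at hx
    obtain ⟨t, ht, e⟩ := hx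
    obtain ⟨v, hv⟩ := S.exists_mem_closure_openArc hφ D ht e.symm
    rw [hdeg v x hv, ← MulAction.zpow_smul_eq_iff_minimalPeriod_dvd]
    exact hk v
  · intro hk v
    have hx : sm v t₀ ∈ closure (openArc sm v) := subset_closure ⟨t₀, ht₀, rfl⟩
    have := hk _ ⟨sm v t₀, ?_, rfl⟩
    · rw [hdeg v _ hx, ← MulAction.zpow_smul_eq_iff_minimalPeriod_dvd] at this
      exact this
    · rw [mem_preimage, S.liftLower v _ hlow, hα]
      exact ⟨t₀, Ioo_subset_Icc_self ht₀, rfl⟩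

/-- The fibre is discrete, being a fibre of a covering, and compact, being closed in `F`. -/
theorem IsBranchedAlong.finite_fibre_of_notMem (hφ : IsBranchedAlong φ P) {y : Disk} (hy : y ∉ P) :
    Finite {x // φ x = y} := by
  have hd : DiscreteTopology (φ ⁻¹' {y}) := (hφ.covering y hy).1
  have hc : CompactSpace (φ ⁻¹' {y}) :=
    isCompact_iff_compactSpace.mp (isClosed_singleton.preimage φ.continuous).isCompact
  exact finite_of_compact_of_discrete (X := (φ ⁻¹' {y} : Set F))

theorem IsArcJoining.two_le {n : ℕ} {H : Disk ≃ₜ Disk} (hα : IsArcJoining (punctures n H) α) :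
    2 ≤ n := by
  obtain ⟨γ, hγ, -, -, hγP⟩ := hα
  obtain ⟨i, hi⟩ := (hγP 0).mpr (Or.inl rfl)
  obtain ⟨j, hj⟩ := (hγP 1).mpr (Or.inr rfl)
  have hij : i ≠ j := by
    rintro rfl
    exact zero_ne_one (hγ (hi.symm.trans hj))
  have := Fin.val_ne_of_ne hij
  omega

theorem norm_lt_one_of_mem_punctures {n : ℕ} {H : Disk ≃ₜ Disk} {p : Disk}
    (hp : p ∈ punctures n H) : ‖(p : ℂ)‖ < 1 := by
  obtain ⟨j, rfl⟩ := hp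
  refine (norm_coe_le _).lt_of_ne fun e => ?_
  have := norm_homeomorph_eq_one H.symm e
  rw [H.symm_apply_apply, stdPoint, norm_mul, Complex.norm_exp_ofReal_mul_I, Complex.norm_real] at this
  norm_num at this

end Degree

end ArcTwist
end

/-! ### Assembly -/

theorem mainTheorem6 {F : Type*} [TopologicalSpace F] [CompactSpace F] [T2Space F]
    {V : Type*} [Finite V] (G : SimpleGraph V) (hG : G.IsTree)
    (n : ℕ) (c : G.lineGraph.Coloring (Fin n)) (H : ArcTwist.Disk ≃ₜ ArcTwist.Disk)
    (φ : C(F, ArcTwist.Disk))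
    (hφ : ArcTwist.IsBranchedCover φ (ArcTwist.punctures n H))
    (hrep : ArcTwist.IsRepresentedBy φ H c)
    (α : Set ArcTwist.Disk) (hα : ArcTwist.IsArcJoining (ArcTwist.punctures n H) α)
    (τ : ArcTwist.Disk ≃ₜ ArcTwist.Disk)
    (hτ : ArcTwist.IsHalfArcTwist (ArcTwist.punctures n H) α τ)
    (q : ArcTwist.Disk) (hq : q ∈ α \ ArcTwist.punctures n H) (k : ℤ) :
    ArcTwist.Lifts φ (τ ^ k) ↔
      ∀ β : Set F, ArcTwist.IsComponentOver φ α β → (ArcTwist.degreeAt φ q β : ℤ) ∣ k := by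
  -- The distinct ends of the arc are two punctures, so the sectors have angle at most `π`.
  have hn := hα.two_le
  have : NeZero n := ⟨by omega⟩
  have hφ := hφ.isBranchedAlong
  obtain ⟨h, hemb, hlt, hseg, hrange, htwist, hfixed⟩ := hτ
  have D₀ : ArcTwist.TwistChart (ArcTwist.punctures n H) τ h := ⟨hemb, hlt, htwist, hfixed⟩
  have D : ArcTwist.ArcChart (ArcTwist.punctures n H) τ h :=
    ⟨D₀, fun z hz => D₀.mem_punctures_iff hα hseg hrange hz, ArcTwist.finite_punctures,
      fun p hp => ArcTwist.norm_lt_one_of_mem_punctures hp⟩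
  obtain ⟨e, he⟩ := hrep
  have T := ArcTwist.isTreeAction_rho hG c
  obtain ⟨s, SS⟩ := ArcTwist.exists_sectorSections hn hφ he
  -- The sections are indexed by the fibre over the midpoint of the arc, whereas those over the
  -- sectors are indexed by the vertices of the graph; no identification of the two is needed.
  obtain ⟨sm, sp, a, b, S⟩ := ArcTwist.ArcSections.exists_sections hφ D.twoPunctured
  have := hφ.finite_fibre_of_notMem (y := h (ArcTwist.pr 0))
    (D.twoPunctured.off 0 (by simp) (by norm_num) (by norm_num))
  have hr := SS.doublePeriodic T hn hφ D.punctureChart_right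
  have hl := SS.doublePeriodic T hn hφ D.punctureChart_left
  have ha : Function.Involutive a := S.half_right.involutive hφ D.punctureChart_right hr
  have hb : Function.Involutive b := S.neg.half_right.involutive hφ D.punctureChart_left hl
  rw [D.lifts_iff hφ S ha hb]
  refine S.zpow_eq_one_iff_forall_degreeAt_dvd hφ D hr hl ?_ ha hb
    (fun ε h1 h2 => D.alternating_eq_zero hn hφ SS T S h1 h2) hq k
  rw [← hseg]
  ext x
  constructor
  · rintro ⟨w, ⟨hw, hw'⟩, rfl⟩
    refine ⟨(w : ℂ).re, abs_le.mp hw', ?_⟩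
    have : (((w : ℂ).re : ℝ) : ℂ) = w := Complex.ext (by simp) (by simpa using hw.symm)
    simp only
    rw [this, ArcTwist.pr_coe]
  · rintro ⟨t, ht, rfl⟩
    refine ⟨ArcTwist.pr t, ?_, rfl⟩
    rw [Set.mem_ofPred_eq, ArcTwist.coe_pr (ArcTwist.abs_le_one_of_mem ht)]
    exact ⟨by simp, by simpa using abs_le.mpr ht⟩
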